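/- **Proposition 3.1.** Let $\gamma>0$ and $0<\varepsilon<\tfrac1{12}$. There are constants $C>0$ and $n_0$, depending only on $\gamma$ and $\varepsilon$, such that the following holds for all $n\ge n_0$. Let $G$ be a simple undirected graph with vertices $v_1,\dots,v_n$, all of even degree, and edge set $EG$; let $Q$ be its Laplacian matrix (degrees on the diagonal, $-1$ at adjacent pairs, $0$ elsewhere), with eigenvalues $\lambda_1\le\lambda_2\le\dots\le\lambda_n$, and suppose that $\lambda_2\ge\gamma n$. For $\xi\in\mathbb R^n$ write $\Delta_{jk}=\xi_j-\xi_k$, and for $x\in\mathbb R$ write $|x|_\pi=\min_{l\in\mathbb Z}|x+\pi l|$. Let $$V_0=\{\xi\in\mathbb R^n:\ |\xi_j|\le\pi/2 \text{ for all } j,\ \ |\xi_j-\xi_k|_\pi\le n^{-1/2+\varepsilon}\text{ for all }j,k\}.$$ For each $r$ let $\mathcal T_r$ be the set of directed trees obtained from the spanning trees of $G$ by directing all edges towards the root $v_r$ (so that $v_r$ has out-degree $0$ and every other vertex has out-degree $1$), and put $$S_0=\frac1n\sum_{r=1}^n\int_{V_0}\ \prod_{\{v_j,v_k\}\in EG}\cos\Delta_{jk}\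 \sum_{T\in\mathcal T_r}\ \prod_{(v_j,v_k)\in ET}\bigl(1+i\tan\Delta_{jk}\bigr)\,d\xi .$$ Let $J$ be the $n\times n$ matrix with all entries $1$, let $W=(Q+J)^{-1}$, let $\alpha\in\mathbb R^n$ be the vector with $\alpha_j=W_{jj}$, and let $\Lambda(\xi)$ be the diagonal matrix whose diagonal is the vector $Q\xi$. Put $$\mathrm{Int}=\int_{|\xi_j|\le n^{-1/2+\varepsilon}\ \forall j}\exp\Bigl(i\,\xi^{T}Q\alpha-\tfrac12\,\xi^{T}(Q+J)\xi-\tfrac1{12}\sum_{\{v_j,v_k\}\in EG}\Delta_{jk}^4+\tfrac12\operatorname{tr}\bigl(\Lambda(\xi)W\Lambda(\xi)W\bigr)\Bigr)\,d\xi .$$ Then there is a complex number $\delta$ with $|\delta|\le C\,n^{-1/2+6\varepsilon}$ such that $$S_0=(1+\delta)\,2^{-1/2}\,\pi^{1/2}\,n^{-1}\,\det(Q+J)\,\mathrm{Int}.$$ -/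

import Mathlib

noncomputable section

namespace EulerianCircuits

open MeasureTheory

/-- The cube `{ξ ∈ ℝⁿ : |ξ_j| ≤ ρ for all j}`. -/
def cube (n : ℕ) (ρ : ℝ) : Set (Fin n → ℝ) := {ξ | ∀ j, |ξ j| ≤ ρ}

/-- The distance `|x|_π = min_{l ∈ ℤ} |x + π l|` from `x` to the lattice `π ℤ`. -/
def distPi (x : ℝ) : ℝ := ⨅ l : ℤ, |x + Real.pi * l|

/-- The main region: the points `ξ` of the cube `|ξ_j| ≤ π / 2` such that
`|ξ_j - ξ_k|_π ≤ n ^ (-1/2 + ε)` for all `j, k`. -/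
def mainRegion (n : ℕ) (ε : ℝ) : Set (Fin n → ℝ) :=
  {ξ | ξ ∈ cube n (Real.pi / 2) ∧
    ∀ j k, distPi (ξ j - ξ k) ≤ (n : ℝ) ^ (-(1 / 2 : ℝ) + ε)}

section DirectedTrees

variable {V : Type*}

/-- A directed graph on `V` is given by its set of arcs, `(a, b)` being the arc from `a` to `b`.
This is the undirected graph obtained by forgetting directions. -/
def underlyingGraph (A : Finset (V × V)) : SimpleGraph V :=
  SimpleGraph.fromRel fun a b => (a, b) ∈ A

/-- A directed tree with root `r` (and vertex set `V`): a connected directed graph in which `r`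
has out-degree zero and every other vertex has out-degree one. -/
structure IsDirectedTree (A : Finset (V × V)) (r : V) : Prop where
  connected : (underlyingGraph A).Connected
  root_out : ∀ w, (r, w) ∉ A
  other_out : ∀ v, v ≠ r → ∃! w, (v, w) ∈ A

/-- The arc set `A` arises from the undirected graph `T` by giving each edge exactly one of its
two directions. -/
def IsOrientation (A : Finset (V × V)) (T : SimpleGraph V) : Prop :=
  (∀ a b, T.Adj a b ↔ (a, b) ∈ A ∨ (b, a) ∈ A) ∧ ∀ a b, (a, b) ∈ A → (b, a) ∉ A

open Classical in
/-- The set of directed trees with root `r` obtained by orienting the spanning trees of `G`. -/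
def rootedSpanningTrees [Fintype V] (G : SimpleGraph V) (r : V) : Finset (Finset (V × V)) :=
  Finset.univ.filter fun A =>
    IsDirectedTree A r ∧ ∃ T : SimpleGraph V, T ≤ G ∧ T.IsTree ∧ IsOrientation A T

end DirectedTrees

section Integrals

variable {n : ℕ} (G : SimpleGraph (Fin n)) [DecidableRel G.Adj]

/-- `cos Δ_{jk}`, where `Δ_{jk} = ξ_j - ξ_k`, as a function of the edge `{j, k}`. -/
def edgeCos (ξ : Fin n → ℝ) : Sym2 (Fin n) → ℝ :=
  Sym2.lift ⟨fun j k => Real.cos (ξ j - ξ k), fun j k => by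
    change Real.cos (ξ j - ξ k) = Real.cos (ξ k - ξ j)
    rw [← Real.cos_neg, neg_sub]⟩

/-- `Δ_{jk} ^ 4`, where `Δ_{jk} = ξ_j - ξ_k`, as a function of the edge `{j, k}`. -/
def edgeQuartic (ξ : Fin n → ℝ) : Sym2 (Fin n) → ℝ :=
  Sym2.lift ⟨fun j k => (ξ j - ξ k) ^ 4, fun j k => by ring⟩

/-- `∏_{edges} cos Δ_{jk} * ∑_T ∏_{(j, k) ∈ T} (1 + i tan Δ_{jk})`, where `T` runs over the
directed trees with root `r` obtained from the spanning trees of `G`. -/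
def integrand (r : Fin n) (ξ : Fin n → ℝ) : ℂ :=
  ((∏ e ∈ G.edgeFinset, edgeCos ξ e : ℝ) : ℂ) *
    ∑ T ∈ rootedSpanningTrees G r,
      ∏ a ∈ T, (1 + Complex.I * ((Real.tan (ξ a.1 - ξ a.2) : ℝ) : ℂ))

/-- The contribution of the main region, averaged over the root. -/
def S₀ (ε : ℝ) : ℂ :=
  (1 / (n : ℂ)) * ∑ r : Fin n, ∫ ξ in mainRegion n ε, integrand G r ξ

/-- `Q + J`, with `Q` the Laplacian matrix of `G` and `J` the all-ones matrix. -/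
def Qhat : Matrix (Fin n) (Fin n) ℝ := G.lapMatrix ℝ + Matrix.of fun _ _ => 1

/-- `W = (Q + J)⁻¹`. -/
def W : Matrix (Fin n) (Fin n) ℝ := (Qhat G)⁻¹

/-- `α_j = W_jj`. -/
def α : Fin n → ℝ := fun j => W G j j

/-- The diagonal matrix whose diagonal is the vector `Q ξ`. -/
def Lam (ξ : Fin n → ℝ) : Matrix (Fin n) (Fin n) ℝ :=
  Matrix.diagonal ((G.lapMatrix ℝ).mulVec ξ)

/-- `R(ξ) = tr (Λ(ξ) W Λ(ξ) W)`. -/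
def R (ξ : Fin n → ℝ) : ℝ := (Lam G ξ * W G * Lam G ξ * W G).trace

/-- The integral over the cube `|ξ_j| ≤ n ^ (-1/2 + ε)` of
`exp (i ξᵀ Q α - ½ ξᵀ (Q + J) ξ - (1/12) ∑_{edges} Δ_{jk} ^ 4 + ½ R(ξ))`. -/
def mainIntegral (ε : ℝ) : ℂ :=
  ∫ ξ in cube n ((n : ℝ) ^ (-(1 / 2 : ℝ) + ε)),
    Complex.exp
      (Complex.I * ((ξ ⬝ᵥ (G.lapMatrix ℝ).mulVec (α G) : ℝ) : ℂ) +
        ((-(1 / 2) * (ξ ⬝ᵥ (Qhat G).mulVec ξ)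
          - (1 / 12) * ∑ e ∈ G.edgeFinset, edgeQuartic ξ e
          + (1 / 2) * R G ξ : ℝ) : ℂ))

/-- The eigenvalues of the Laplacian matrix of `G`, with multiplicity, in non-decreasing order
(Mathlib's `eigenvalues₀` lists them in non-increasing order). -/
def laplacianEigenvalues : Fin (Fintype.card (Fin n)) → ℝ := fun i =>
  (G.posSemidef_lapMatrix ℝ).isHermitian.eigenvalues₀ i.rev

/-- The algebraic connectivity `λ₂` (with value `0` if there are fewer than two vertices). -/
def algebraicConnectivity : ℝ :=
  if h : 1 < Fintype.card (Fin n) then laplacianEigenvalues G ⟨1, h⟩ else 0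

/-- `G` is `γ`-mixing: its algebraic connectivity is at least `γ` times its number of vertices. -/
def IsMixing (γ : ℝ) : Prop := γ * (n : ℝ) ≤ algebraicConnectivity G

end Integrals

end EulerianCircuits

end

noncomputable section

namespace EulerianCircuits

open MeasureTheory

/-! ### The directed matrix-tree theorem -/

section MatrixTree

variable {V : Type*}

/-! The tree sum becomes a determinant, the determinant is expanded to second order, and the
resulting additive error is made relative by showing that the oscillating integral is not small.

By the directed matrix-tree theorem the sum over trees rooted at `r` is a principal cofactor of the
Laplacian with arc weights `1 + i tan Δ`. Summing over roots gives the trace of its adjugate, which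
is `det (L + J) / n` (`card_mul_trace_adjugate`). Here `L + J = (Q + J)(1 + X)` with `X = i W (D +
A)`, where `D` is the diagonal matrix of the sums of tangents and `A` is antisymmetric. Since `W`
has operator norm at most `1 / (κ n)`, `det (1 + X)` is close to `exp (tr X - tr X² / 2)`. The
traces that are linear in `A` vanish by symmetry, and replacing tangents by their arguments leaves
`i ξᵀQα + R / 2`. Each edge cosine is `exp (-Δ² / 2 - Δ⁴ / 12)` up to a factor `1 + O(Δ⁶)`. Together
these match the integrand pointwise with that of the main integral (`HasGap.integrand_expansion`).

The domains are matched by two invariances. Even degrees make the integrand invariant under `π ℤⁿ`,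
so the cube may be replaced by a sheared cell in which being near the lattice diagonal means being
near the diagonal. The integrand is also invariant under diagonal translations, so the cut-off on
one coordinate can be exchanged for the weight `exp (-(∑ ξ)² / 2)`. This supplies the `J` in the
quadratic form and the constant factor (`S₀_eq`).

Pointwise closeness bounds the error only by a multiple of the Gaussian mass, so a lower bound of
the same order is needed for the modulus of the main integral in spite of the phase `i a · ξ`, `a =
Qα`. Scale the phase by `t`, call the integral over the whole space `φ(t)`, and integrate by parts
in the direction `W a`. This gives `φ' = -t v φ + O(n^(-1/2))` with `v = aᵀ W a` bounded, hence
`φ(1)` is at least a constant times `φ(0)`, up to a vanishing error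
(`HasGap.le_norm_integral_cexp_mainExponent`). Gaussian tails make all truncations negligible. -/

/-- Every point is mapped to `r` by some iterate of `f`. -/
def Reaches (f : V → V) (r : V) : Prop := ∀ v, ∃ k, f^[k] v = r


/-- The number of steps needed to reach `r` is such a depth. It is used to triangularise the matrix
of `f`, to connect every vertex to the root, and to exclude pairs of opposite arcs. -/
theorem Reaches.exists_depth {r : V} {f : V → V} (h : Reaches f r) :
    ∃ d : V → ℕ, ∀ v, v ≠ r → d (f v) < d v := by
  classical
  refine ⟨fun v => Nat.find (h v), fun v hv => ?_⟩
  have h1 := Nat.find_spec (h v)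
  obtain ⟨m, hm⟩ : ∃ m, Nat.find (h v) = m + 1 := by
    refine Nat.exists_eq_succ_of_ne_zero fun h0 => hv ?_
    rw [h0] at h1
    exact h1
  rw [hm, Function.iterate_succ_apply] at h1
  change Nat.find (h (f v)) < Nat.find (h v)
  rw [hm]
  exact Nat.lt_succ_of_le (Nat.find_min' _ h1)

theorem underlyingGraph_adj {A : Finset (V × V)} {a b : V} :
    (underlyingGraph A).Adj a b ↔ a ≠ b ∧ ((a, b) ∈ A ∨ (b, a) ∈ A) := by
  simp [underlyingGraph]

variable [Fintype V] [DecidableEq V]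

/-- The matrix with rows `e_v - e_{f v}` for `v ≠ r` and `e_r` for `v = r`. -/
def functionalMatrix (r : V) (f : V → V) : Matrix V V ℂ := fun v =>
  if v = r then Pi.single r 1 else Pi.single v 1 - Pi.single (f v) 1

/-- The indicator of the points whose orbit misses `r` is a nonzero kernel vector, since a point `v
≠ r` and its image `f v` both miss `r` or both reach it. -/
theorem det_functionalMatrix_of_not_reaches {r : V} {f : V → V} (h : ¬ Reaches f r) :
    (functionalMatrix r f).det = 0 := by
  classical
  rw [← Matrix.exists_mulVec_eq_zero_iff]
  refine ⟨fun v => if ∃ k, f^[k] v = r then 0 else 1, ?_, ?_⟩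
  · intro h0
    apply h
    intro v
    by_contra hv
    have := congrFun h0 v
    simp only [if_neg hv] at this
    exact one_ne_zero this
  · funext v
    by_cases hv : v = r
    · subst hv
      simp only [Matrix.mulVec, functionalMatrix, if_true, single_dotProduct, Pi.zero_apply]
      rw [if_pos ⟨0, rfl⟩, mul_zero]
    · simp only [Matrix.mulVec, functionalMatrix, if_neg hv, sub_dotProduct, single_dotProduct,
        Pi.zero_apply, one_mul]
      have : (∃ k, f^[k] v = r) ↔ ∃ k, f^[k] (f v) = r := by
        constructor
        · rintro ⟨k, hk⟩
          cases k with
          | zero => exact absurd hk hv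
          | succ k => exact ⟨k, by rwa [Function.iterate_succ_apply] at hk⟩
        · rintro ⟨k, hk⟩
          exact ⟨k + 1, by rwa [Function.iterate_succ_apply]⟩
      simp only [this, sub_self]

/-- Off the diagonal, row `v` is supported at `f v`, which has smaller depth. Ordering by depth,
with the order reversed to fit the convention of `BlockTriangular`, makes the matrix triangular with
unit diagonal. -/
theorem det_functionalMatrix_of_reaches {r : V} {f : V → V} (h : Reaches f r) :
    (functionalMatrix r f).det = 1 := by
  obtain ⟨d, hd⟩ := h.exists_depth
  have hne : ∀ v u, d v ≤ d u → v ≠ u → functionalMatrix r f v u = 0 := by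
    intro v u hvu hne
    by_cases hv : v = r
    · subst hv
      simp [functionalMatrix, hne.symm]
    · have : u ≠ f v := by
        rintro rfl
        exact absurd (hd v hv) (not_lt.mpr hvu)
      simp [functionalMatrix, hv, hne.symm, this]
  have hone : ∀ v, functionalMatrix r f v v = 1 := by
    intro v
    by_cases hv : v = r
    · subst hv
      simp [functionalMatrix]
    · have : v ≠ f v := by
        intro h'
        have := hd v hv
        rw [← h'] at this
        exact lt_irrefl _ this
      simp [functionalMatrix, hv, this]
  have hB : (functionalMatrix r f).BlockTriangular (fun v => OrderDual.toDual (d v)) := by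
    intro v u hvu
    have h1 : d v < d u := hvu
    exact hne v u h1.le (by rintro rfl; exact lt_irrefl _ h1)
  rw [hB.det]
  refine Finset.prod_eq_one fun a _ => ?_
  have : (functionalMatrix r f).toSquareBlock (fun v => OrderDual.toDual (d v)) a = 1 := by
    ext ⟨v, hv⟩ ⟨u, hu⟩
    simp only [Matrix.toSquareBlock, Matrix.toSquareBlockProp, Matrix.one_apply,
      Subtype.mk.injEq]
    split_ifs with h'
    · subst h'
      exact hone v
    · refine hne v u (le_of_eq ?_) h'
      exact OrderDual.toDual.injective (hv.trans hu.symm)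
  rw [this, Matrix.det_one]

/-- The weighted Laplacian of a weight function on arcs. -/
def weightedLaplacian (w : V → V → ℂ) : Matrix V V ℂ :=
  Matrix.diagonal (fun v => ∑ u, w v u) - Matrix.of w

-- Row `v` of the Laplacian is `∑ u, w v u • (e_v - e_u)`, and the cofactor replaces row `r` by
-- `e_r`. Multilinearity expands the determinant over all choices `u = f v`, and each resulting
-- determinant is 1 or 0 according to whether `f` leads every vertex to `r`.
open Classical in
theorem adjugate_weightedLaplacian (w : V → V → ℂ) (r : V) :
    (weightedLaplacian w).adjugate r r =
      ∑ f : V → V with f r = r ∧ Reaches f r, ∏ v ∈ Finset.univ.erase r, w v (f v) := by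
  rw [Matrix.adjugate_apply]
  -- Row `r` is written as a sum with the single admissible choice `u = r`, so that the expansion
  -- runs over all maps `f` and the coefficient forces `f r = r`.
  set c : V → V → ℂ := fun v u => if v = r then (if u = r then 1 else 0) else w v u with hc
  have hrow : (weightedLaplacian w).updateRow r (Pi.single r 1) = fun v => ∑ u, c v u •
      ((if v = r then Pi.single r 1 else Pi.single v 1 - Pi.single u 1 : V → ℂ)) := by
    funext v x
    by_cases hv : v = r
    · subst hv
      rw [Matrix.updateRow_self, Finset.sum_apply, Finset.sum_eq_single v]
      · simp [hc]
      · intro u _ hu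
        simp [hc, hu]
      · simp
    · rw [Matrix.updateRow_ne hv]
      simp only [hc, if_neg hv, Finset.sum_apply, Pi.smul_apply, Pi.sub_apply, smul_eq_mul,
        mul_sub, Finset.sum_sub_distrib, weightedLaplacian, Matrix.sub_apply, Matrix.of_apply,
        Matrix.diagonal_apply, Pi.single_apply]
      congr 1
      · rw [← Finset.sum_mul]
        by_cases hx : v = x
        · simp [hx]
        · simp [hx, Ne.symm hx]
      · simp
  rw [hrow]
  have h1 := (Matrix.detRowAlternating (n := V) (R := ℂ)).toMultilinearMap.map_sum
    (fun v u => c v u •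
      ((if v = r then Pi.single r 1 else Pi.single v 1 - Pi.single u 1 : V → ℂ)))
  change Matrix.det _ = _ at h1
  rw [h1]
  have h2 : ∀ f : V → V, (Matrix.detRowAlternating (n := V) (R := ℂ)).toMultilinearMap
      (fun v => c v (f v) • ((if v = r then Pi.single r 1 else
        Pi.single v 1 - Pi.single (f v) 1 : V → ℂ))) =
      (∏ v, c v (f v)) * (functionalMatrix r f).det := fun f =>
    (Matrix.detRowAlternating (n := V) (R := ℂ)).toMultilinearMap.map_smul_univ _ _
  rw [Finset.sum_congr rfl fun f _ => h2 f, Finset.sum_filter]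
  refine Finset.sum_congr rfl fun f _ => ?_
  have h3 : ∏ v, c v (f v) =
      (if f r = r then 1 else 0) * ∏ v ∈ Finset.univ.erase r, w v (f v) := by
    rw [← Finset.mul_prod_erase _ _ (Finset.mem_univ r)]
    congr 1
    · simp [hc]
    · refine Finset.prod_congr rfl fun v hv => ?_
      simp [hc, Finset.ne_of_mem_erase hv]
  rw [h3]
  by_cases hf : Reaches f r
  · rw [det_functionalMatrix_of_reaches hf]
    by_cases hr : f r = r <;> simp [hf, hr]
  · rw [det_functionalMatrix_of_not_reaches hf]
    simp [hf]

/-- The arcs `(v, f v)`, `v ≠ r`. -/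
def arcsOf (r : V) (f : V → V) : Finset (V × V) :=
  (Finset.univ.erase r).image fun v => (v, f v)

theorem mem_arcsOf {r : V} {f : V → V} {a b : V} :
    (a, b) ∈ arcsOf r f ↔ a ≠ r ∧ b = f a := by
  simp only [arcsOf, Finset.mem_image, Finset.mem_erase, Finset.mem_univ, and_true,
    Prod.mk.injEq]
  constructor
  · rintro ⟨v, hv, rfl, rfl⟩
    exact ⟨hv, rfl⟩
  · rintro ⟨h1, h2⟩
    exact ⟨a, h1, rfl, h2.symm⟩

/-- Following `f` decreases the depth, so every vertex is connected to `r`. A connected graph with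
at most `card V - 1` edges is a tree. -/
theorem arcsOf_mem_rootedSpanningTrees {G : SimpleGraph V} {r : V} {f : V → V}
    (hf : Reaches f r) (hG : ∀ v, v ≠ r → G.Adj v (f v)) :
    arcsOf r f ∈ rootedSpanningTrees G r := by
  classical
  obtain ⟨d, hd⟩ := hf.exists_depth
  have hadj : ∀ v, v ≠ r → (underlyingGraph (arcsOf r f)).Adj v (f v) := fun v hv =>
    underlyingGraph_adj.2 ⟨(hG v hv).ne, Or.inl (mem_arcsOf.2 ⟨hv, rfl⟩)⟩
  have hreach : ∀ k v, d v ≤ k → (underlyingGraph (arcsOf r f)).Reachable v r := by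
    intro k
    induction k with
    | zero =>
      intro v hv
      by_cases h : v = r
      · subst h; rfl
      · have := hd v h
        omega
    | succ k ih =>
      intro v hv
      by_cases h : v = r
      · subst h; rfl
      · exact (hadj v h).reachable.trans (ih _ (by have := hd v h; omega))
  have hconn : (underlyingGraph (arcsOf r f)).Connected := by
    have : Nonempty V := ⟨r⟩
    exact ⟨fun a b => (hreach _ a le_rfl).trans (hreach _ b le_rfl).symm⟩
  simp only [rootedSpanningTrees, Finset.mem_filter, Finset.mem_univ, true_and]
  refine ⟨⟨hconn, fun w hw => (mem_arcsOf.1 hw).1 rfl, fun v hv =>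
    ⟨f v, mem_arcsOf.2 ⟨hv, rfl⟩, fun w hw => (mem_arcsOf.1 hw).2⟩⟩,
    underlyingGraph (arcsOf r f), ?_, ?_, ?_, ?_⟩
  · intro a b hab
    obtain ⟨-, h | h⟩ := underlyingGraph_adj.1 hab
    · obtain ⟨h1, rfl⟩ := mem_arcsOf.1 h
      exact hG a h1
    · obtain ⟨h1, rfl⟩ := mem_arcsOf.1 h
      exact (hG b h1).symm
  · rw [SimpleGraph.isTree_iff_connected_and_card]
    refine ⟨hconn, le_antisymm ?_ hconn.card_vert_le_card_edgeSet_add_one⟩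
    have hsub : (underlyingGraph (arcsOf r f)).edgeSet ⊆
        (((Finset.univ.erase r).image fun v => s(v, f v) : Finset (Sym2 V)) : Set (Sym2 V)) := by
      intro e
      induction e using Sym2.ind with
      | _ a b =>
        intro hab
        rw [SimpleGraph.mem_edgeSet] at hab
        simp only [Finset.coe_image, Set.mem_image, Finset.mem_coe, Finset.mem_erase,
          Finset.mem_univ, and_true]
        obtain ⟨-, h | h⟩ := underlyingGraph_adj.1 hab
        · obtain ⟨h1, rfl⟩ := mem_arcsOf.1 h
          exact ⟨a, h1, rfl⟩
        · obtain ⟨h1, rfl⟩ := mem_arcsOf.1 h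
          exact ⟨b, h1, Sym2.eq_swap⟩
    have h1 : Nat.card (underlyingGraph (arcsOf r f)).edgeSet ≤
        ((Finset.univ.erase r).image fun v => s(v, f v) : Finset (Sym2 V)).card := by
      have := Set.ncard_le_ncard hsub (Finset.finite_toSet _)
      rwa [Set.ncard_coe_finset] at this
    have h2 := h1.trans Finset.card_image_le
    rw [Finset.card_erase_of_mem (Finset.mem_univ r), Finset.card_univ] at h2
    rw [Nat.card_eq_fintype_card (α := V)]
    have : 0 < Fintype.card V := Fintype.card_pos_iff.2 ⟨r⟩
    omega
  · intro a b
    rw [underlyingGraph_adj]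
    refine ⟨fun h => h.2, fun h => ⟨?_, h⟩⟩
    rintro rfl
    have h' : (a, a) ∈ arcsOf r f := by simpa using h
    obtain ⟨h1, h2⟩ := mem_arcsOf.1 h'
    exact (hG a h1).ne h2
  · intro a b hab hba
    obtain ⟨h1, rfl⟩ := mem_arcsOf.1 hab
    obtain ⟨h2, h3⟩ := mem_arcsOf.1 hba
    have e1 := hd a h1
    have e2 := hd _ h2
    rw [← h3] at e2
    omega

/-- The map is the out-neighbour map, extended by fixing `r`. Having an orbit that meets `r` is
invariant along the edges of the underlying graph, so connectedness spreads it from `r` to every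
vertex. -/
theorem exists_arcsOf_eq {G : SimpleGraph V} {r : V} {A : Finset (V × V)}
    (hA : A ∈ rootedSpanningTrees G r) :
    ∃ f : V → V, f r = r ∧ Reaches f r ∧ (∀ v, v ≠ r → G.Adj v (f v)) ∧ arcsOf r f = A := by
  classical
  simp only [rootedSpanningTrees, Finset.mem_filter, Finset.mem_univ, true_and] at hA
  obtain ⟨hD, T, hTG, -, hO⟩ := hA
  choose! g hg hg' using hD.other_out
  set f : V → V := fun v => if v = r then r else g v with hf
  have hfr : f r = r := by simp [hf]
  have hfv : ∀ v, v ≠ r → f v = g v := fun v hv => by simp [hf, hv]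
  have hmem : ∀ a b, (a, b) ∈ A → a ≠ r ∧ b = f a := by
    intro a b hab
    have h1 : a ≠ r := by
      rintro rfl
      exact hD.root_out b hab
    exact ⟨h1, by rw [hfv a h1]; exact hg' a h1 b hab⟩
  have hstep : ∀ v, v ≠ r → ((∃ k, f^[k] v = r) ↔ ∃ k, f^[k] (f v) = r) := by
    intro v hv
    constructor
    · rintro ⟨k, hk⟩
      cases k with
      | zero => exact absurd hk hv
      | succ k => exact ⟨k, by rwa [Function.iterate_succ_apply] at hk⟩
    · rintro ⟨k, hk⟩
      exact ⟨k + 1, by rwa [Function.iterate_succ_apply]⟩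
  have hadj : ∀ a b, (underlyingGraph A).Adj a b →
      ((∃ k, f^[k] a = r) ↔ ∃ k, f^[k] b = r) := by
    intro a b hab
    obtain ⟨-, h | h⟩ := underlyingGraph_adj.1 hab
    · obtain ⟨h1, rfl⟩ := hmem _ _ h
      exact hstep a h1
    · obtain ⟨h1, rfl⟩ := hmem _ _ h
      exact (hstep b h1).symm
  refine ⟨f, hfr, ?_, ?_, ?_⟩
  · intro v
    have key : ∀ a b, (underlyingGraph A).Walk a b →
        ((∃ k, f^[k] a = r) ↔ ∃ k, f^[k] b = r) := by
      intro a b p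
      induction p with
      | nil => rfl
      | cons h p ih => exact (hadj _ _ h).trans ih
    obtain ⟨p⟩ := hD.connected.preconnected v r
    exact (key v r p).2 ⟨0, rfl⟩
  · intro v hv
    exact hTG ((hO.1 v (f v)).2 (Or.inl (by rw [hfv v hv]; exact hg v hv)))
  · ext ⟨a, b⟩
    rw [mem_arcsOf]
    refine ⟨?_, hmem a b⟩
    rintro ⟨h1, rfl⟩
    rw [hfv a h1]
    exact hg a h1

/-- The matrix-tree theorem for arc weights supported on the arcs of a graph. -/
theorem sum_rootedSpanningTrees_prod (G : SimpleGraph V) (w : V → V → ℂ)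
    (hw : ∀ a b, ¬ G.Adj a b → w a b = 0) (r : V) :
    ∑ T ∈ rootedSpanningTrees G r, ∏ a ∈ T, w a.1 a.2 =
      (weightedLaplacian w).adjugate r r := by
  classical
  rw [adjugate_weightedLaplacian]
  have h1 : ∑ f : V → V with f r = r ∧ Reaches f r, ∏ v ∈ Finset.univ.erase r, w v (f v) =
      ∑ f : V → V with (f r = r ∧ Reaches f r) ∧ ∀ v, v ≠ r → G.Adj v (f v),
        ∏ v ∈ Finset.univ.erase r, w v (f v) := by
    rw [Finset.sum_filter, Finset.sum_filter]
    refine Finset.sum_congr rfl fun f _ => ?_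
    by_cases h : ∀ v, v ≠ r → G.Adj v (f v)
    · exact if_congr (and_iff_left h).symm rfl rfl
    · rw [if_neg (fun h' : (f r = r ∧ Reaches f r) ∧ _ => h h'.2)]
      push Not at h
      obtain ⟨v, hv, hadj⟩ := h
      have h0 : ∏ v ∈ Finset.univ.erase r, w v (f v) = 0 :=
        Finset.prod_eq_zero (i := v) (Finset.mem_erase.2 ⟨hv, Finset.mem_univ v⟩) (hw _ _ hadj)
      rw [h0, ite_self]
  rw [h1]
  symm
  refine Finset.sum_bij (fun f _ => arcsOf r f) ?_ ?_ ?_ ?_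
  · intro f hf
    simp only [Finset.mem_filter, Finset.mem_univ, true_and] at hf
    exact arcsOf_mem_rootedSpanningTrees hf.1.2 hf.2
  · intro f hf g hg hfg
    simp only [Finset.mem_filter, Finset.mem_univ, true_and] at hf hg
    funext v
    by_cases hv : v = r
    · subst hv
      rw [hf.1.1, hg.1.1]
    · have : (v, f v) ∈ arcsOf r g := hfg ▸ mem_arcsOf.2 ⟨hv, rfl⟩
      exact (mem_arcsOf.1 this).2
  · intro A hA
    obtain ⟨f, h1, h2, h3, h4⟩ := exists_arcsOf_eq hA
    exact ⟨f, by simp only [Finset.mem_filter, Finset.mem_univ, true_and]; exact ⟨⟨h1, h2⟩, h3⟩,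
      h4⟩
  · intro f _
    rw [arcsOf, Finset.prod_image]
    intro a _ b _ hab
    exact (Prod.mk.inj hab).1

/-- If all row sums of `L` vanish, the trace of its adjugate is `det (L + J) / n`. -/
theorem card_mul_trace_adjugate (L : Matrix V V ℂ) (hL : L.mulVec 1 = 0) [Nonempty V] :
    (Fintype.card V : ℂ) * ∑ r, L.adjugate r r =
      (L + Matrix.of fun _ _ => (1 : ℂ)).det := by
  set M : Matrix V V ℂ := L + Matrix.of fun _ _ => (1 : ℂ) with hM
  have hcard : (Fintype.card V : ℂ) ≠ 0 := by exact_mod_cast Fintype.card_ne_zero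
  have hupd : ∀ (A : Matrix V V ℂ) (r : V),
      (A.updateRow r 1).det = ∑ i, A.adjugate i r := by
    intro A r
    rw [Matrix.det_eq_sum_mul_adjugate_row _ r]
    refine Finset.sum_congr rfl fun i _ => ?_
    rw [Matrix.updateRow_self, Pi.one_apply, one_mul, Matrix.adjugate_apply,
      Matrix.adjugate_apply, Matrix.updateRow_idem]
  -- With row `r` replaced by `e_i - e_r` all row sums still vanish, so the determinant is zero.
  -- Hence each column of the adjugate is constant.
  have hrow : ∀ i r, L.adjugate i r = L.adjugate r r := by
    intro i r
    have h0 : (L.updateRow r (Pi.single i 1 - Pi.single r 1)).det = 0 := by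
      rw [← Matrix.exists_mulVec_eq_zero_iff]
      refine ⟨1, one_ne_zero, ?_⟩
      funext v
      by_cases hv : v = r
      · subst hv
        simp [Matrix.mulVec, dotProduct, Finset.sum_sub_distrib]
      · have := congrFun hL v
        simpa [Matrix.mulVec, Matrix.updateRow_ne hv] using this
    have h1 := Matrix.det_updateRow_add L r (Pi.single i 1 - Pi.single r 1) (Pi.single r 1)
    rw [sub_add_cancel, h0, zero_add] at h1
    rw [Matrix.adjugate_apply, Matrix.adjugate_apply, h1]
  -- Once row `r` consists of ones, adding `J` to the other rows only adds row `r` to each of them.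
  have hML : ∀ r, (M.updateRow r 1).det = (L.updateRow r 1).det := by
    intro r
    refine Matrix.det_eq_of_forall_row_eq_smul_add_const
      (fun v => if v = r then 0 else 1) r (by simp) ?_
    intro i j
    by_cases hi : i = r
    · subst hi
      simp
    · simp [hi, hM]
  have hM1 : M.mulVec 1 = (Fintype.card V : ℂ) • (1 : V → ℂ) := by
    rw [hM, Matrix.add_mulVec, hL, zero_add]
    funext v
    simp [Matrix.mulVec, dotProduct]
  -- The all-ones vector is an eigenvector of `M` with eigenvalue `card V`; apply `adjugate M * M =
  -- det M` to it.
  have hadj : ∀ i, (Fintype.card V : ℂ) * ∑ r, M.adjugate i r = M.det := by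
    intro i
    have h1 : M.adjugate.mulVec (M.mulVec 1) = M.det • (1 : V → ℂ) := by
      rw [Matrix.mulVec_mulVec, Matrix.adjugate_mul, Matrix.smul_mulVec, Matrix.one_mulVec]
    rw [hM1, Matrix.mulVec_smul] at h1
    have := congrFun h1 i
    simpa [Matrix.mulVec, dotProduct] using this
  have h2 : (Fintype.card V : ℂ) * ∑ i, ∑ r, M.adjugate i r = Fintype.card V * M.det := by
    rw [Finset.mul_sum, Finset.sum_congr rfl fun i _ => hadj i]
    simp
  rw [← mul_left_cancel₀ hcard h2]
  rw [Finset.sum_comm (f := fun i r => M.adjugate i r), Finset.mul_sum]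
  refine Finset.sum_congr rfl fun r _ => ?_
  rw [← hupd M r, hML, hupd, Finset.sum_congr rfl fun i _ => hrow i r]
  simp

theorem weightedLaplacian_mulVec_one (w : V → V → ℂ) : (weightedLaplacian w).mulVec 1 = 0 := by
  funext v
  rw [weightedLaplacian, Matrix.sub_mulVec, Pi.sub_apply, Matrix.mulVec_diagonal]
  simp [Matrix.mulVec, dotProduct]

end MatrixTree

/-! ### A determinant expansion to second order -/

section DetExpansion

open scoped Matrix.Norms.Frobenius

variable {V : Type*} [Fintype V] [DecidableEq V]

theorem frobenius_sq (A : Matrix V V ℂ) : ‖A‖ ^ 2 = ∑ i, ∑ j, ‖A i j‖ ^ 2 := by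
  rw [Matrix.frobenius_norm_def, ← Real.sqrt_eq_rpow, Real.sq_sqrt]
  · norm_cast
  · positivity

theorem norm_trace_mul_le (A B : Matrix V V ℂ) : ‖(A * B).trace‖ ≤ ‖A‖ * ‖B‖ := by
  have h1 : ‖(A * B).trace‖ ≤ ∑ p : V × V, ‖A p.1 p.2‖ * ‖B p.2 p.1‖ := by
    rw [Fintype.sum_prod_type]
    simp only [Matrix.trace, Matrix.diag_apply, Matrix.mul_apply]
    refine (norm_sum_le _ _).trans (Finset.sum_le_sum fun i _ => (norm_sum_le _ _).trans ?_)
    exact le_of_eq (Finset.sum_congr rfl fun j _ => norm_mul _ _)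
  have h2 := Finset.sum_mul_sq_le_sq_mul_sq (Finset.univ : Finset (V × V))
    (fun p => ‖A p.1 p.2‖) (fun p => ‖B p.2 p.1‖)
  have h3 : ∑ p : V × V, ‖A p.1 p.2‖ ^ 2 = ‖A‖ ^ 2 := by
    rw [Fintype.sum_prod_type, frobenius_sq]
  have h4 : ∑ p : V × V, ‖B p.2 p.1‖ ^ 2 = ‖B‖ ^ 2 := by
    rw [Fintype.sum_prod_type, Finset.sum_comm, frobenius_sq]
  rw [h3, h4, ← mul_pow] at h2
  exact h1.trans (abs_le_of_sq_le_sq' h2 (by positivity)).2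

/-- Here `Y` plays the role of `(1 + tX)⁻¹ X`. From `1 + sX = (1 + tX)(1 + (s - t)Y)` the derivative
reduces to the linear coefficient of `det (1 + zY)` at `z = 0`. -/
theorem hasDerivAt_det_one_add_smul (X Y : Matrix V V ℂ) (t : ℝ)
    (hY : (1 + (t : ℂ) • X) * Y = X) :
    HasDerivAt (fun s : ℝ => (1 + (s : ℂ) • X).det) ((1 + (t : ℂ) • X).det * Y.trace) t := by
  have hfac : ∀ s : ℝ, (1 + (s : ℂ) • X).det =
      (1 + (t : ℂ) • X).det * (1 + ((s - t : ℝ) : ℂ) • Y).det := by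
    intro s
    rw [← Matrix.det_mul, mul_add, mul_one, Matrix.mul_smul, hY]
    congr 1
    push_cast
    rw [sub_smul]
    abel
  have h1 : ∀ s : ℝ, (1 + (s : ℂ) • X).det = (1 + (t : ℂ) • X).det *
      (1 + Y.trace * ((s - t : ℝ) : ℂ) +
        (Matrix.det (1 + (Polynomial.X : Polynomial ℂ) • Y.map Polynomial.C)).divX.divX.eval
          (((s - t : ℝ) : ℂ)) * ((s - t : ℝ) : ℂ) ^ 2) := by
    intro s
    rw [hfac s, Matrix.det_one_add_smul ((s - t : ℝ) : ℂ) Y]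
  set p := (Matrix.det (1 + (Polynomial.X : Polynomial ℂ) • Y.map Polynomial.C)).divX.divX
  have hlin : HasDerivAt (fun s : ℝ => ((s - t : ℝ) : ℂ)) 1 t := by
    simpa using ((hasDerivAt_id t).sub_const t).ofReal_comp
  have hp : HasDerivAt (fun s : ℝ => p.eval ((s - t : ℝ) : ℂ))
      (p.derivative.eval ((t - t : ℝ) : ℂ) * 1) t :=
    HasDerivAt.comp (h₂ := fun z => p.eval z) t (p.hasDerivAt ((t - t : ℝ) : ℂ)) hlin
  have h2 := (((hlin.const_mul Y.trace).const_add 1).add (hp.mul (hlin.pow 2))).const_mul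
    ((1 + (t : ℂ) • X).det)
  rw [funext h1]
  refine h2.congr_deriv ?_
  simp

/-- The logarithmic derivative in `t` of `det (1 + tX) exp (-t tr X + t² tr X² / 2)` is `t² tr
(XYX)` with `Y = (1 + tX)⁻¹ X`, and Grönwall's inequality integrates its bound. Keeping the operator
bound `θ` separate from the Frobenius norm matters: the error is `θ ‖X‖²`, whereas `‖X‖³` would be
too large. -/
theorem norm_det_one_add_mul_exp_sub_one_le (X : Matrix V V ℂ) {θ : ℝ} (hθ0 : 0 ≤ θ)
    (hθ : θ ≤ 1 / 2) (hX : ∀ M : Matrix V V ℂ, ‖X * M‖ ≤ θ * ‖M‖) :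
    ‖(1 + X).det * Complex.exp (-X.trace + (X * X).trace / 2) - 1‖ ≤
      Real.exp (2 * θ * ‖X‖ ^ 2) - 1 := by
  set η := 2 * θ * ‖X‖ ^ 2 with hη
  have hη0 : 0 ≤ η := by positivity
  set f : ℝ → ℂ := fun t => (1 + (t : ℂ) • X).det *
    Complex.exp (-((t : ℂ) * X.trace) + (t : ℂ) ^ 2 * (X * X).trace / 2) with hf
  have hinv : ∀ t ∈ Set.Icc (0 : ℝ) 1, (1 + (t : ℂ) • X).det ≠ 0 := by
    intro t ht h0
    obtain ⟨v, hv0, hv⟩ := Matrix.exists_mulVec_eq_zero_iff.2 h0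
    -- The hypothesis on `X` concerns matrices, so the kernel vector is repeated in every column.
    set M : Matrix V V ℂ := Matrix.of fun i _ => v i with hM
    have h1 : M = -((t : ℂ) • (X * M)) := by
      rw [eq_neg_iff_add_eq_zero]
      ext i j
      have := congrFun hv i
      rw [Matrix.add_mulVec, Matrix.one_mulVec, Matrix.smul_mulVec] at this
      simpa [hM, Matrix.mul_apply, Matrix.mulVec, dotProduct] using this
    have h2 : ‖M‖ ≤ 1 * (θ * ‖M‖) := by
      conv_lhs => rw [h1]
      rw [norm_neg, norm_smul, Complex.norm_real, Real.norm_of_nonneg ht.1]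
      exact mul_le_mul ht.2 (hX M) (norm_nonneg _) zero_le_one
    have h3 : ‖M‖ = 0 := by nlinarith [norm_nonneg M]
    rw [norm_eq_zero] at h3
    apply hv0
    funext i
    exact congrFun (congrFun h3 i) i
  have key : ∀ t ∈ Set.Icc (0 : ℝ) 1, ∃ u : ℂ, ‖u‖ ≤ η ∧ HasDerivAt f (f t * u) t := by
    intro t ht
    set Y := (1 + (t : ℂ) • X)⁻¹ * X with hY
    have hY1 : (1 + (t : ℂ) • X) * Y = X := by
      rw [hY, ← mul_assoc, Matrix.mul_nonsing_inv _ (isUnit_iff_ne_zero.2 (hinv t ht)), one_mul]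
    have hY2 : Y = X - (t : ℂ) • (X * Y) := by
      rw [eq_sub_iff_add_eq, ← Matrix.smul_mul]
      rw [add_mul, one_mul] at hY1
      exact hY1
    have ht1 : ‖(t : ℂ)‖ ≤ 1 := by
      rw [Complex.norm_real, Real.norm_of_nonneg ht.1]
      exact ht.2
    have hYn : ‖Y‖ ≤ 2 * ‖X‖ := by
      have h1 : ‖Y‖ ≤ ‖X‖ + ‖(t : ℂ) • (X * Y)‖ := by
        conv_lhs => rw [hY2]
        exact norm_sub_le _ _
      have h2 : ‖(t : ℂ) • (X * Y)‖ ≤ 1 * (θ * ‖Y‖) := by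
        rw [norm_smul]
        exact mul_le_mul ht1 (hX Y) (norm_nonneg _) zero_le_one
      nlinarith [norm_nonneg Y]
    -- Substitute `Y = X - t X Y` into itself once.
    have htr : Y.trace = X.trace - t * (X * X).trace + (t : ℂ) ^ 2 * (X * Y * X).trace := by
      have h1 : X * Y = X * X - (t : ℂ) • (X * X * Y) := by
        conv_lhs => rw [hY2]
        rw [mul_sub, Matrix.mul_smul, mul_assoc]
      have h2 : (X * Y * X).trace = (X * X * Y).trace := by
        rw [Matrix.trace_mul_comm, mul_assoc]
      have h3 : Y.trace = X.trace - t * (X * Y).trace := by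
        conv_lhs => rw [hY2]
        rw [Matrix.trace_sub, Matrix.trace_smul, smul_eq_mul]
      have h4 : (X * Y).trace = (X * X).trace - t * (X * X * Y).trace := by
        conv_lhs => rw [h1]
        rw [Matrix.trace_sub, Matrix.trace_smul, smul_eq_mul]
      rw [h3, h4, h2]
      ring
    refine ⟨(t : ℂ) ^ 2 * (X * Y * X).trace, ?_, ?_⟩
    · rw [norm_mul, norm_pow]
      have h1 : ‖(X * Y * X).trace‖ ≤ η := by
        refine (norm_trace_mul_le _ _).trans ?_
        have : ‖X * Y‖ ≤ θ * (2 * ‖X‖) := (hX Y).trans (mul_le_mul_of_nonneg_left hYn hθ0)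
        calc ‖X * Y‖ * ‖X‖ ≤ θ * (2 * ‖X‖) * ‖X‖ :=
              mul_le_mul_of_nonneg_right this (norm_nonneg _)
          _ = η := by rw [hη]; ring
      calc ‖(t : ℂ)‖ ^ 2 * ‖(X * Y * X).trace‖ ≤ 1 * ‖(X * Y * X).trace‖ :=
            mul_le_mul_of_nonneg_right (pow_le_one₀ (norm_nonneg _) ht1) (norm_nonneg _)
        _ ≤ η := by rwa [one_mul]
    · have h1 := hasDerivAt_det_one_add_smul X Y t hY1
      have hid : HasDerivAt (fun s : ℝ => (s : ℂ)) 1 t := by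
        simpa using (hasDerivAt_id t).ofReal_comp
      have h2 := (((hid.mul_const X.trace).neg).add
        (((hid.pow 2).mul_const (X * X).trace).div_const 2)).cexp
      have h3 := h1.mul h2
      refine h3.congr_deriv ?_
      rw [htr, hf]
      simp only [Pi.add_apply, Pi.neg_apply, Pi.pow_apply]
      push_cast
      ring
  choose! u hu hfu using key
  have hder : ∀ t ∈ Set.Icc (0 : ℝ) 1, HasDerivAt (fun t => f t - 1) (f t * u t) t :=
    fun t ht => (hfu t ht).sub_const 1
  have hG := norm_le_gronwallBound_of_norm_deriv_right_le (f := fun t => f t - 1)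
    (f' := fun t => f t * u t) (δ := 0) (K := η) (ε := η) (a := 0) (b := 1)
    (fun t ht => (hder t ht).continuousAt.continuousWithinAt)
    (fun t ht => (hder t ⟨ht.1, ht.2.le⟩).hasDerivWithinAt) (by simp [hf])
    (fun t ht => by
      have h1 := hu t ⟨ht.1, ht.2.le⟩
      have h2 : f t * u t = (f t - 1) * u t + u t := by ring
      rw [h2]
      refine (norm_add_le _ _).trans (add_le_add ?_ h1)
      rw [norm_mul, mul_comm]
      exact mul_le_mul_of_nonneg_right h1 (norm_nonneg _)) 1 ⟨zero_le_one, le_rfl⟩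
  have h1 : f 1 = (1 + X).det * Complex.exp (-X.trace + (X * X).trace / 2) := by
    simp [hf]
  rw [h1] at hG
  refine hG.trans (le_of_eq ?_)
  by_cases h0 : η = 0
  · simp [h0, gronwallBound_K0]
  · rw [gronwallBound_of_K_ne_0 h0]
    simp [h0]

end DetExpansion

/-! ### The Laplacian and its resolvent -/

section Laplacian

variable {n : ℕ} (G : SimpleGraph (Fin n)) [DecidableRel G.Adj]

/-- Both sides are sums over darts: every edge carries exactly two. -/
theorem two_mul_sum_edgeFinset (F : Sym2 (Fin n) → ℝ) :
    2 * ∑ e ∈ G.edgeFinset, F e = ∑ j, ∑ k, if G.Adj j k then F s(j, k) else 0 := by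
  have h1 : ∑ d : G.Dart, F d.edge = 2 * ∑ e ∈ G.edgeFinset, F e := by
    rw [← Finset.sum_fiberwise_of_maps_to (s := (Finset.univ : Finset G.Dart))
      (t := G.edgeFinset) (g := fun d => d.edge)
      (fun d _ => SimpleGraph.mem_edgeFinset.2 d.edge_mem), Finset.mul_sum]
    refine Finset.sum_congr rfl fun e he => ?_
    rw [Finset.sum_congr rfl (g := fun _ => F e)
      (fun d hd => by rw [(Finset.mem_filter.1 hd).2]), Finset.sum_const,
      G.dart_edge_fiber_card e (SimpleGraph.mem_edgeFinset.1 he), nsmul_eq_mul]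
    norm_num
  rw [← h1, ← Fintype.sum_prod_type' (f := fun j k => if G.Adj j k then F s(j, k) else 0),
    ← Finset.sum_filter]
  refine Finset.sum_bij' (fun d _ => d.toProd)
    (fun p hp => ⟨p, (Finset.mem_filter.1 hp).2⟩) ?_ ?_ ?_ ?_ ?_
  · intro d _
    exact Finset.mem_filter.2 ⟨Finset.mem_univ _, d.adj⟩
  · intro p _
    exact Finset.mem_univ _
  · intro d _
    rfl
  · intro p _
    rfl
  · intro d _
    rfl

theorem lapMatrix_mulVec_eq_sum (ξ : Fin n → ℝ) (j : Fin n) :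
    (G.lapMatrix ℝ).mulVec ξ j = ∑ k, if G.Adj j k then ξ j - ξ k else 0 := by
  rw [SimpleGraph.lapMatrix_mulVec_apply, SimpleGraph.degree_eq_sum_if_adj, Finset.sum_mul,
    SimpleGraph.neighborFinset_eq_filter, Finset.sum_filter, ← Finset.sum_sub_distrib]
  refine Finset.sum_congr rfl fun k _ => ?_
  split_ifs <;> ring

theorem dotProduct_lapMatrix_mulVec (ξ : Fin n → ℝ) :
    ξ ⬝ᵥ (G.lapMatrix ℝ).mulVec ξ =
      (∑ j, ∑ k, if G.Adj j k then (ξ j - ξ k) ^ 2 else 0) / 2 := by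
  rw [← SimpleGraph.lapMatrix_toLinearMap₂' (R := ℝ) G ξ, Matrix.toLinearMap₂'_apply']

theorem dotProduct_Qhat_mulVec (ξ : Fin n → ℝ) :
    ξ ⬝ᵥ (Qhat G).mulVec ξ = ξ ⬝ᵥ (G.lapMatrix ℝ).mulVec ξ + (∑ j, ξ j) ^ 2 := by
  rw [Qhat, Matrix.add_mulVec, dotProduct_add]
  congr 1
  simp [Matrix.mulVec, dotProduct, ← Finset.sum_mul, sq]

theorem Qhat_isSymm : (Qhat G).IsSymm := by
  refine (G.isSymm_lapMatrix (R := ℝ)).add ?_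
  ext i j
  rfl

theorem W_isSymm : (W G).IsSymm := by
  rw [Matrix.IsSymm, W, Matrix.transpose_nonsing_inv, (Qhat_isSymm G).eq]

theorem Qhat_mulVec_one : (Qhat G).mulVec 1 = (n : ℝ) • (1 : Fin n → ℝ) := by
  have h : (G.lapMatrix ℝ).mulVec 1 = 0 := G.lapMatrix_mulVec_const_eq_zero
  rw [Qhat, Matrix.add_mulVec, h, zero_add]
  funext v
  simp [Matrix.mulVec, dotProduct]

/-- The quadratic form of `Q + J` is bounded below by `κ n |ξ|²`. -/
structure HasGap (κ : ℝ) : Prop where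
  pos : 0 < κ
  le_one : κ ≤ 1
  n_pos : 0 < n
  le : ∀ ξ : Fin n → ℝ, κ * n * ∑ j, ξ j ^ 2 ≤ ξ ⬝ᵥ (Qhat G).mulVec ξ

variable {G} {κ : ℝ}

namespace HasGap

theorem mul_pos (h : HasGap G κ) : 0 < κ * n :=
  _root_.mul_pos h.pos (Nat.cast_pos.2 h.n_pos)

theorem posDef (h : HasGap G κ) : (Qhat G).PosDef := by
  refine Matrix.PosDef.of_dotProduct_mulVec_pos ?_ ?_
  · have := Qhat_isSymm G
    rwa [Matrix.IsHermitian, Matrix.conjTranspose_eq_transpose_of_trivial]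
  · intro x hx
    rw [star_trivial]
    refine lt_of_lt_of_le (_root_.mul_pos h.mul_pos ?_) (h.le x)
    obtain ⟨i, hi⟩ := Function.ne_iff.1 hx
    exact Finset.sum_pos' (fun i _ => sq_nonneg _) ⟨i, Finset.mem_univ i, by
      have : x i ≠ 0 := hi
      positivity⟩

theorem det_pos (h : HasGap G κ) : 0 < (Qhat G).det := h.posDef.det_pos

theorem isUnit_det (h : HasGap G κ) : IsUnit (Qhat G).det := isUnit_iff_ne_zero.2 h.det_pos.ne'

theorem Qhat_mul_W (h : HasGap G κ) : Qhat G * W G = 1 := Matrix.mul_nonsing_inv _ h.isUnit_det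

theorem W_mul_Qhat (h : HasGap G κ) : W G * Qhat G = 1 := Matrix.nonsing_inv_mul _ h.isUnit_det

theorem Qhat_mulVec_W_mulVec (h : HasGap G κ) (b : Fin n → ℝ) :
    (Qhat G).mulVec ((W G).mulVec b) = b := by
  rw [Matrix.mulVec_mulVec, h.Qhat_mul_W, Matrix.one_mulVec]

theorem W_mulVec_Qhat_mulVec (h : HasGap G κ) (b : Fin n → ℝ) :
    (W G).mulVec ((Qhat G).mulVec b) = b := by
  rw [Matrix.mulVec_mulVec, h.W_mul_Qhat, Matrix.one_mulVec]

theorem dotProduct_W_mulVec_eq (h : HasGap G κ) (b : Fin n → ℝ) :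
    b ⬝ᵥ (W G).mulVec b = (W G).mulVec b ⬝ᵥ (Qhat G).mulVec ((W G).mulVec b) := by
  rw [h.Qhat_mulVec_W_mulVec, dotProduct_comm]

theorem dotProduct_W_mulVec_nonneg (h : HasGap G κ) (b : Fin n → ℝ) :
    0 ≤ b ⬝ᵥ (W G).mulVec b := by
  rw [h.dotProduct_W_mulVec_eq]
  refine le_trans ?_ (h.le _)
  exact mul_nonneg h.mul_pos.le (Finset.sum_nonneg fun i _ => sq_nonneg _)

/-- Apply the gap to `x = W b`: `κ n |x|² ≤ x · b ≤ |x| |b|`. This is the operator norm bound for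
`W` on which all later estimates rest. -/
theorem sum_W_mulVec_sq_le (h : HasGap G κ) (b : Fin n → ℝ) :
    ∑ j, (W G).mulVec b j ^ 2 ≤ ((κ * n) ^ 2)⁻¹ * ∑ j, b j ^ 2 := by
  have h1 := h.le ((W G).mulVec b)
  rw [h.Qhat_mulVec_W_mulVec] at h1
  have h2 := Finset.sum_mul_sq_le_sq_mul_sq Finset.univ ((W G).mulVec b) b
  set S := ∑ j, (W G).mulVec b j ^ 2
  set T := ∑ j, b j ^ 2
  have hS : 0 ≤ S := Finset.sum_nonneg fun i _ => sq_nonneg _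
  have hk := h.mul_pos
  rw [inv_mul_eq_div, le_div_iff₀ (by positivity)]
  have h3 : (κ * n * S) ^ 2 ≤ S * T := by
    refine le_trans ?_ h2
    exact pow_le_pow_left₀ (by positivity) h1 2
  rcases hS.eq_or_lt with h0 | h0
  · rw [← h0, zero_mul]
    exact Finset.sum_nonneg fun i _ => sq_nonneg _
  · refine le_of_mul_le_mul_left ?_ h0
    calc S * (S * (κ * n) ^ 2) = (κ * n * S) ^ 2 := by ring
      _ ≤ S * T := h3

theorem dotProduct_W_mulVec_le (h : HasGap G κ) (b : Fin n → ℝ) :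
    b ⬝ᵥ (W G).mulVec b ≤ (κ * n)⁻¹ * ∑ j, b j ^ 2 := by
  have h1 := h.sum_W_mulVec_sq_le b
  have h2 := Finset.sum_mul_sq_le_sq_mul_sq Finset.univ b ((W G).mulVec b)
  set S := ∑ j, (W G).mulVec b j ^ 2
  set T := ∑ j, b j ^ 2
  have hT : 0 ≤ T := Finset.sum_nonneg fun i _ => sq_nonneg _
  have hk := h.mul_pos
  refine (abs_le_of_sq_le_sq' (h2.trans ?_) (by positivity)).2
  calc T * S ≤ T * (((κ * n) ^ 2)⁻¹ * T) := mul_le_mul_of_nonneg_left h1 hT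
    _ = ((κ * n)⁻¹ * T) ^ 2 := by rw [← inv_pow]; ring

theorem W_mulVec_single (j k : Fin n) : (W G).mulVec (Pi.single j 1) k = W G k j := by
  simp

/-- A row of `W` is the image of a basis vector, so its whole sum of squares, and not only each
entry squared, is `O(n⁻²)`. -/
theorem sum_W_sq_le (h : HasGap G κ) (j : Fin n) : ∑ k, W G j k ^ 2 ≤ ((κ * n) ^ 2)⁻¹ := by
  have h1 := h.sum_W_mulVec_sq_le (Pi.single j 1)
  have h2 : ∑ k, (Pi.single j (1 : ℝ) : Fin n → ℝ) k ^ 2 = 1 := by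
    simp [Pi.single_apply]
  rw [h2, mul_one] at h1
  refine le_trans (le_of_eq (Finset.sum_congr rfl fun k _ => ?_)) h1
  rw [W_mulVec_single, (W_isSymm G).apply]

theorem α_nonneg (h : HasGap G κ) (j : Fin n) : 0 ≤ α G j := by
  have := h.dotProduct_W_mulVec_nonneg (Pi.single j 1)
  simpa [α] using this

theorem α_le (h : HasGap G κ) (j : Fin n) : α G j ≤ (κ * n)⁻¹ := by
  have := h.dotProduct_W_mulVec_le (Pi.single j 1)
  simpa [α, Pi.single_apply] using this

theorem abs_α_sub_le (h : HasGap G κ) (j k : Fin n) : |α G j - α G k| ≤ (κ * n)⁻¹ := by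
  rw [abs_le]
  constructor <;> linarith [h.α_nonneg j, h.α_nonneg k, h.α_le j, h.α_le k]

section Frobenius

open scoped Matrix.Norms.Frobenius

/-- The squared Frobenius norm is additive over columns and over real and imaginary parts, so the
real vector bound applies to each piece. -/
theorem norm_W_mul_le (h : HasGap G κ) (M : Matrix (Fin n) (Fin n) ℂ) :
    ‖(W G).map Complex.ofReal * M‖ ≤ (κ * n)⁻¹ * ‖M‖ := by
  have hk := h.mul_pos
  refine (abs_le_of_sq_le_sq' ?_ (by positivity)).2
  rw [mul_pow, frobenius_sq, frobenius_sq,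
    Finset.sum_comm (f := fun i j => ‖((W G).map Complex.ofReal * M) i j‖ ^ 2),
    Finset.sum_comm (f := fun i j => ‖M i j‖ ^ 2), Finset.mul_sum, inv_pow]
  refine Finset.sum_le_sum fun j _ => ?_
  have h1 := h.sum_W_mulVec_sq_le fun i => (M i j).re
  have h2 := h.sum_W_mulVec_sq_le fun i => (M i j).im
  have h3 : ∀ z : ℂ, ‖z‖ ^ 2 = z.re ^ 2 + z.im ^ 2 := fun z => by
    rw [← Complex.normSq_eq_norm_sq, Complex.normSq_apply]
    ring
  have h4 : ∀ i, ‖((W G).map Complex.ofReal * M) i j‖ ^ 2 =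
      (W G).mulVec (fun i => (M i j).re) i ^ 2 + (W G).mulVec (fun i => (M i j).im) i ^ 2 := by
    intro i
    rw [h3]
    simp [Matrix.mul_apply, Matrix.mulVec, dotProduct]
  rw [Finset.sum_congr rfl fun i _ => h4 i, Finset.sum_congr rfl fun i _ => h3 (M i j),
    Finset.sum_add_distrib, Finset.sum_add_distrib, mul_add]
  exact add_le_add h1 h2

end Frobenius

end HasGap

end Laplacian

/-! ### Scalar estimates -/

theorem abs_exp_neg_sub_taylor_le {u : ℝ} (hu0 : 0 ≤ u) (hu1 : u ≤ 1) :
    |Real.exp (-u) - (1 - u + u ^ 2 / 2)| ≤ u ^ 3 := by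
  have h := Real.exp_bound (x := -u) (by rw [abs_neg, abs_of_nonneg hu0]; exact hu1)
    (n := 3) (by norm_num)
  have h1 : ∑ m ∈ Finset.range 3, (-u) ^ m / (m.factorial : ℝ) = 1 - u + u ^ 2 / 2 := by
    simp [Finset.sum_range_succ, Nat.factorial]
    ring
  rw [h1, abs_neg, abs_of_nonneg hu0] at h
  refine h.trans ?_
  have : (0 : ℝ) ≤ u ^ 3 := by positivity
  norm_num [Nat.factorial]
  linarith

theorem abs_cos_sub_taylor_le {x : ℝ} (hx : |x| ≤ 1) :
    |Real.cos x - (1 - x ^ 2 / 2 + x ^ 4 / 24)| ≤ x ^ 6 / 100 := by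
  have h := Complex.exp_bound (x := (x : ℂ) * Complex.I) (by simpa using hx) (n := 6) (by norm_num)
  have h1 : (Complex.exp ((x : ℂ) * Complex.I) -
      ∑ m ∈ Finset.range 6, ((x : ℂ) * Complex.I) ^ m / (m.factorial : ℂ)).re =
      Real.cos x - (1 - x ^ 2 / 2 + x ^ 4 / 24) := by
    have h2 : ∑ m ∈ Finset.range 6, ((x : ℂ) * Complex.I) ^ m / (m.factorial : ℂ) =
        ((1 - x ^ 2 / 2 + x ^ 4 / 24 : ℝ) : ℂ) + ((x - x ^ 3 / 6 + x ^ 5 / 120 : ℝ) : ℂ) *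
          Complex.I := by
      have h2 : Complex.I ^ 2 = -1 := Complex.I_sq
      have h3 : Complex.I ^ 3 = -Complex.I := Complex.I_pow_three
      have h4 : Complex.I ^ 4 = 1 := Complex.I_pow_four
      have h5 : Complex.I ^ 5 = Complex.I := by rw [pow_succ, h4, one_mul]
      simp [Finset.sum_range_succ, Nat.factorial, mul_pow, h2, h3, h4, h5]
      ring
    rw [h2, Complex.sub_re, Complex.exp_ofReal_mul_I_re, Complex.add_re, Complex.ofReal_re,
      Complex.re_ofReal_mul, Complex.I_re, mul_zero, add_zero]
  rw [← h1]
  refine (Complex.abs_re_le_norm _).trans (h.trans ?_)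
  have h6 : ‖(x : ℂ) * Complex.I‖ ^ 6 = x ^ 6 := by
    simp only [norm_mul, Complex.norm_real, Complex.norm_I, mul_one, Real.norm_eq_abs]
    rw [← abs_pow, abs_of_nonneg (by positivity)]
  rw [h6]
  have : (0 : ℝ) ≤ x ^ 6 := by positivity
  norm_num [Nat.factorial]
  linarith

/-- The expansion `log cos x = -x² / 2 - x⁴ / 12 + O(x⁶)` is the source of the coefficient `1 / 12`
in the main integral. In terms of `y = x²`, the Taylor polynomials of `cos x` and of `exp (-u)`
agree through order `y²`. -/
theorem abs_cos_mul_exp_sub_one_le {x : ℝ} (hx : |x| ≤ 1 / 2) :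
    |Real.cos x * Real.exp (x ^ 2 / 2 + x ^ 4 / 12) - 1| ≤ x ^ 6 := by
  set y := x ^ 2 with hy
  have hy0 : 0 ≤ y := sq_nonneg x
  have hy1 : y ≤ 1 / 4 := by
    rw [hy, ← sq_abs]
    nlinarith [abs_nonneg x]
  have h4 : x ^ 4 = y ^ 2 := by rw [hy]; ring
  have h6 : x ^ 6 = y ^ 3 := by rw [hy]; ring
  set u := y / 2 + y ^ 2 / 12 with hu
  have hu0 : 0 ≤ u := by positivity
  have hu1 : u ≤ 1 / 4 := by nlinarith
  have hc := abs_cos_sub_taylor_le (x := x) (by linarith)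
  have he := abs_exp_neg_sub_taylor_le hu0 (by linarith)
  rw [← hy, h4, h6] at hc
  rw [h4, h6, ← hu]
  have hu3 : u ^ 3 ≤ y ^ 3 * (1 / 6) := by
    have h1 : u ≤ y * (25 / 48) := by rw [hu]; nlinarith
    calc u ^ 3 ≤ (y * (25 / 48)) ^ 3 := pow_le_pow_left₀ hu0 h1 3
      _ = y ^ 3 * (25 / 48) ^ 3 := by ring
      _ ≤ y ^ 3 * (1 / 6) := mul_le_mul_of_nonneg_left (by norm_num) (by positivity)
  have hd : |(1 - y / 2 + y ^ 2 / 24) - (1 - u + u ^ 2 / 2)| ≤ y ^ 3 / 16 := by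
    have h1 : (1 - y / 2 + y ^ 2 / 24) - (1 - u + u ^ 2 / 2) = -(y ^ 3 / 24 + y ^ 4 / 288) := by
      rw [hu]; ring
    rw [h1, abs_neg, abs_of_nonneg (by positivity)]
    have h2 : y ^ 4 ≤ y ^ 3 * (1 / 4) := by
      rw [pow_succ y 3]
      exact mul_le_mul_of_nonneg_left hy1 (by positivity)
    have : 0 ≤ y ^ 3 := by positivity
    linarith
  have hdiff : |Real.cos x - Real.exp (-u)| ≤ y ^ 3 / 2 := by
    have h3 : 0 ≤ y ^ 3 := by positivity
    rw [abs_le] at hc he hd ⊢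
    constructor <;> linarith [hc.1, hc.2, he.1, he.2, hd.1, hd.2]
  have h7 : Real.cos x * Real.exp u - 1 = (Real.cos x - Real.exp (-u)) * Real.exp u := by
    rw [sub_mul, ← Real.exp_add, neg_add_cancel, Real.exp_zero]
  have h8 : Real.exp u ≤ 2 := by
    have h9 : Real.exp u ≤ Real.exp (1 / 4) := Real.exp_le_exp.2 hu1
    have h10 := Real.exp_bound_div_one_sub_of_interval (x := 1 / 4) (by norm_num) (by norm_num)
    norm_num at h10
    linarith
  rw [h7, abs_mul, abs_of_pos (Real.exp_pos u)]
  have h3 : 0 ≤ y ^ 3 := by positivity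
  calc |Real.cos x - Real.exp (-u)| * Real.exp u ≤ y ^ 3 / 2 * 2 :=
        mul_le_mul hdiff h8 (Real.exp_pos u).le (by positivity)
    _ = y ^ 3 := by ring

theorem abs_tan_sub_self_le {x : ℝ} (hx : |x| ≤ 1 / 2) : |Real.tan x - x| ≤ |x| ^ 3 := by
  wlog h0 : 0 ≤ x generalizing x
  · have h := this (x := -x) (by rwa [abs_neg]) (by linarith)
    rw [Real.tan_neg, abs_neg, show -Real.tan x - -x = -(Real.tan x - x) by ring, abs_neg] at h
    exact h
  rw [abs_of_nonneg h0] at hx ⊢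
  have hpi : x < Real.pi / 2 := by linarith [Real.pi_gt_three]
  have h1 : x ≤ Real.tan x := by
    rcases h0.eq_or_lt with h | h
    · rw [← h, Real.tan_zero]
    · exact (Real.lt_tan h hpi).le
  rw [abs_of_nonneg (by linarith)]
  have hcos := Real.one_sub_sq_div_two_le_cos (x := x)
  have hpos : 0 < Real.cos x := by nlinarith
  have hsin := Real.sin_le h0
  rw [Real.tan_eq_sin_div_cos, sub_le_iff_le_add, div_le_iff₀ hpos]
  have h2 : x ≤ (x ^ 3 + x) * (1 - x ^ 2 / 2) := by
    have : (x ^ 3 + x) * (1 - x ^ 2 / 2) - x = x ^ 3 * (1 - x ^ 2) / 2 := by ring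
    have h3 : 0 ≤ x ^ 3 * (1 - x ^ 2) / 2 := by
      have : 0 ≤ 1 - x ^ 2 := by nlinarith
      positivity
    linarith
  have h4 : (x ^ 3 + x) * (1 - x ^ 2 / 2) ≤ (x ^ 3 + x) * Real.cos x :=
    mul_le_mul_of_nonneg_left hcos (by positivity)
  linarith

theorem abs_tan_le {x : ℝ} (hx : |x| ≤ 1 / 2) : |Real.tan x| ≤ 2 * |x| := by
  have h1 := abs_tan_sub_self_le hx
  have h2 : |Real.tan x| ≤ |Real.tan x - x| + |x| := by
    simpa using abs_add_le (Real.tan x - x) x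
  have h3 : |x| ^ 3 ≤ |x| := by
    have := abs_nonneg x
    have h4 : |x| ^ 2 ≤ 1 := by nlinarith
    calc |x| ^ 3 = |x| ^ 2 * |x| := by ring
      _ ≤ 1 * |x| := mul_le_mul_of_nonneg_right h4 this
      _ = |x| := one_mul _
  linarith

/-- Errors of the form `exp x - 1` compose: multiplying approximations of 1 adds their exponents. -/
theorem norm_mul_sub_one_le {a b : ℂ} {x y : ℝ} (ha : ‖a - 1‖ ≤ Real.exp x - 1)
    (hb : ‖b - 1‖ ≤ Real.exp y - 1) : ‖a * b - 1‖ ≤ Real.exp (x + y) - 1 := by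
  have h1 : a * b - 1 = (a - 1) * (b - 1) + (a - 1) + (b - 1) := by ring
  have h2 : ‖a * b - 1‖ ≤ ‖a - 1‖ * ‖b - 1‖ + ‖a - 1‖ + ‖b - 1‖ := by
    rw [h1, ← norm_mul]
    exact (norm_add_le _ _).trans (add_le_add_left (norm_add_le _ _) _)
  have h3 : ‖a - 1‖ * ‖b - 1‖ ≤ (Real.exp x - 1) * (Real.exp y - 1) :=
    mul_le_mul ha hb (norm_nonneg _) ((norm_nonneg _).trans ha)
  rw [Real.exp_add]
  linarith

theorem norm_exp_sub_one_le_exp_norm (z : ℂ) : ‖Complex.exp z - 1‖ ≤ Real.exp ‖z‖ - 1 := by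
  have := Complex.norm_exp_sub_sum_le_exp_norm_sub_sum z 1
  simpa using this

/-! ### The integrand near the diagonal -/

section Pointwise

variable {n : ℕ} (G : SimpleGraph (Fin n)) [DecidableRel G.Adj]

/-- `Q ξ`. -/
def lap (ξ : Fin n → ℝ) : Fin n → ℝ := (G.lapMatrix ℝ).mulVec ξ

theorem lap_apply (ξ : Fin n → ℝ) (j : Fin n) :
    lap G ξ j = ∑ k, if G.Adj j k then ξ j - ξ k else 0 := lapMatrix_mulVec_eq_sum G ξ j

/-- The vector `∑_k tan Δ_{jk}`. -/
def tanVec (ξ : Fin n → ℝ) (j : Fin n) : ℝ :=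
  ∑ k, if G.Adj j k then Real.tan (ξ j - ξ k) else 0

/-- The antisymmetric matrix `-tan Δ_{jk}`. -/
def tanMat (ξ : Fin n → ℝ) : Matrix (Fin n) (Fin n) ℝ :=
  Matrix.of fun j k => if G.Adj j k then -Real.tan (ξ j - ξ k) else 0

/-- The weight `1 + i tan Δ_{jk}` of an arc. -/
def arcWeight (ξ : Fin n → ℝ) (j k : Fin n) : ℂ :=
  if G.Adj j k then 1 + Complex.I * ((Real.tan (ξ j - ξ k) : ℝ) : ℂ) else 0

theorem R_eq_sum (ξ : Fin n → ℝ) :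
    R G ξ = ∑ j, ∑ k, lap G ξ j * lap G ξ k * W G j k ^ 2 := by
  have h : ∀ j k, (Lam G ξ * W G * Lam G ξ) j k = lap G ξ j * W G j k * lap G ξ k := by
    intro j k
    rw [Lam, Matrix.mul_diagonal, Matrix.diagonal_mul]
    rfl
  rw [R, Matrix.trace]
  refine Finset.sum_congr rfl fun j _ => ?_
  rw [Matrix.diag_apply, Matrix.mul_apply]
  refine Finset.sum_congr rfl fun k _ => ?_
  rw [h, (W_isSymm G).apply]
  ring

theorem sum_edgeQuartic (ξ : Fin n → ℝ) :
    ∑ e ∈ G.edgeFinset, edgeQuartic ξ e =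
      (∑ j, ∑ k, if G.Adj j k then (ξ j - ξ k) ^ 4 else 0) / 2 := by
  rw [eq_div_iff two_ne_zero, mul_comm, two_mul_sum_edgeFinset]
  rfl

/-- The average over roots turns the `n` separate cofactors into a single determinant, through the
trace of the adjugate. -/
theorem sum_integrand (ξ : Fin n → ℝ) (hn : 0 < n) :
    (n : ℂ) * ∑ r, integrand G r ξ =
      ((∏ e ∈ G.edgeFinset, edgeCos ξ e : ℝ) : ℂ) *
        (weightedLaplacian (arcWeight G ξ) + Matrix.of fun _ _ => (1 : ℂ)).det := by
  have : Nonempty (Fin n) := ⟨⟨0, hn⟩⟩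
  rw [← card_mul_trace_adjugate _ (weightedLaplacian_mulVec_one _), Fintype.card_fin]
  simp only [integrand]
  rw [← Finset.mul_sum, mul_left_comm]
  congr 2
  refine Finset.sum_congr rfl fun r _ => ?_
  rw [← sum_rootedSpanningTrees_prod G (arcWeight G ξ) (fun a b hab => if_neg hab) r]
  refine Finset.sum_congr rfl fun T hT => Finset.prod_congr rfl fun a ha => ?_
  obtain ⟨f, -, -, hf, rfl⟩ := exists_arcsOf_eq hT
  obtain ⟨a, b⟩ := a
  obtain ⟨h1, rfl⟩ := mem_arcsOf.1 ha
  rw [arcWeight, if_pos (hf a h1)]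

/-- The imaginary part splits into a symmetric diagonal piece and an antisymmetric piece; this
difference in symmetry later decides which traces survive. -/
theorem weightedLaplacian_arcWeight (ξ : Fin n → ℝ) :
    weightedLaplacian (arcWeight G ξ) + Matrix.of (fun _ _ => (1 : ℂ)) =
      (Qhat G).map Complex.ofReal + Complex.I •
        (Matrix.diagonal (tanVec G ξ) + tanMat G ξ).map Complex.ofReal := by
  ext j k
  by_cases hjk : j = k
  · subst hjk
    simp only [weightedLaplacian, Qhat, arcWeight, tanVec, tanMat, Matrix.add_apply,
      Matrix.sub_apply, Matrix.of_apply, Matrix.diagonal_apply_eq, Matrix.map_apply,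
      Matrix.smul_apply, SimpleGraph.irrefl, if_false, SimpleGraph.lapMatrix,
      SimpleGraph.degMatrix, SimpleGraph.adjMatrix_apply, smul_eq_mul]
    rw [SimpleGraph.degree_eq_sum_if_adj (R := ℝ) G]
    push_cast
    rw [sub_zero, sub_zero, add_zero, Finset.mul_sum]
    rw [add_right_comm, ← Finset.sum_add_distrib]
    congr 1
    refine Finset.sum_congr rfl fun k _ => ?_
    split_ifs <;> simp
  · simp only [weightedLaplacian, Qhat, arcWeight, tanMat, Matrix.add_apply,
      Matrix.sub_apply, Matrix.of_apply, Matrix.diagonal_apply_ne _ hjk, Matrix.map_apply,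
      Matrix.smul_apply, SimpleGraph.lapMatrix,
      SimpleGraph.degMatrix, SimpleGraph.adjMatrix_apply, smul_eq_mul]
    split_ifs <;> simp

/-- The exponent of the integrand of `mainIntegral`. -/
def mainExponent (ξ : Fin n → ℝ) : ℂ :=
  Complex.I * ((ξ ⬝ᵥ (G.lapMatrix ℝ).mulVec (α G) : ℝ) : ℂ) +
        ((-(1 / 2) * (ξ ⬝ᵥ (Qhat G).mulVec ξ)
          - (1 / 12) * ∑ e ∈ G.edgeFinset, edgeQuartic ξ e
          + (1 / 2) * R G ξ : ℝ) : ℂ)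

variable {G}

/-- There are at most `n²` edges, and each contributes a factor within `ρ⁶` of 1. -/
theorem norm_prod_edgeCos_sub_one_le {ξ : Fin n → ℝ} {ρ : ℝ} (hρ : ρ ≤ 1 / 2)
    (hξ : ∀ j k, |ξ j - ξ k| ≤ ρ) :
    |(∏ e ∈ G.edgeFinset, edgeCos ξ e) *
      Real.exp (1 / 2 * (ξ ⬝ᵥ (G.lapMatrix ℝ).mulVec ξ) +
        1 / 12 * ∑ e ∈ G.edgeFinset, edgeQuartic ξ e) - 1| ≤
      Real.exp ((n : ℝ) ^ 2 * ρ ^ 6) - 1 := by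
  set E2 : Sym2 (Fin n) → ℝ :=
    Sym2.lift ⟨fun j k => (ξ j - ξ k) ^ 2, fun j k => by ring⟩ with hE2
  have h2 : ξ ⬝ᵥ (G.lapMatrix ℝ).mulVec ξ = ∑ e ∈ G.edgeFinset, E2 e := by
    rw [dotProduct_lapMatrix_mulVec, div_eq_iff two_ne_zero, mul_comm, two_mul_sum_edgeFinset]
    rfl
  rw [h2, Finset.mul_sum, Finset.mul_sum, ← Finset.sum_add_distrib, Real.exp_sum,
    ← Finset.prod_mul_distrib]
  have h3 : ∀ e : Sym2 (Fin n), |edgeCos ξ e *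
      Real.exp (1 / 2 * E2 e + 1 / 12 * edgeQuartic ξ e) - 1| ≤ ρ ^ 6 := by
    intro e
    induction e using Sym2.ind with
    | _ j k =>
      have h4 := abs_cos_mul_exp_sub_one_le ((hξ j k).trans hρ)
      have h5 : (ξ j - ξ k) ^ 6 ≤ ρ ^ 6 := by
        rw [← Even.pow_abs (by decide : Even 6)]
        exact pow_le_pow_left₀ (abs_nonneg _) (hξ j k) 6
      refine le_trans (le_of_eq ?_) (h4.trans h5)
      change |Real.cos (ξ j - ξ k) * Real.exp (1 / 2 * (ξ j - ξ k) ^ 2 +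
        1 / 12 * (ξ j - ξ k) ^ 4) - 1| = _
      ring_nf
  have h6 := Finset.norm_prod_one_add_sub_one_le G.edgeFinset
    (fun e => edgeCos ξ e * Real.exp (1 / 2 * E2 e + 1 / 12 * edgeQuartic ξ e) - 1)
  simp only [add_sub_cancel, Real.norm_eq_abs] at h6
  refine h6.trans (sub_le_sub_right (Real.exp_le_exp.2 ?_) 1)
  have hρ6 : (0 : ℝ) ≤ ρ ^ 6 := Even.pow_nonneg (by decide) _
  refine (Finset.sum_le_card_nsmul _ _ _ fun e _ => h3 e).trans ?_
  rw [nsmul_eq_mul]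
  refine mul_le_mul_of_nonneg_right ?_ hρ6
  have h7 := G.card_edgeFinset_le_card_choose_two
  rw [Fintype.card_fin] at h7
  have h8 : G.edgeFinset.card ≤ n ^ 2 := by
    rcases Nat.eq_zero_or_pos n with rfl | hn
    · simpa using h7
    · exact h7.trans (Nat.choose_le_pow n 2)
  exact_mod_cast h8

end Pointwise

/-! ### Determinant expansion and comparison of the integrands. -/

section Pointwise

variable {n : ℕ} {G : SimpleGraph (Fin n)} [DecidableRel G.Adj]

section Frobenius

open scoped Matrix.Norms.Frobenius

theorem frobenius_sq_le_of_entries {A : Matrix (Fin n) (Fin n) ℂ} {τ : ℝ}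
    (h : ∀ i j, ‖A i j‖ ≤ τ) : ‖A‖ ^ 2 ≤ (n * τ) ^ 2 := by
  rw [frobenius_sq]
  calc ∑ i, ∑ j, ‖A i j‖ ^ 2 ≤ ∑ _i : Fin n, ∑ _j : Fin n, τ ^ 2 :=
        Finset.sum_le_sum fun i _ => Finset.sum_le_sum fun j _ =>
          pow_le_pow_left₀ (norm_nonneg _) (h i j) 2
    _ = (n * τ) ^ 2 := by simp; ring

theorem frobenius_norm_diagonal_mul_le {d : Fin n → ℂ} {s : ℝ} (hs : 0 ≤ s) (h : ∀ i, ‖d i‖ ≤ s)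
    (M : Matrix (Fin n) (Fin n) ℂ) : ‖Matrix.diagonal d * M‖ ≤ s * ‖M‖ := by
  refine (abs_le_of_sq_le_sq' ?_ (by positivity)).2
  rw [mul_pow, frobenius_sq, frobenius_sq, Finset.mul_sum]
  refine Finset.sum_le_sum fun i _ => ?_
  rw [Finset.mul_sum]
  refine Finset.sum_le_sum fun j _ => ?_
  rw [Matrix.diagonal_mul, norm_mul, mul_pow]
  exact mul_le_mul_of_nonneg_right (pow_le_pow_left₀ (norm_nonneg _) (h i) 2) (by positivity)

theorem frobenius_sq_diagonal_le {d : Fin n → ℂ} {s : ℝ} (h : ∀ i, ‖d i‖ ≤ s) :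
    ‖(Matrix.diagonal d : Matrix (Fin n) (Fin n) ℂ)‖ ^ 2 ≤ n * s ^ 2 := by
  rw [frobenius_sq]
  have h1 : ∀ i, ∑ j, ‖(Matrix.diagonal d : Matrix (Fin n) (Fin n) ℂ) i j‖ ^ 2 = ‖d i‖ ^ 2 := by
    intro i
    rw [Finset.sum_eq_single i]
    · rw [Matrix.diagonal_apply_eq]
    · intro j _ hj
      rw [Matrix.diagonal_apply_ne _ hj.symm]
      simp
    · simp
  rw [Finset.sum_congr rfl fun i _ => h1 i]
  calc ∑ i, ‖d i‖ ^ 2 ≤ ∑ _i : Fin n, s ^ 2 :=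
        Finset.sum_le_sum fun i _ => pow_le_pow_left₀ (norm_nonneg _) (h i) 2
    _ = n * s ^ 2 := by simp

theorem trace_symm_mul_antisymm {S A : Matrix (Fin n) (Fin n) ℂ} (hS : S.transpose = S)
    (hA : A.transpose = -A) : (S * A).trace = 0 := by
  have h1 : (S * A).trace = -(S * A).trace := by
    conv_lhs => rw [← Matrix.trace_transpose, Matrix.transpose_mul, hS, hA, neg_mul,
      Matrix.trace_neg, Matrix.trace_mul_comm]
  exact self_eq_neg.1 h1

theorem abs_sum_ite_le {G : SimpleGraph (Fin n)} [DecidableRel G.Adj] {f : Fin n → Fin n → ℝ}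
    {s : ℝ} (hs : 0 ≤ s) (h : ∀ j k, |f j k| ≤ s) (j : Fin n) :
    |∑ k, if G.Adj j k then f j k else 0| ≤ n * s := by
  refine (Finset.abs_sum_le_sum_abs _ _).trans ?_
  calc ∑ k, |if G.Adj j k then f j k else 0| ≤ ∑ _k : Fin n, s := by
        refine Finset.sum_le_sum fun k _ => ?_
        split_ifs
        · exact h j k
        · simpa using hs
    _ = n * s := by simp

/-- Second-order expansion of the determinant near the diagonal. -/
theorem HasGap.det_expansion {κ : ℝ} (h : HasGap G κ) {ξ : Fin n → ℝ} {ρ : ℝ} (hρ0 : 0 ≤ ρ)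
    (hρ : ρ ≤ 1 / 2) (hρκ : 4 * ρ / κ ≤ 1 / 2) (hξ : ∀ j k, |ξ j - ξ k| ≤ ρ) :
    ∃ u : ℂ, ‖u - 1‖ ≤ Real.exp ((128 * n * ρ ^ 3 / κ ^ 3) +
        (n * ρ ^ 3 / κ + 2 * n * ρ ^ 4 / κ ^ 2 + 2 * ρ ^ 2 / κ ^ 2)) - 1 ∧
      (weightedLaplacian (arcWeight G ξ) + Matrix.of fun _ _ => (1 : ℂ)).det =
        ((Qhat G).det : ℂ) * (Complex.exp (Complex.I * ((ξ ⬝ᵥ (G.lapMatrix ℝ).mulVec (α G) : ℝ) : ℂ)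
          + ((1 / 2 * R G ξ : ℝ) : ℂ)) * u) := by
  have hκ := h.pos
  have hn : (0 : ℝ) < n := Nat.cast_pos.2 h.n_pos
  have hn1 : (1 : ℝ) ≤ n := by exact_mod_cast h.n_pos
  have hk := h.mul_pos
  set l := lap G ξ with hl
  set d := tanVec G ξ with hd
  have htan : ∀ j k, |Real.tan (ξ j - ξ k)| ≤ 2 * ρ := fun j k =>
    (abs_tan_le ((hξ j k).trans hρ)).trans (by linarith [hξ j k])
  have hdb : ∀ j, |d j| ≤ 2 * n * ρ := fun j =>
    (abs_sum_ite_le (by positivity) htan j).trans (le_of_eq (by ring))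
  have hlb : ∀ j, |l j| ≤ n * ρ := fun j => by
    rw [hl, lap_apply]
    exact abs_sum_ite_le hρ0 hξ j
  have hdl : ∀ j, |d j - l j| ≤ n * ρ ^ 3 := fun j => by
    have h1 : d j - l j =
        ∑ k, if G.Adj j k then Real.tan (ξ j - ξ k) - (ξ j - ξ k) else 0 := by
      rw [hl, lap_apply, hd, tanVec, ← Finset.sum_sub_distrib]
      refine Finset.sum_congr rfl fun k _ => ?_
      split_ifs <;> simp
    rw [h1]
    exact abs_sum_ite_le (f := fun j k => Real.tan (ξ j - ξ k) - (ξ j - ξ k)) (by positivity)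
      (fun j k => (abs_tan_sub_self_le ((hξ j k).trans hρ)).trans
        (pow_le_pow_left₀ (abs_nonneg _) (hξ j k) 3)) j
  set WC := (W G).map Complex.ofReal with hWC
  set D : Matrix (Fin n) (Fin n) ℂ := Matrix.diagonal fun j => (d j : ℂ) with hD
  set A : Matrix (Fin n) (Fin n) ℂ := (tanMat G ξ).map Complex.ofReal with hA
  have hWCs : WC.transpose = WC := by
    rw [hWC, ← Matrix.transpose_map, (W_isSymm G).eq]
  have hAs : A.transpose = -A := by
    ext j k
    simp only [hA, tanMat, Matrix.transpose_apply, Matrix.map_apply, Matrix.of_apply,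
      Matrix.neg_apply]
    simp only [G.adj_comm k j, ← neg_sub (ξ j) (ξ k), Real.tan_neg]
    split_ifs <;> simp
  have hDs : D.transpose = D := Matrix.diagonal_transpose _
  have hdet : weightedLaplacian (arcWeight G ξ) + Matrix.of (fun _ _ => (1 : ℂ)) =
      (Qhat G).map Complex.ofReal * (1 + Complex.I • (WC * (D + A))) := by
    have h1 : (Qhat G).map Complex.ofReal * WC = 1 := by
      have h2 := Matrix.map_mul (f := Complex.ofRealHom) (L := Qhat G) (M := W G)
      rw [h.Qhat_mul_W, Matrix.map_one _ (map_zero _) (map_one _)] at h2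
      exact h2.symm
    have h2 : D + A = (Matrix.diagonal (tanVec G ξ) + tanMat G ξ).map Complex.ofReal := by
      ext j k
      by_cases hjk : j = k
      · subst hjk
        simp [hD, hA, hd]
      · simp [hD, hA, hjk]
    rw [weightedLaplacian_arcWeight, ← h2, mul_add, mul_one, Matrix.mul_smul, ← mul_assoc, h1,
      one_mul]
  set X := Complex.I • (WC * (D + A)) with hX
  have hdn : ∀ j, ‖(d j : ℂ)‖ ≤ 2 * n * ρ := fun j => by
    rw [Complex.norm_real]
    exact hdb j
  have hAe : ‖A‖ ^ 2 ≤ (n * (2 * ρ)) ^ 2 := frobenius_sq_le_of_entries fun j k => by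
    simp only [hA, tanMat, Matrix.map_apply, Matrix.of_apply, Complex.norm_real]
    split_ifs
    · rw [norm_neg]
      exact htan j k
    · simpa using hρ0
  have hAn : ‖A‖ ≤ n * (2 * ρ) := (abs_le_of_sq_le_sq' hAe (by positivity)).2
  have hDe : ‖D‖ ^ 2 ≤ n * (2 * n * ρ) ^ 2 := frobenius_sq_diagonal_le hdn
  -- The factor `1 / (κ n)` from `W` meets `2nρ` from the diagonal part and `2nρ` from the Frobenius
  -- norm of `A`.
  have hXM : ∀ M : Matrix (Fin n) (Fin n) ℂ, ‖X * M‖ ≤ 4 * ρ / κ * ‖M‖ := by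
    intro M
    rw [hX, Matrix.smul_mul, norm_smul, Complex.norm_I, one_mul, mul_assoc]
    refine (h.norm_W_mul_le _).trans ?_
    have h1 : ‖(D + A) * M‖ ≤ 4 * n * ρ * ‖M‖ := by
      rw [add_mul]
      refine (norm_add_le _ _).trans ?_
      have h2 := frobenius_norm_diagonal_mul_le (by positivity) hdn M
      have h3 := (Matrix.frobenius_norm_mul A M).trans
        (mul_le_mul_of_nonneg_right hAn (norm_nonneg M))
      linarith
    calc (κ * n)⁻¹ * ‖(D + A) * M‖ ≤ (κ * n)⁻¹ * (4 * n * ρ * ‖M‖) :=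
          mul_le_mul_of_nonneg_left h1 (by positivity)
      _ = 4 * ρ / κ * ‖M‖ := by field_simp
  -- The diagonal part dominates: `‖D‖² ≤ 4n³ρ²`, while `‖A‖² ≤ 4n²ρ²`.
  have hXn : ‖X‖ ^ 2 ≤ 16 * n * ρ ^ 2 / κ ^ 2 := by
    have h1 : ‖X‖ ≤ (κ * n)⁻¹ * (‖D‖ + ‖A‖) := by
      rw [hX, norm_smul, Complex.norm_I, one_mul]
      exact (h.norm_W_mul_le _).trans
        (mul_le_mul_of_nonneg_left (norm_add_le _ _) (by positivity))
    have h2 : (‖D‖ + ‖A‖) ^ 2 ≤ 16 * n ^ 3 * ρ ^ 2 := by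
      have h3 : (‖D‖ + ‖A‖) ^ 2 ≤ 2 * (‖D‖ ^ 2 + ‖A‖ ^ 2) := by
        nlinarith [sq_nonneg (‖D‖ - ‖A‖)]
      have h4 : (n * (2 * ρ)) ^ 2 ≤ n * (2 * n * ρ) ^ 2 := by
        have : (n * (2 * ρ)) ^ 2 = 1 * (2 * n * ρ) ^ 2 := by ring
        rw [this]
        exact mul_le_mul_of_nonneg_right hn1 (sq_nonneg _)
      nlinarith
    calc ‖X‖ ^ 2 ≤ ((κ * n)⁻¹ * (‖D‖ + ‖A‖)) ^ 2 := pow_le_pow_left₀ (norm_nonneg _) h1 2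
      _ = ((κ * n) ^ 2)⁻¹ * (‖D‖ + ‖A‖) ^ 2 := by rw [mul_pow, inv_pow]
      _ ≤ ((κ * n) ^ 2)⁻¹ * (16 * n ^ 3 * ρ ^ 2) := mul_le_mul_of_nonneg_left h2 (by positivity)
      _ = 16 * n * ρ ^ 2 / κ ^ 2 := by field_simp
  have hC := norm_det_one_add_mul_exp_sub_one_le X (by positivity) hρκ hXM
  have hC' : ‖(1 + X).det * Complex.exp (-X.trace + (X * X).trace / 2) - 1‖ ≤
      Real.exp (128 * n * ρ ^ 3 / κ ^ 3) - 1 := by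
    refine hC.trans (sub_le_sub_right (Real.exp_le_exp.2 ?_) 1)
    calc 2 * (4 * ρ / κ) * ‖X‖ ^ 2 ≤ 2 * (4 * ρ / κ) * (16 * n * ρ ^ 2 / κ ^ 2) :=
          mul_le_mul_of_nonneg_left hXn (by positivity)
      _ = 128 * n * ρ ^ 3 / κ ^ 3 := by field_simp; ring
  have hWD : (WC * D).trace = ((∑ j, d j * α G j : ℝ) : ℂ) := by
    rw [Matrix.trace]
    push_cast
    refine Finset.sum_congr rfl fun j _ => ?_
    rw [Matrix.diag_apply, hD, Matrix.mul_diagonal, hWC, Matrix.map_apply, mul_comm]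
    rfl
  have hWDWD : (WC * D * (WC * D)).trace = ((∑ j, ∑ k, d j * d k * W G j k ^ 2 : ℝ) : ℂ) := by
    rw [Matrix.trace]
    push_cast
    refine Finset.sum_congr rfl fun j _ => ?_
    rw [Matrix.diag_apply, Matrix.mul_apply]
    refine Finset.sum_congr rfl fun k _ => ?_
    rw [hD, Matrix.mul_diagonal, Matrix.mul_diagonal, hWC, Matrix.map_apply, Matrix.map_apply,
      (W_isSymm G).apply]
    ring
  have hWAWA : ‖(WC * A * (WC * A)).trace‖ ≤ 4 * ρ ^ 2 / κ ^ 2 := by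
    refine (norm_trace_mul_le _ _).trans ?_
    have h1 : ‖WC * A‖ ≤ 2 * ρ / κ := by
      refine (h.norm_W_mul_le A).trans ?_
      calc (κ * n)⁻¹ * ‖A‖ ≤ (κ * n)⁻¹ * (n * (2 * ρ)) :=
            mul_le_mul_of_nonneg_left hAn (by positivity)
        _ = 2 * ρ / κ := by field_simp
    calc ‖WC * A‖ * ‖WC * A‖ ≤ (2 * ρ / κ) * (2 * ρ / κ) :=
          mul_le_mul h1 h1 (norm_nonneg _) (by positivity)
      _ = 4 * ρ ^ 2 / κ ^ 2 := by ring
  have hXtr : X.trace = Complex.I * ((∑ j, d j * α G j : ℝ) : ℂ) := by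
    rw [hX, Matrix.trace_smul, mul_add, Matrix.trace_add, trace_symm_mul_antisymm hWCs hAs,
      add_zero, hWD, smul_eq_mul]
  -- The cross terms vanish because `W D W` is symmetric and `A` is antisymmetric.
  have hXXtr : (X * X).trace = -((∑ j, ∑ k, d j * d k * W G j k ^ 2 : ℝ) : ℂ) -
      (WC * A * (WC * A)).trace := by
    have h1 : (WC * D * (WC * A)).trace = 0 := by
      rw [← mul_assoc]
      refine trace_symm_mul_antisymm ?_ hAs
      rw [Matrix.transpose_mul, Matrix.transpose_mul, hWCs, hDs, mul_assoc]
    have h2 : (WC * A * (WC * D)).trace = 0 := by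
      rw [Matrix.trace_mul_comm, h1]
    rw [hX, Matrix.smul_mul, Matrix.mul_smul, smul_smul, Complex.I_mul_I, Matrix.trace_smul,
      mul_add WC, add_mul, mul_add, mul_add, Matrix.trace_add, Matrix.trace_add,
      Matrix.trace_add, h1, h2, hWDWD, smul_eq_mul]
    ring
  -- `z` collects everything dropped from the exponent: the replacement of tangents by their
  -- arguments in the linear and quadratic terms, and `tr (WAWA) / 2`.
  set z : ℂ := Complex.I * ((∑ j, (d j - l j) * α G j : ℝ) : ℂ) +
    ((1 / 2 * (∑ j, ∑ k, (d j * d k - l j * l k) * W G j k ^ 2) : ℝ) : ℂ) +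
    (WC * A * (WC * A)).trace / 2 with hz
  have hlα : ξ ⬝ᵥ (G.lapMatrix ℝ).mulVec (α G) = ∑ j, l j * α G j := by
    rw [Matrix.dotProduct_mulVec, ← Matrix.mulVec_transpose, (G.isSymm_lapMatrix (R := ℝ)).eq]
    rfl
  have hexp : X.trace - (X * X).trace / 2 =
      (Complex.I * ((ξ ⬝ᵥ (G.lapMatrix ℝ).mulVec (α G) : ℝ) : ℂ)
          + ((1 / 2 * R G ξ : ℝ) : ℂ)) + z := by
    rw [hXtr, hXXtr, hlα, R_eq_sum, hz]
    simp only [sub_mul, Finset.sum_sub_distrib]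
    push_cast
    ring
  have hz1 : ‖Complex.I * ((∑ j, (d j - l j) * α G j : ℝ) : ℂ)‖ ≤ n * ρ ^ 3 / κ := by
    rw [norm_mul, Complex.norm_I, one_mul, Complex.norm_real]
    refine (Finset.abs_sum_le_sum_abs _ _).trans ?_
    calc ∑ j, |(d j - l j) * α G j| ≤ ∑ _j : Fin n, n * ρ ^ 3 * (κ * n)⁻¹ := by
          refine Finset.sum_le_sum fun j _ => ?_
          rw [abs_mul, abs_of_nonneg (h.α_nonneg j)]
          exact mul_le_mul (hdl j) (h.α_le j) (h.α_nonneg j) (by positivity)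
      _ = n * ρ ^ 3 / κ := by simp; field_simp
  have hz2 : ‖((1 / 2 * (∑ j, ∑ k, (d j * d k - l j * l k) * W G j k ^ 2) : ℝ) : ℂ)‖ ≤
      2 * n * ρ ^ 4 / κ ^ 2 := by
    rw [Complex.norm_real, norm_mul, Real.norm_of_nonneg (by norm_num)]
    have h1 : ‖∑ j, ∑ k, (d j * d k - l j * l k) * W G j k ^ 2‖ ≤
        ∑ _j : Fin n, 3 * n ^ 2 * ρ ^ 4 * ((κ * n) ^ 2)⁻¹ := by
      refine (norm_sum_le _ _).trans (Finset.sum_le_sum fun j _ => ?_)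
      refine (norm_sum_le _ _).trans ?_
      refine le_trans (Finset.sum_le_sum (g := fun k => 3 * n ^ 2 * ρ ^ 4 * W G j k ^ 2)
        fun k _ => ?_) ?_
      · rw [norm_mul, Real.norm_of_nonneg (sq_nonneg (W G j k))]
        refine mul_le_mul_of_nonneg_right ?_ (sq_nonneg _)
        have h2 : d j * d k - l j * l k = (d j - l j) * d k + l j * (d k - l k) := by ring
        rw [h2]
        refine (norm_add_le _ _).trans ?_
        rw [norm_mul, norm_mul]
        have h3 : ‖d j - l j‖ * ‖d k‖ ≤ n * ρ ^ 3 * (2 * n * ρ) :=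
          mul_le_mul (hdl j) (hdb k) (norm_nonneg _) (by positivity)
        have h4 : ‖l j‖ * ‖d k - l k‖ ≤ n * ρ * (n * ρ ^ 3) :=
          mul_le_mul (hlb j) (hdl k) (norm_nonneg _) (by positivity)
        linarith
      · rw [← Finset.mul_sum]
        exact mul_le_mul_of_nonneg_left (h.sum_W_sq_le j) (by positivity)
    have h2 : ∑ _j : Fin n, 3 * n ^ 2 * ρ ^ 4 * ((κ * n) ^ 2)⁻¹ = 3 * n * ρ ^ 4 / κ ^ 2 := by
      simp
      field_simp
    rw [h2] at h1
    have h3 : 3 * n * ρ ^ 4 / κ ^ 2 = 3 * (n * ρ ^ 4 / κ ^ 2) := by ring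
    have h4 : 2 * n * ρ ^ 4 / κ ^ 2 = 2 * (n * ρ ^ 4 / κ ^ 2) := by ring
    have h5 : 0 ≤ n * ρ ^ 4 / κ ^ 2 := by positivity
    rw [h3] at h1
    rw [h4]
    linarith
  have hz3 : ‖(WC * A * (WC * A)).trace / 2‖ ≤ 2 * ρ ^ 2 / κ ^ 2 := by
    rw [norm_div, Complex.norm_ofNat]
    have h3 : 4 * ρ ^ 2 / κ ^ 2 = 2 * ρ ^ 2 / κ ^ 2 * 2 := by ring
    rw [h3] at hWAWA
    linarith
  have hzn : ‖z‖ ≤ n * ρ ^ 3 / κ + 2 * n * ρ ^ 4 / κ ^ 2 + 2 * ρ ^ 2 / κ ^ 2 :=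
    (norm_add_le _ _).trans (add_le_add ((norm_add_le _ _).trans (add_le_add hz1 hz2)) hz3)
  refine ⟨(1 + X).det * Complex.exp (-X.trace + (X * X).trace / 2) * Complex.exp z,
    norm_mul_sub_one_le hC' ((norm_exp_sub_one_le_exp_norm z).trans
      (sub_le_sub_right (Real.exp_le_exp.2 hzn) 1)), ?_⟩
  rw [hdet, Matrix.det_mul]
  have h1 : ((Qhat G).map Complex.ofReal).det = ((Qhat G).det : ℂ) :=
    (RingHom.map_det Complex.ofRealHom (Qhat G)).symm
  rw [h1]
  congr 1
  have h2 : Complex.exp (Complex.I * ((ξ ⬝ᵥ (G.lapMatrix ℝ).mulVec (α G) : ℝ) : ℂ)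
          + ((1 / 2 * R G ξ : ℝ) : ℂ)) * Complex.exp z *
      Complex.exp (-X.trace + (X * X).trace / 2) = 1 := by
    rw [← Complex.exp_add, ← hexp, ← Complex.exp_add]
    ring_nf
    exact Complex.exp_zero
  calc (1 + X).det = (1 + X).det * (Complex.exp (Complex.I *
        ((ξ ⬝ᵥ (G.lapMatrix ℝ).mulVec (α G) : ℝ) : ℂ)
          + ((1 / 2 * R G ξ : ℝ) : ℂ)) * Complex.exp z *
      Complex.exp (-X.trace + (X * X).trace / 2)) := by rw [h2, mul_one]
    _ = _ := by ring

end Frobenius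

/-- Near the diagonal the integrand is close to that of `mainIntegral`. -/
theorem HasGap.integrand_expansion {κ : ℝ} (h : HasGap G κ) {ξ : Fin n → ℝ} {ρ : ℝ} (hρ0 : 0 ≤ ρ)
    (hρ : ρ ≤ 1 / 2) (hρκ : 4 * ρ / κ ≤ 1 / 2) (hξ : ∀ j k, |ξ j - ξ k| ≤ ρ) :
    ∃ u : ℂ, ‖u - 1‖ ≤ Real.exp ((n : ℝ) ^ 2 * ρ ^ 6 + ((128 * n * ρ ^ 3 / κ ^ 3) +
        (n * ρ ^ 3 / κ + 2 * n * ρ ^ 4 / κ ^ 2 + 2 * ρ ^ 2 / κ ^ 2))) - 1 ∧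
      (n : ℂ) * (∑ r, integrand G r ξ) * ((Real.exp (-(1 / 2) * (∑ j, ξ j) ^ 2) : ℝ) : ℂ) =
        ((Qhat G).det : ℂ) * (Complex.exp (mainExponent G ξ) * u) := by
  obtain ⟨u, hu, hdet⟩ := h.det_expansion hρ0 hρ hρκ hξ
  set E := Real.exp (1 / 2 * (ξ ⬝ᵥ (G.lapMatrix ℝ).mulVec ξ) +
        1 / 12 * ∑ e ∈ G.edgeFinset, edgeQuartic ξ e) with hE
  have hc := norm_prod_edgeCos_sub_one_le (G := G) hρ hξ
  refine ⟨(((∏ e ∈ G.edgeFinset, edgeCos ξ e) * E : ℝ) : ℂ) * u, norm_mul_sub_one_le ?_ hu, ?_⟩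
  · rw [← Complex.ofReal_one, ← Complex.ofReal_sub, Complex.norm_real]
    exact hc
  -- `E` cancels the quadratic form of `Q` and the quartic term. The form of `Q + J` exceeds that of
  -- `Q` by `(∑ ξ)²`, which is exactly the extra Gaussian weight.
  · have h1 : Complex.exp (mainExponent G ξ) * (E : ℂ) =
        Complex.exp (Complex.I * ((ξ ⬝ᵥ (G.lapMatrix ℝ).mulVec (α G) : ℝ) : ℂ)
          + ((1 / 2 * R G ξ : ℝ) : ℂ)) *
          ((Real.exp (-(1 / 2) * (∑ j, ξ j) ^ 2) : ℝ) : ℂ) := by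
      rw [hE, Complex.ofReal_exp, Complex.ofReal_exp, ← Complex.exp_add, ← Complex.exp_add,
        mainExponent, dotProduct_Qhat_mulVec]
      congr 1
      push_cast
      ring
    rw [sum_integrand G ξ h.n_pos, hdet]
    push_cast at h1 ⊢
    linear_combination (-(∏ e ∈ G.edgeFinset, (edgeCos ξ e : ℂ)) * ((Qhat G).det : ℂ) * u) * h1

end Pointwise

/-! ### Gaussian integrals -/

section Gaussian

variable {n : ℕ} (G : SimpleGraph (Fin n)) [DecidableRel G.Adj]

/-- The Gaussian weight `exp (-(s / 2) ξᵀ (Q + J) ξ)`. -/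
def gaussWeight (s : ℝ) (ξ : Fin n → ℝ) : ℝ := Real.exp (-(s / 2) * (ξ ⬝ᵥ (Qhat G).mulVec ξ))

theorem gaussWeight_pos (s : ℝ) (ξ : Fin n → ℝ) : 0 < gaussWeight G s ξ := Real.exp_pos _

@[fun_prop]
theorem continuous_quadForm (M : Matrix (Fin n) (Fin n) ℝ) :
    Continuous fun ξ : Fin n → ℝ => ξ ⬝ᵥ M.mulVec ξ := by
  simp only [dotProduct, Matrix.mulVec]
  fun_prop

@[fun_prop]
theorem continuous_gaussWeight (s : ℝ) : Continuous (gaussWeight G s) := by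
  unfold gaussWeight
  fun_prop

@[fun_prop]
theorem continuous_dotProduct_left (b : Fin n → ℝ) : Continuous fun ξ : Fin n → ℝ => b ⬝ᵥ ξ := by
  simp only [dotProduct]
  fun_prop

theorem measurableSet_cube (n : ℕ) (δ : ℝ) : MeasurableSet (cube n δ) := by
  have : cube n δ = ⋂ j, {ξ : Fin n → ℝ | |ξ j| ≤ δ} := by
    ext ξ
    simp [cube]
  rw [this]
  exact MeasurableSet.iInter fun j => measurableSet_le (by fun_prop) (by fun_prop)

variable {G} {κ : ℝ}

namespace HasGap

theorem integrable_exp_mul_gaussWeight (h : HasGap G κ) {s : ℝ} (hs : 0 < s) (b : Fin n → ℝ) :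
    Integrable fun ξ => Real.exp (b ⬝ᵥ ξ) * gaussWeight G s ξ := by
  have hk := h.mul_pos
  have h1 : Integrable fun ξ : Fin n → ℝ => Real.exp (-(s / 2 * (κ * n)) * ∑ i, ξ i ^ 2 +
      ∑ i, b i * ξ i) := by
    have h2 := (GaussianFourier.integrable_cexp_neg_mul_sum_add (ι := Fin n)
      (b := ((s / 2 * (κ * n) : ℝ) : ℂ))
      (by rw [Complex.ofReal_re]; positivity) (fun i => (b i : ℂ))).norm
    refine h2.congr (Filter.Eventually.of_forall fun ξ => ?_)
    simp only [Complex.norm_exp]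
    congr 1
    norm_cast
  refine h1.mono' (Continuous.aestronglyMeasurable (by fun_prop))
    (Filter.Eventually.of_forall fun ξ => ?_)
  rw [Real.norm_of_nonneg (by have := gaussWeight_pos G s ξ; positivity), gaussWeight,
    ← Real.exp_add, Real.exp_le_exp, add_comm]
  refine add_le_add ?_ le_rfl
  have := mul_le_mul_of_nonneg_left (h.le ξ) (by positivity : 0 ≤ s / 2)
  linarith

theorem integrable_gaussWeight (h : HasGap G κ) {s : ℝ} (hs : 0 < s) :
    Integrable (gaussWeight G s) := by
  simpa using h.integrable_exp_mul_gaussWeight hs 0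

theorem integral_gaussWeight_one_pos (h : HasGap G κ) : 0 < ∫ ξ, gaussWeight G 1 ξ := by
  rw [integral_pos_iff_support_of_nonneg (fun ξ => (gaussWeight_pos G 1 ξ).le)
    (h.integrable_gaussWeight one_pos)]
  have : Function.support (gaussWeight G 1) = Set.univ :=
    Set.eq_univ_of_forall fun ξ => (gaussWeight_pos G 1 ξ).ne'
  rw [this]
  exact Measure.measure_univ_pos.2 (NeZero.ne _)

theorem integral_gaussWeight {s : ℝ} (hs : 0 < s) :
    ∫ ξ, gaussWeight G s ξ = (Real.sqrt s)⁻¹ ^ n * ∫ ξ, gaussWeight G 1 ξ := by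
  have h1 : ∀ ξ, gaussWeight G s ξ = gaussWeight G 1 (Real.sqrt s • ξ) := by
    intro ξ
    rw [gaussWeight, gaussWeight, Matrix.mulVec_smul, dotProduct_smul, smul_dotProduct,
      smul_eq_mul, smul_eq_mul, ← mul_assoc (Real.sqrt s), Real.mul_self_sqrt hs.le]
    congr 1
    ring
  simp only [h1]
  rw [Measure.integral_comp_smul, Module.finrank_fin_fun, smul_eq_mul, ← inv_pow,
    abs_of_nonneg (by positivity)]

/-- Completing the square moves the centre to `s⁻¹ W b`; translation invariance does the rest. -/
theorem integral_exp_mul_gaussWeight (h : HasGap G κ) {s : ℝ} (hs : 0 < s) (b : Fin n → ℝ) :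
    ∫ ξ, Real.exp (b ⬝ᵥ ξ) * gaussWeight G s ξ =
      Real.exp (b ⬝ᵥ (W G).mulVec b / (2 * s)) * ∫ ξ, gaussWeight G s ξ := by
  set c := s⁻¹ • (W G).mulVec b with hc
  have hQc : (Qhat G).mulVec c = s⁻¹ • b := by
    rw [hc, Matrix.mulVec_smul, h.Qhat_mulVec_W_mulVec]
  have hsym : ∀ x y : Fin n → ℝ, x ⬝ᵥ (Qhat G).mulVec y = y ⬝ᵥ (Qhat G).mulVec x := by
    intro x y
    rw [Matrix.dotProduct_mulVec, ← Matrix.mulVec_transpose, (Qhat_isSymm G).eq, dotProduct_comm]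
  have h1 : ∀ ξ, Real.exp (b ⬝ᵥ ξ) * gaussWeight G s ξ =
      Real.exp (b ⬝ᵥ (W G).mulVec b / (2 * s)) * gaussWeight G s (ξ - c) := by
    intro ξ
    rw [gaussWeight, gaussWeight, ← Real.exp_add, ← Real.exp_add]
    congr 1
    rw [Matrix.mulVec_sub, sub_dotProduct, dotProduct_sub, dotProduct_sub, hsym c ξ, hQc,
      dotProduct_smul, dotProduct_smul, dotProduct_comm ξ b, hc, smul_dotProduct,
      dotProduct_comm ((W G).mulVec b) b, smul_eq_mul, smul_eq_mul, smul_eq_mul]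
    field_simp
    ring
  simp only [h1]
  rw [integral_const_mul, integral_sub_right_eq_self]

/-- Exponential moments of the Gaussian weight. -/
theorem integral_exp_mul_gaussWeight_le (h : HasGap G κ) {s K : ℝ} (hs : 1 / 2 ≤ s)
    (hK : (Real.sqrt s)⁻¹ ^ n ≤ K) (b : Fin n → ℝ) :
    ∫ ξ, Real.exp (b ⬝ᵥ ξ) * gaussWeight G s ξ ≤
      K * Real.exp ((κ * n)⁻¹ * ∑ j, b j ^ 2) * ∫ ξ, gaussWeight G 1 ξ := by
  have hs0 : 0 < s := by linarith
  rw [h.integral_exp_mul_gaussWeight hs0, integral_gaussWeight hs0, ← mul_assoc, mul_comm K]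
  have hI := h.integral_gaussWeight_one_pos
  have h1 : b ⬝ᵥ (W G).mulVec b / (2 * s) ≤ (κ * n)⁻¹ * ∑ j, b j ^ 2 := by
    refine le_trans ?_ (h.dotProduct_W_mulVec_le b)
    exact div_le_self (h.dotProduct_W_mulVec_nonneg b) (by linarith)
  gcongr

theorem pow_abs_le_exp_add_exp (k : ℕ) (x : ℝ) :
    |x| ^ k ≤ k.factorial * (Real.exp x + Real.exp (-x)) := by
  have h1 := Real.pow_div_factorial_le_exp (x := |x|) (abs_nonneg x) k
  rw [div_le_iff₀ (by positivity), mul_comm] at h1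
  refine h1.trans (mul_le_mul_of_nonneg_left ?_ (by positivity))
  rcases abs_cases x with ⟨h, -⟩ | ⟨h, -⟩ <;> rw [h] <;> linarith [Real.exp_pos x, Real.exp_pos (-x)]

/-- The scale `√(κ n)` matches the fluctuations of `b · ξ`, which have size `O(|b| / √(κ n))`. At
this scale both exponential moments are bounded in terms of `|b|` alone. -/
theorem mul_pow_abs_le (h : HasGap G κ) (b : Fin n → ℝ) (k : ℕ) (s : ℝ) (ξ : Fin n → ℝ) :
    |b ⬝ᵥ ξ| ^ k * gaussWeight G s ξ ≤ k.factorial * (Real.sqrt (κ * n))⁻¹ ^ k *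
      (Real.exp ((Real.sqrt (κ * n) • b) ⬝ᵥ ξ) * gaussWeight G s ξ +
        Real.exp ((-Real.sqrt (κ * n) • b) ⬝ᵥ ξ) * gaussWeight G s ξ) := by
  have hσ : 0 < Real.sqrt (κ * n) := Real.sqrt_pos.2 h.mul_pos
  set σ := Real.sqrt (κ * n)
  have h1 := pow_abs_le_exp_add_exp k (σ * (b ⬝ᵥ ξ))
  rw [abs_mul, mul_pow, abs_of_pos hσ] at h1
  rw [smul_dotProduct, smul_dotProduct, smul_eq_mul, smul_eq_mul, neg_mul, ← add_mul, ← mul_assoc]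
  refine mul_le_mul_of_nonneg_right ?_ (gaussWeight_pos G s ξ).le
  calc |b ⬝ᵥ ξ| ^ k = σ⁻¹ ^ k * (σ ^ k * |b ⬝ᵥ ξ| ^ k) := by
        rw [← mul_assoc, ← mul_pow, inv_mul_cancel₀ hσ.ne', one_pow, one_mul]
    _ ≤ σ⁻¹ ^ k * (k.factorial * (Real.exp (σ * (b ⬝ᵥ ξ)) + Real.exp (-(σ * (b ⬝ᵥ ξ))))) :=
        mul_le_mul_of_nonneg_left h1 (by positivity)
    _ = _ := by ring

theorem integrable_pow_abs_mul_gaussWeight (h : HasGap G κ) {s : ℝ} (hs : 0 < s)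
    (b : Fin n → ℝ) (k : ℕ) : Integrable fun ξ => |b ⬝ᵥ ξ| ^ k * gaussWeight G s ξ := by
  have hi := ((h.integrable_exp_mul_gaussWeight hs (Real.sqrt (κ * n) • b)).add
    (h.integrable_exp_mul_gaussWeight hs (-Real.sqrt (κ * n) • b))).const_mul
      (k.factorial * (Real.sqrt (κ * n))⁻¹ ^ k)
  refine hi.mono' (Continuous.aestronglyMeasurable (by fun_prop))
    (Filter.Eventually.of_forall fun ξ => ?_)
  rw [Real.norm_of_nonneg (by have := gaussWeight_pos G s ξ; positivity)]
  exact h.mul_pow_abs_le b k s ξ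

/-- Absolute moments of linear forms under the Gaussian weight. -/
theorem integral_pow_abs_mul_gaussWeight_le (h : HasGap G κ) {s K : ℝ} (hs : 1 / 2 ≤ s)
    (hK : (Real.sqrt s)⁻¹ ^ n ≤ K) (b : Fin n → ℝ) (k : ℕ) :
    ∫ ξ, |b ⬝ᵥ ξ| ^ k * gaussWeight G s ξ ≤
      k.factorial * (Real.sqrt (κ * n))⁻¹ ^ k * (2 * K * Real.exp (∑ j, b j ^ 2)) *
        ∫ ξ, gaussWeight G 1 ξ := by
  have hs0 : 0 < s := by linarith
  have hk := h.mul_pos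
  have hσ : 0 < Real.sqrt (κ * n) := Real.sqrt_pos.2 hk
  have hsq : ∀ c : ℝ, c ^ 2 = κ * n →
      (κ * n)⁻¹ * ∑ j, (c • b) j ^ 2 = ∑ j, b j ^ 2 := by
    intro c hc
    simp only [Pi.smul_apply, smul_eq_mul, mul_pow, hc, ← Finset.mul_sum]
    rw [← mul_assoc, inv_mul_cancel₀ hk.ne', one_mul]
  have hi1 := h.integrable_exp_mul_gaussWeight hs0 (Real.sqrt (κ * n) • b)
  have hi2 := h.integrable_exp_mul_gaussWeight hs0 (-Real.sqrt (κ * n) • b)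
  have h1 := h.integral_exp_mul_gaussWeight_le hs hK (Real.sqrt (κ * n) • b)
  have h2 := h.integral_exp_mul_gaussWeight_le hs hK (-Real.sqrt (κ * n) • b)
  rw [hsq _ (Real.sq_sqrt hk.le)] at h1
  rw [hsq _ (by rw [neg_sq, Real.sq_sqrt hk.le])] at h2
  refine (integral_mono (h.integrable_pow_abs_mul_gaussWeight hs0 b k)
    ((hi1.add hi2).const_mul _) (fun ξ => h.mul_pow_abs_le b k s ξ)).trans ?_
  rw [integral_const_mul, mul_assoc (_ * _)]
  refine mul_le_mul_of_nonneg_left ?_ (by positivity)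
  refine (integral_add hi1 hi2).trans_le ?_
  linarith

/-- Moments of the differences of coordinates under the Gaussian weight. -/
theorem integral_pow_abs_sub_mul_gaussWeight_le (h : HasGap G κ) {s K : ℝ} (hs : 1 / 2 ≤ s)
    (hK : (Real.sqrt s)⁻¹ ^ n ≤ K) (i j : Fin n) (k : ℕ) :
    Integrable (fun ξ => |ξ i - ξ j| ^ k * gaussWeight G s ξ) ∧
    ∫ ξ, |ξ i - ξ j| ^ k * gaussWeight G s ξ ≤
      k.factorial * (Real.sqrt (κ * n))⁻¹ ^ k * (2 * K * Real.exp 4) *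
        ∫ ξ, gaussWeight G 1 ξ := by
  have h1 : ∀ ξ : Fin n → ℝ, (Pi.single i 1 - Pi.single j 1 : Fin n → ℝ) ⬝ᵥ ξ = ξ i - ξ j := by
    intro ξ
    simp [sub_dotProduct]
  have h2 : ∑ l, (Pi.single i 1 - Pi.single j 1 : Fin n → ℝ) l ^ 2 ≤ 4 := by
    calc ∑ l, (Pi.single i 1 - Pi.single j 1 : Fin n → ℝ) l ^ 2 ≤
        ∑ l, (2 * (Pi.single i 1 : Fin n → ℝ) l + 2 * (Pi.single j 1 : Fin n → ℝ) l) := by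
          refine Finset.sum_le_sum fun l _ => ?_
          simp only [Pi.sub_apply, Pi.single_apply]
          split_ifs <;> norm_num
      _ = 4 := by
          simp [Finset.sum_add_distrib, ← Finset.mul_sum]
          norm_num
  have h3 := h.integrable_pow_abs_mul_gaussWeight (by linarith)
    (Pi.single i 1 - Pi.single j 1) k (s := s)
  have h4 := h.integral_pow_abs_mul_gaussWeight_le hs hK (Pi.single i 1 - Pi.single j 1) k
  simp only [h1] at h3 h4
  refine ⟨h3, h4.trans ?_⟩
  have hK0 : 0 ≤ K := le_trans (by positivity) hK
  have hI := h.integral_gaussWeight_one_pos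
  gcongr

/-- The Gaussian weight is concentrated near the origin. -/
theorem setIntegral_gaussWeight_le (h : HasGap G κ) {s K : ℝ} (hs : 1 / 2 ≤ s)
    (hK : (Real.sqrt s)⁻¹ ^ n ≤ K) (δ t : ℝ) (ht : 0 ≤ t) :
    ∫ ξ in (cube n δ)ᶜ, gaussWeight G s ξ ≤
      n * (2 * K * Real.exp ((κ * n)⁻¹ * t ^ 2 - t * δ)) * ∫ ξ, gaussWeight G 1 ξ := by
  have hs0 : 0 < s := by linarith
  have hI := h.integral_gaussWeight_one_pos
  -- A Chernoff majorant: outside the cube some coordinate exceeds `δ` in absolute value, so one of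
  -- these `2n` exponential tilts dominates the weight.
  set F : (Fin n → ℝ) → ℝ := fun ξ => ∑ j, Real.exp (-(t * δ)) *
    (Real.exp (Pi.single j t ⬝ᵥ ξ) * gaussWeight G s ξ +
      Real.exp (Pi.single j (-t) ⬝ᵥ ξ) * gaussWeight G s ξ) with hF
  have hFj : ∀ j : Fin n, Integrable fun ξ => Real.exp (-(t * δ)) *
      (Real.exp (Pi.single j t ⬝ᵥ ξ) * gaussWeight G s ξ +
        Real.exp (Pi.single j (-t) ⬝ᵥ ξ) * gaussWeight G s ξ) := fun j =>
    ((h.integrable_exp_mul_gaussWeight hs0 _).add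
      (h.integrable_exp_mul_gaussWeight hs0 _)).const_mul _
  have hFi : Integrable F := integrable_finsetSum _ fun j _ => hFj j
  have hF0 : ∀ ξ, 0 ≤ F ξ := fun ξ => Finset.sum_nonneg fun j _ => by
    have := gaussWeight_pos G s ξ
    positivity
  have h1 : ∀ ξ ∈ (cube n δ)ᶜ, gaussWeight G s ξ ≤ F ξ := by
    intro ξ hξ
    simp only [cube, Set.mem_compl_iff, Set.mem_ofPred_eq, not_forall, not_le] at hξ
    obtain ⟨j, hj⟩ := hξ
    refine le_trans ?_ (Finset.single_le_sum (f := fun j => Real.exp (-(t * δ)) *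
      (Real.exp (Pi.single j t ⬝ᵥ ξ) * gaussWeight G s ξ +
      Real.exp (Pi.single j (-t) ⬝ᵥ ξ) * gaussWeight G s ξ)) (fun j _ => by
        have := gaussWeight_pos G s ξ
        positivity) (Finset.mem_univ j))
    simp only [single_dotProduct]
    rw [← add_mul, ← mul_assoc, mul_add, ← Real.exp_add, ← Real.exp_add]
    refine le_mul_of_one_le_left (gaussWeight_pos G s ξ).le ?_
    have h2 : t * δ ≤ t * |ξ j| := mul_le_mul_of_nonneg_left hj.le ht
    rcases abs_cases (ξ j) with ⟨h3, -⟩ | ⟨h3, -⟩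
    · rw [h3] at h2
      have := Real.one_le_exp (x := -(t * δ) + t * ξ j) (by linarith)
      linarith [Real.exp_pos (-(t * δ) + -t * ξ j)]
    · rw [h3] at h2
      have := Real.one_le_exp (x := -(t * δ) + -t * ξ j) (by linarith)
      linarith [Real.exp_pos (-(t * δ) + t * ξ j)]
  have h2 : ∫ ξ in (cube n δ)ᶜ, gaussWeight G s ξ ≤ ∫ ξ, F ξ :=
    (setIntegral_mono_on (h.integrable_gaussWeight hs0).integrableOn hFi.integrableOn
      (measurableSet_cube n δ).compl h1).trans (setIntegral_le_integral hFi (Filter.Eventually.of_forall hF0))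
  refine h2.trans ?_
  rw [integral_finsetSum _ fun j _ => hFj j]
  have h3 : ∀ j : Fin n, ∫ ξ, Real.exp (-(t * δ)) *
      (Real.exp (Pi.single j t ⬝ᵥ ξ) * gaussWeight G s ξ +
      Real.exp (Pi.single j (-t) ⬝ᵥ ξ) * gaussWeight G s ξ) ≤
      2 * K * Real.exp ((κ * n)⁻¹ * t ^ 2 - t * δ) * ∫ ξ, gaussWeight G 1 ξ := by
    intro j
    rw [integral_const_mul, integral_add (h.integrable_exp_mul_gaussWeight hs0 _)
      (h.integrable_exp_mul_gaussWeight hs0 _)]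
    have h4 := h.integral_exp_mul_gaussWeight_le hs hK (Pi.single j t)
    have h5 := h.integral_exp_mul_gaussWeight_le hs hK (Pi.single j (-t))
    have h6 : ∀ c : ℝ, ∑ l, (Pi.single j c : Fin n → ℝ) l ^ 2 = c ^ 2 := by
      intro c
      simp [Pi.single_apply]
    rw [h6] at h4 h5
    rw [neg_sq] at h5
    rw [sub_eq_neg_add, Real.exp_add]
    have := mul_le_mul_of_nonneg_left (add_le_add h4 h5) (Real.exp_pos (-(t * δ))).le
    linarith
  refine (Finset.sum_le_sum fun j _ => h3 j).trans (le_of_eq ?_)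
  simp
  ring

end HasGap

end Gaussian

/-! ### A lower bound for the main integral -/

section LowerBound

variable {n : ℕ} (G : SimpleGraph (Fin n)) [DecidableRel G.Adj]

/-- The real part of `mainExponent`. -/
def realExponent (ξ : Fin n → ℝ) : ℝ :=
  -(1 / 2) * (ξ ⬝ᵥ (Qhat G).mulVec ξ) - (1 / 12) * ∑ e ∈ G.edgeFinset, edgeQuartic ξ e
    + (1 / 2) * R G ξ

theorem mainExponent_eq (ξ : Fin n → ℝ) :
    mainExponent G ξ = Complex.I * ((lap G (α G) ⬝ᵥ ξ : ℝ) : ℂ) + (realExponent G ξ : ℂ) := by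
  rw [mainExponent, realExponent, dotProduct_comm, lap]

theorem realExponent_eq (ξ : Fin n → ℝ) :
    realExponent G ξ = -(1 / 2) * (ξ ⬝ᵥ (Qhat G).mulVec ξ) -
      (1 / 24) * (∑ j, ∑ k, if G.Adj j k then (ξ j - ξ k) ^ 4 else 0) +
      (1 / 2) * ∑ j, ∑ k, lap G ξ j * lap G ξ k * W G j k ^ 2 := by
  rw [realExponent, sum_edgeQuartic, R_eq_sum]
  ring

theorem norm_cexp_mainExponent (ξ : Fin n → ℝ) :
    ‖Complex.exp (mainExponent G ξ)‖ = Real.exp (realExponent G ξ) := by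
  rw [mainExponent_eq, Complex.norm_exp]
  simp

@[fun_prop]
theorem continuous_lap (j : Fin n) : Continuous fun ξ : Fin n → ℝ => lap G ξ j := by
  unfold lap
  simp only [Matrix.mulVec, dotProduct]
  fun_prop

theorem continuous_sum_ite {f : Fin n → Fin n → (Fin n → ℝ) → ℝ}
    (hf : ∀ j k, Continuous (f j k)) :
    Continuous fun ξ => ∑ j, ∑ k, if G.Adj j k then f j k ξ else 0 := by
  refine continuous_finsetSum _ fun j _ => continuous_finsetSum _ fun k _ => ?_
  split_ifs
  · exact hf j k
  · exact continuous_const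

@[fun_prop]
theorem continuous_realExponent : Continuous (realExponent G) := by
  have h : realExponent G = fun ξ => -(1 / 2) * (ξ ⬝ᵥ (Qhat G).mulVec ξ) -
      (1 / 24) * (∑ j, ∑ k, if G.Adj j k then (ξ j - ξ k) ^ 4 else 0) +
      (1 / 2) * ∑ j, ∑ k, lap G ξ j * lap G ξ k * W G j k ^ 2 := funext (realExponent_eq G)
  rw [h]
  have := continuous_sum_ite G (f := fun j k ξ => (ξ j - ξ k) ^ 4) (fun j k => by fun_prop)
  fun_prop

theorem lap_add_smul (ξ β : Fin n → ℝ) (t : ℝ) (j : Fin n) :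
    lap G (ξ + t • β) j = lap G ξ j + t * lap G β j := by
  simp [lap, Matrix.mulVec_add, Matrix.mulVec_smul]

/-- The part of the derivative of `realExponent` in direction `β` that comes from the quartic
terms and from `R`. -/
def correction (β ξ : Fin n → ℝ) : ℝ :=
  -(1 / 6) * (∑ j, ∑ k, if G.Adj j k then (ξ j - ξ k) ^ 3 * (β j - β k) else 0) +
    ∑ j, ∑ k, lap G ξ j * lap G β k * W G j k ^ 2

@[fun_prop]
theorem continuous_correction (β : Fin n → ℝ) : Continuous (correction G β) := by
  unfold correction
  have := continuous_sum_ite G (f := fun j k ξ => (ξ j - ξ k) ^ 3 * (β j - β k))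
    (fun j k => by fun_prop)
  fun_prop

/-- This feeds the integration by parts. For `β = W a` the Gaussian part of the derivative is `-a ·
ξ`, the quantity to be integrated. -/
theorem hasLineDerivAt_realExponent (ξ β : Fin n → ℝ) :
    HasLineDerivAt ℝ (realExponent G) (-(β ⬝ᵥ (Qhat G).mulVec ξ) + correction G β ξ) ξ β := by
  unfold HasLineDerivAt
  have hsym : ξ ⬝ᵥ (Qhat G).mulVec β = β ⬝ᵥ (Qhat G).mulVec ξ := by
    rw [Matrix.dotProduct_mulVec, ← Matrix.mulVec_transpose, (Qhat_isSymm G).eq, dotProduct_comm]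
  have hid := hasDerivAt_id (0 : ℝ)
  have h1 : HasDerivAt (fun t : ℝ => (ξ + t • β) ⬝ᵥ (Qhat G).mulVec (ξ + t • β))
      (2 * (β ⬝ᵥ (Qhat G).mulVec ξ)) 0 := by
    have h2 : (fun t : ℝ => (ξ + t • β) ⬝ᵥ (Qhat G).mulVec (ξ + t • β)) = fun t : ℝ =>
        ξ ⬝ᵥ (Qhat G).mulVec ξ + 2 * (β ⬝ᵥ (Qhat G).mulVec ξ) * t +
          β ⬝ᵥ (Qhat G).mulVec β * t ^ 2 := by
      funext t
      simp only [Matrix.mulVec_add, Matrix.mulVec_smul, dotProduct_add, add_dotProduct,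
        smul_dotProduct, dotProduct_smul, smul_eq_mul, hsym]
      ring
    rw [h2]
    refine (((hid.const_mul (2 * (β ⬝ᵥ (Qhat G).mulVec ξ))).const_add
      (ξ ⬝ᵥ (Qhat G).mulVec ξ)).add ((hid.pow 2).const_mul
        (β ⬝ᵥ (Qhat G).mulVec β))).congr_deriv ?_
    simp
  have h3 : HasDerivAt (fun t : ℝ => ∑ j, ∑ k, if G.Adj j k then
      ((ξ + t • β) j - (ξ + t • β) k) ^ 4 else 0)
      (∑ j, ∑ k, if G.Adj j k then 4 * ((ξ j - ξ k) ^ 3 * (β j - β k)) else 0) 0 := by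
    refine HasDerivAt.fun_sum fun j _ => HasDerivAt.fun_sum fun k _ => ?_
    split_ifs
    · have h4 : HasDerivAt (fun t : ℝ => (ξ + t • β) j - (ξ + t • β) k) (β j - β k) 0 := by
        have h5 : (fun t : ℝ => (ξ + t • β) j - (ξ + t • β) k) =
            fun t : ℝ => ξ j - ξ k + t * (β j - β k) := by
          funext t
          simp only [Pi.add_apply, Pi.smul_apply, smul_eq_mul]
          ring
        rw [h5]
        simpa using (hid.mul_const (β j - β k)).const_add (ξ j - ξ k)
      refine (h4.pow 4).congr_deriv ?_
      simp
      ring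
    · exact hasDerivAt_const _ _
  have h6 : HasDerivAt (fun t : ℝ => ∑ j, ∑ k, lap G (ξ + t • β) j * lap G (ξ + t • β) k *
      W G j k ^ 2) (∑ j, ∑ k, (lap G β j * lap G ξ k + lap G ξ j * lap G β k) *
        W G j k ^ 2) 0 := by
    refine HasDerivAt.fun_sum fun j _ => HasDerivAt.fun_sum fun k _ => ?_
    have h7 : ∀ i, HasDerivAt (fun t : ℝ => lap G (ξ + t • β) i) (lap G β i) 0 := by
      intro i
      simp only [lap_add_smul]
      simpa using (hid.mul_const (lap G β i)).const_add (lap G ξ i)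
    refine (((h7 j).mul (h7 k)).mul_const _).congr_deriv ?_
    simp
  have h8 : ∑ j, ∑ k, (lap G β j * lap G ξ k + lap G ξ j * lap G β k) * W G j k ^ 2 =
      2 * ∑ j, ∑ k, lap G ξ j * lap G β k * W G j k ^ 2 := by
    simp only [add_mul, Finset.sum_add_distrib]
    rw [two_mul]
    congr 1
    rw [Finset.sum_comm]
    refine Finset.sum_congr rfl fun j _ => Finset.sum_congr rfl fun k _ => ?_
    rw [(W_isSymm G).apply]
    ring
  have h9 : ∑ j, ∑ k, (if G.Adj j k then 4 * ((ξ j - ξ k) ^ 3 * (β j - β k)) else 0) =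
      4 * ∑ j, ∑ k, if G.Adj j k then (ξ j - ξ k) ^ 3 * (β j - β k) else 0 := by
    simp only [Finset.mul_sum, mul_ite, mul_zero]
  simp only [realExponent_eq]
  refine (((h1.const_mul _).sub (h3.const_mul _)).add (h6.const_mul _)).congr_deriv ?_
  rw [h8, h9, correction]
  ring

variable {G} {κ : ℝ}

theorem sum_ite_le {f : Fin n → Fin n → ℝ} (hf : ∀ j k, 0 ≤ f j k) (j : Fin n) :
    ∑ k, (if G.Adj j k then f j k else 0) ≤ ∑ k, f j k := by
  refine Finset.sum_le_sum fun k _ => ?_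
  split_ifs
  · exact le_rfl
  · exact hf j k

theorem abs_lap_le (ξ : Fin n → ℝ) (j : Fin n) : |lap G ξ j| ≤ ∑ k, |ξ j - ξ k| := by
  rw [lap_apply]
  refine (Finset.abs_sum_le_sum_abs _ _).trans (Finset.sum_le_sum fun k _ => ?_)
  split_ifs
  · exact le_rfl
  · simp

theorem sum_lap_sq_le (ξ : Fin n → ℝ) :
    ∑ j, lap G ξ j ^ 2 ≤ n * ∑ j, ∑ k, if G.Adj j k then (ξ j - ξ k) ^ 2 else 0 := by
  rw [Finset.mul_sum]
  refine Finset.sum_le_sum fun j _ => ?_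
  rw [lap_apply]
  have h := sq_sum_le_card_mul_sum_sq (s := (Finset.univ : Finset (Fin n)))
    (f := fun k => if G.Adj j k then ξ j - ξ k else 0)
  rw [Finset.card_univ, Fintype.card_fin] at h
  refine h.trans (le_of_eq ?_)
  congr 1
  refine Finset.sum_congr rfl fun k _ => ?_
  split_ifs <;> simp

namespace HasGap

/-- Bound each product by the mean of the two squares, then use the bound on the row sums of squares
of `W`. -/
theorem abs_R_le (h : HasGap G κ) (ξ : Fin n → ℝ) :
    |∑ j, ∑ k, lap G ξ j * lap G ξ k * W G j k ^ 2| ≤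
      ((κ * n) ^ 2)⁻¹ * ∑ j, lap G ξ j ^ 2 := by
  have h1 : |∑ j, ∑ k, lap G ξ j * lap G ξ k * W G j k ^ 2| ≤
      ∑ j, ∑ k, (lap G ξ j ^ 2 / 2 * W G j k ^ 2 + lap G ξ k ^ 2 / 2 * W G k j ^ 2) := by
    refine (Finset.abs_sum_le_sum_abs _ _).trans (Finset.sum_le_sum fun j _ => ?_)
    refine (Finset.abs_sum_le_sum_abs _ _).trans (Finset.sum_le_sum fun k _ => ?_)
    rw [(W_isSymm G).apply j k, ← add_mul, abs_mul, abs_of_nonneg (sq_nonneg (W G j k)), abs_mul]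
    refine mul_le_mul_of_nonneg_right ?_ (sq_nonneg _)
    have := sq_nonneg (|lap G ξ j| - |lap G ξ k|)
    have h3 := sq_abs (lap G ξ j)
    have h4 := sq_abs (lap G ξ k)
    nlinarith
  refine h1.trans ?_
  simp only [Finset.sum_add_distrib]
  rw [Finset.sum_comm (f := fun j k => lap G ξ k ^ 2 / 2 * W G k j ^ 2), ← two_mul]
  simp only [← Finset.mul_sum]
  have h2 : ∑ j, lap G ξ j ^ 2 / 2 * ∑ k, W G j k ^ 2 ≤
      ∑ j, lap G ξ j ^ 2 / 2 * ((κ * n) ^ 2)⁻¹ :=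
    Finset.sum_le_sum fun j _ =>
      mul_le_mul_of_nonneg_left (h.sum_W_sq_le j) (by positivity)
  rw [← Finset.sum_mul, ← Finset.sum_div] at h2
  linarith

/-- Relative to the quadratic form, `R` is of order `1 / n`, so it can be absorbed by a slight
change of scale of the Gaussian. -/
theorem abs_R_le_quadForm (h : HasGap G κ) (ξ : Fin n → ℝ) :
    |∑ j, ∑ k, lap G ξ j * lap G ξ k * W G j k ^ 2| ≤
      2 / (κ ^ 2 * n) * (ξ ⬝ᵥ (Qhat G).mulVec ξ) := by
  have hk := h.pos
  have hn : (0 : ℝ) < n := Nat.cast_pos.2 h.n_pos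
  refine (h.abs_R_le ξ).trans ?_
  have h1 := sum_lap_sq_le (G := G) ξ
  have h2 : ∑ j, ∑ k, (if G.Adj j k then (ξ j - ξ k) ^ 2 else 0) ≤
      2 * (ξ ⬝ᵥ (Qhat G).mulVec ξ) := by
    rw [dotProduct_Qhat_mulVec, dotProduct_lapMatrix_mulVec]
    linarith [sq_nonneg (∑ j, ξ j)]
  calc ((κ * n) ^ 2)⁻¹ * ∑ j, lap G ξ j ^ 2
      ≤ ((κ * n) ^ 2)⁻¹ * (n * (2 * (ξ ⬝ᵥ (Qhat G).mulVec ξ))) :=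
        mul_le_mul_of_nonneg_left (h1.trans (mul_le_mul_of_nonneg_left h2 hn.le)) (by positivity)
    _ = 2 / (κ ^ 2 * n) * (ξ ⬝ᵥ (Qhat G).mulVec ξ) := by field_simp

/-- The integrand of `mainIntegral` is dominated by a Gaussian. -/
theorem exp_realExponent_le (h : HasGap G κ) (ξ : Fin n → ℝ) :
    Real.exp (realExponent G ξ) ≤ gaussWeight G (1 - 2 / (κ ^ 2 * n)) ξ := by
  rw [gaussWeight, Real.exp_le_exp, realExponent_eq]
  have h1 := (abs_le.1 (h.abs_R_le_quadForm ξ)).2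
  have h2 : 0 ≤ ∑ j, ∑ k, (if G.Adj j k then (ξ j - ξ k) ^ 4 else 0) :=
    Finset.sum_nonneg fun j _ => Finset.sum_nonneg fun k _ => by
      split_ifs
      · positivity
      · exact le_rfl
  linarith

/-- Each of the `n` coordinates loses a factor `1 + O(1 / n)` under the change of scale, so the
total mass grows by a bounded factor. -/
theorem inv_sqrt_pow_le (h : HasGap G κ) (hs : 1 / 2 ≤ 1 - 2 / (κ ^ 2 * n)) :
    (Real.sqrt (1 - 2 / (κ ^ 2 * n)))⁻¹ ^ n ≤ Real.exp (4 / κ ^ 2) := by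
  have hk := h.pos
  have hn : (0 : ℝ) < n := Nat.cast_pos.2 h.n_pos
  set x := 2 / (κ ^ 2 * n) with hx
  have hx0 : 0 ≤ x := by positivity
  have h1 : (Real.sqrt (1 - x))⁻¹ ≤ Real.exp (2 * x) := by
    have h2 : 1 - x ≤ Real.sqrt (1 - x) := by
      refine Real.le_sqrt_of_sq_le ?_
      nlinarith
    have h3 : (Real.sqrt (1 - x))⁻¹ ≤ (1 - x)⁻¹ := inv_anti₀ (by linarith) h2
    refine h3.trans ?_
    rw [inv_le_iff_one_le_mul₀ (by linarith)]
    have h4 := Real.add_one_le_exp (2 * x)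
    nlinarith
  calc (Real.sqrt (1 - x))⁻¹ ^ n ≤ Real.exp (2 * x) ^ n :=
        pow_le_pow_left₀ (by positivity) h1 n
    _ = Real.exp (4 / κ ^ 2) := by
        rw [← Real.exp_nat_mul]
        congr 1
        rw [hx]
        field_simp
        ring

end HasGap

end LowerBound

/-! ### Mass of the modulus and size of the correction term. -/

section LowerBound

variable {n : ℕ} {G : SimpleGraph (Fin n)} [DecidableRel G.Adj] {κ : ℝ}

namespace HasGap

theorem integral_sum_pow_abs_sub_le (h : HasGap G κ) {s K : ℝ} (hs : 1 / 2 ≤ s)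
    (hK : (Real.sqrt s)⁻¹ ^ n ≤ K) (p : ℕ) :
    Integrable (fun ξ => (∑ j, ∑ k, |ξ j - ξ k| ^ p) * gaussWeight G s ξ) ∧
    ∫ ξ, (∑ j, ∑ k, |ξ j - ξ k| ^ p) * gaussWeight G s ξ ≤
      n ^ 2 * (p.factorial * (Real.sqrt (κ * n))⁻¹ ^ p * (2 * K * Real.exp 4)) *
        ∫ ξ, gaussWeight G 1 ξ := by
  have h1 := fun i j => h.integral_pow_abs_sub_mul_gaussWeight_le hs hK i j p
  simp only [Finset.sum_mul]
  have hi : ∀ j, Integrable fun ξ => ∑ k, |ξ j - ξ k| ^ p * gaussWeight G s ξ := fun j =>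
    integrable_finsetSum _ fun k _ => (h1 j k).1
  refine ⟨integrable_finsetSum _ fun j _ => hi j, ?_⟩
  rw [integral_finsetSum _ fun j _ => hi j]
  simp only [integral_finsetSum _ fun k _ => (h1 _ k).1]
  refine (Finset.sum_le_sum fun j _ => Finset.sum_le_sum fun k _ => (h1 j k).2).trans
    (le_of_eq ?_)
  simp
  ring

/-- The integral of the modulus of the integrand is bounded below. -/
theorem le_integral_exp_realExponent (h : HasGap G κ) (hs : 1 / 2 ≤ 1 - 2 / (κ ^ 2 * n)) :
    Real.exp (-(4 * Real.exp 4 / κ ^ 3)) * ∫ ξ, gaussWeight G 1 ξ ≤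
      ∫ ξ, Real.exp (realExponent G ξ) := by
  have hκ := h.pos
  have hκ1 := h.le_one
  have hn : (0 : ℝ) < n := Nat.cast_pos.2 h.n_pos
  have hk := h.mul_pos
  set M := 4 * Real.exp 4 / κ ^ 3 with hM
  -- `F` bounds the loss in the exponent compared with the pure Gaussian, and `M` bounds its
  -- Gaussian mean through the second and fourth moments.
  set F : (Fin n → ℝ) → ℝ := fun ξ => 1 / 24 * (∑ j, ∑ k, |ξ j - ξ k| ^ 4) +
    1 / 2 * (((κ * n) ^ 2)⁻¹ * n) * ∑ j, ∑ k, |ξ j - ξ k| ^ 2 with hF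
  have hsqrt : (Real.sqrt (κ * n))⁻¹ ^ 2 = (κ * n)⁻¹ := by
    rw [inv_pow, Real.sq_sqrt hk.le]
  have h4 := h.integral_sum_pow_abs_sub_le (s := 1) (K := 1) (by norm_num) (by simp) 4
  have h2 := h.integral_sum_pow_abs_sub_le (s := 1) (K := 1) (by norm_num) (by simp) 2
  have hG0 := h.integral_gaussWeight_one_pos
  set G0 := ∫ ξ, gaussWeight G 1 ξ with hG0d
  have hFeq : (fun ξ => F ξ * gaussWeight G 1 ξ) = fun ξ =>
      1 / 24 * ((∑ j, ∑ k, |ξ j - ξ k| ^ 4) * gaussWeight G 1 ξ) +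
      1 / 2 * (((κ * n) ^ 2)⁻¹ * n) * ((∑ j, ∑ k, |ξ j - ξ k| ^ 2) * gaussWeight G 1 ξ) := by
    funext ξ
    rw [hF]
    ring
  have hFi : Integrable fun ξ => F ξ * gaussWeight G 1 ξ := by
    rw [hFeq]
    exact (h4.1.const_mul _).add (h2.1.const_mul _)
  have hFle : ∫ ξ, F ξ * gaussWeight G 1 ξ ≤ M * G0 := by
    rw [hFeq, integral_add (h4.1.const_mul _) (h2.1.const_mul _), integral_const_mul,
      integral_const_mul]
    have e4 : (Real.sqrt (κ * n))⁻¹ ^ 4 = (κ * n)⁻¹ ^ 2 := by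
      rw [← hsqrt]; ring
    have h5 := mul_le_mul_of_nonneg_left h4.2 (by norm_num : (0 : ℝ) ≤ 1 / 24)
    have h6 := mul_le_mul_of_nonneg_left h2.2
      (by positivity : (0 : ℝ) ≤ 1 / 2 * (((κ * n) ^ 2)⁻¹ * n))
    rw [e4] at h5
    rw [hsqrt] at h6
    refine (add_le_add h5 h6).trans ?_
    have e5 : 1 / 24 * (n ^ 2 * ((4 : ℕ).factorial * (κ * n)⁻¹ ^ 2 * (2 * 1 * Real.exp 4)) * G0) =
        2 * Real.exp 4 / κ ^ 2 * G0 := by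
      norm_num [Nat.factorial]
      field_simp
    have e6 : 1 / 2 * (((κ * n) ^ 2)⁻¹ * n) *
        (n ^ 2 * ((2 : ℕ).factorial * (κ * n)⁻¹ * (2 * 1 * Real.exp 4)) * G0) =
        2 * Real.exp 4 / κ ^ 3 * G0 := by
      norm_num [Nat.factorial]
      field_simp
    rw [e5, e6]
    have h7 : 2 * Real.exp 4 / κ ^ 2 ≤ 2 * Real.exp 4 / κ ^ 3 := by
      refine div_le_div_of_nonneg_left (by positivity) (by positivity) ?_
      exact pow_le_pow_of_le_one hκ.le hκ1 (by norm_num)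
    have h8 : M = 2 * Real.exp 4 / κ ^ 3 + 2 * Real.exp 4 / κ ^ 3 := by rw [hM]; ring
    rw [h8]
    nlinarith
  have hpt : ∀ ξ, Real.exp (-M) * ((1 + M) * gaussWeight G 1 ξ - F ξ * gaussWeight G 1 ξ) ≤
      Real.exp (realExponent G ξ) := by
    intro ξ
    have h5 : -F ξ - 1 / 2 * (ξ ⬝ᵥ (Qhat G).mulVec ξ) ≤ realExponent G ξ := by
      rw [realExponent_eq, hF]
      have h6 := (abs_le.1 (h.abs_R_le ξ)).1
      have h7 := sum_lap_sq_le (G := G) ξ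
      have h8 : ∑ j, ∑ k, (if G.Adj j k then (ξ j - ξ k) ^ 2 else 0) ≤
          ∑ j, ∑ k, |ξ j - ξ k| ^ 2 := by
        refine Finset.sum_le_sum fun j _ => ?_
        simp only [sq_abs]
        exact sum_ite_le (f := fun j k => (ξ j - ξ k) ^ 2) (fun j k => sq_nonneg _) j
      have h9 : ∑ j, ∑ k, (if G.Adj j k then (ξ j - ξ k) ^ 4 else 0) ≤
          ∑ j, ∑ k, |ξ j - ξ k| ^ 4 := by
        refine Finset.sum_le_sum fun j _ => ?_
        simp only [Even.pow_abs (by decide : Even 4)]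
        exact sum_ite_le (f := fun j k => (ξ j - ξ k) ^ 4) (fun j k => by positivity) j
      have h10 : ((κ * n) ^ 2)⁻¹ * ∑ j, lap G ξ j ^ 2 ≤
          ((κ * n) ^ 2)⁻¹ * (n * ∑ j, ∑ k, |ξ j - ξ k| ^ 2) :=
        mul_le_mul_of_nonneg_left (h7.trans (mul_le_mul_of_nonneg_left h8 hn.le)) (by positivity)
      linarith
    -- Jensen's inequality in tangent-line form: bound `exp (-F)` from below by its tangent at `F =
    -- M`, then integrate.
    have h6 : Real.exp (-M) * (1 + M - F ξ) ≤ Real.exp (-F ξ) := by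
      have h7 := Real.add_one_le_exp (M - F ξ)
      calc Real.exp (-M) * (1 + M - F ξ) ≤ Real.exp (-M) * Real.exp (M - F ξ) :=
            mul_le_mul_of_nonneg_left (by linarith) (Real.exp_pos _).le
        _ = Real.exp (-F ξ) := by rw [← Real.exp_add]; ring_nf
    calc Real.exp (-M) * ((1 + M) * gaussWeight G 1 ξ - F ξ * gaussWeight G 1 ξ)
        = Real.exp (-M) * (1 + M - F ξ) * gaussWeight G 1 ξ := by ring
      _ ≤ Real.exp (-F ξ) * gaussWeight G 1 ξ :=
          mul_le_mul_of_nonneg_right h6 (gaussWeight_pos G 1 ξ).le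
      _ = Real.exp (-F ξ - 1 / 2 * (ξ ⬝ᵥ (Qhat G).mulVec ξ)) := by
          rw [gaussWeight, ← Real.exp_add]; ring_nf
      _ ≤ Real.exp (realExponent G ξ) := Real.exp_le_exp.2 h5
  have hgi := h.integrable_gaussWeight one_pos
  have hi1 : Integrable fun ξ => Real.exp (-M) *
      ((1 + M) * gaussWeight G 1 ξ - F ξ * gaussWeight G 1 ξ) :=
    ((hgi.const_mul _).sub hFi).const_mul _
  have hi2 : Integrable fun ξ => Real.exp (realExponent G ξ) :=
    (h.integrable_gaussWeight (s := 1 - 2 / (κ ^ 2 * n)) (by linarith)).mono'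
      (Continuous.aestronglyMeasurable (by fun_prop)) (Filter.Eventually.of_forall fun ξ => by
        rw [Real.norm_of_nonneg (Real.exp_pos _).le]
        exact h.exp_realExponent_le ξ)
  have h5 := integral_mono hi1 hi2 hpt
  rw [integral_const_mul, integral_sub (hgi.const_mul _) hFi, integral_const_mul] at h5
  refine le_trans (mul_le_mul_of_nonneg_left ?_ (Real.exp_pos _).le) h5
  linarith

/-- The direction of the oscillation. -/
theorem W_mulVec_lap_α (h : HasGap G κ) (j k : Fin n) :
    (W G).mulVec (lap G (α G)) j - (W G).mulVec (lap G (α G)) k = α G j - α G k := by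
  have hn : (n : ℝ) ≠ 0 := Nat.cast_ne_zero.2 h.n_pos.ne'
  have h1 : (W G).mulVec 1 = (n : ℝ)⁻¹ • (1 : Fin n → ℝ) := by
    have h2 := h.W_mulVec_Qhat_mulVec 1
    rw [Qhat_mulVec_one, Matrix.mulVec_smul] at h2
    conv_rhs => rw [← h2]
    rw [smul_smul, inv_mul_cancel₀ hn, one_smul]
  -- Since `W` maps the all-ones vector to a multiple of itself, `W Q α` is `α` minus a constant
  -- vector and has the same differences.
  have h3 : lap G (α G) = (Qhat G).mulVec (α G) - (∑ i, α G i) • (1 : Fin n → ℝ) := by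
    rw [Qhat, Matrix.add_mulVec, lap]
    funext i
    simp [Matrix.mulVec, dotProduct]
  rw [h3, Matrix.mulVec_sub, h.W_mulVec_Qhat_mulVec, Matrix.mulVec_smul, h1]
  simp

theorem abs_lap_α_le (h : HasGap G κ) (j : Fin n) : |lap G (α G) j| ≤ κ⁻¹ := by
  have hn : (n : ℝ) ≠ 0 := Nat.cast_ne_zero.2 h.n_pos.ne'
  refine (abs_lap_le _ j).trans ((Finset.sum_le_sum fun k _ => h.abs_α_sub_le j k).trans
    (le_of_eq ?_))
  simp
  field_simp

theorem lap_W_mulVec_lap_α (h : HasGap G κ) :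
    lap G ((W G).mulVec (lap G (α G))) = lap G (α G) := by
  funext j
  rw [lap_apply, lap_apply]
  refine Finset.sum_congr rfl fun k _ => ?_
  rw [h.W_mulVec_lap_α]

/-- The direction has the differences of `α`, which are only `O(1 / (κ n))`. Since `|ξ j - ξ k|` is
typically `n^(-1/2)`, both double sums, with their prefactors, are of order `n^(-1/2)` in the mean.
-/
theorem abs_correction_le (h : HasGap G κ) (ξ : Fin n → ℝ) :
    |correction G ((W G).mulVec (lap G (α G))) ξ| ≤
      1 / 6 * (κ * n)⁻¹ * (∑ j, ∑ k, |ξ j - ξ k| ^ 3) +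
      κ⁻¹ * ((κ * n) ^ 2)⁻¹ * (∑ j, ∑ k, |ξ j - ξ k| ^ 1) := by
  have hκ := h.pos
  have hk := h.mul_pos
  rw [correction, h.lap_W_mulVec_lap_α]
  refine (abs_add_le _ _).trans (add_le_add ?_ ?_)
  · rw [abs_mul, mul_assoc, Finset.mul_sum]
    refine mul_le_mul (by norm_num) ?_ (abs_nonneg _) (by norm_num)
    refine (Finset.abs_sum_le_sum_abs _ _).trans (Finset.sum_le_sum fun j _ => ?_)
    rw [Finset.mul_sum]
    refine (Finset.abs_sum_le_sum_abs _ _).trans (Finset.sum_le_sum fun k _ => ?_)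
    split_ifs
    · rw [h.W_mulVec_lap_α, abs_mul, abs_pow, mul_comm]
      exact mul_le_mul_of_nonneg_right (h.abs_α_sub_le j k) (by positivity)
    · rw [abs_zero]
      positivity
  · rw [Finset.mul_sum]
    refine (Finset.abs_sum_le_sum_abs _ _).trans (Finset.sum_le_sum fun j _ => ?_)
    simp only [pow_one]
    have h1 : |∑ k, lap G ξ j * lap G (α G) k * W G j k ^ 2| ≤
        ∑ k, |lap G ξ j| * κ⁻¹ * W G j k ^ 2 := by
      refine (Finset.abs_sum_le_sum_abs _ _).trans (Finset.sum_le_sum fun k _ => ?_)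
      rw [abs_mul, abs_mul, abs_of_nonneg (sq_nonneg (W G j k))]
      exact mul_le_mul_of_nonneg_right
        (mul_le_mul_of_nonneg_left (h.abs_lap_α_le k) (abs_nonneg _)) (sq_nonneg _)
    rw [← Finset.mul_sum] at h1
    refine h1.trans ?_
    calc |lap G ξ j| * κ⁻¹ * ∑ k, W G j k ^ 2
        ≤ (∑ k, |ξ j - ξ k|) * κ⁻¹ * ((κ * n) ^ 2)⁻¹ := by
          refine mul_le_mul (mul_le_mul_of_nonneg_right (abs_lap_le ξ j) (by positivity))
            (h.sum_W_sq_le j) (Finset.sum_nonneg fun k _ => sq_nonneg _) ?_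
          have : 0 ≤ ∑ k, |ξ j - ξ k| := Finset.sum_nonneg fun k _ => abs_nonneg _
          positivity
      _ = _ := by ring

theorem integral_abs_correction_le (h : HasGap G κ) {s K : ℝ} (hs : 1 / 2 ≤ s)
    (hK : (Real.sqrt s)⁻¹ ^ n ≤ K) :
    Integrable (fun ξ => |correction G ((W G).mulVec (lap G (α G))) ξ| * gaussWeight G s ξ) ∧
    ∫ ξ, |correction G ((W G).mulVec (lap G (α G))) ξ| * gaussWeight G s ξ ≤
      4 * K * Real.exp 4 / κ ^ 3 * (Real.sqrt (κ * n))⁻¹ * ∫ ξ, gaussWeight G 1 ξ := by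
  have hκ := h.pos
  have hκ1 := h.le_one
  have hn : (0 : ℝ) < n := Nat.cast_pos.2 h.n_pos
  have hk := h.mul_pos
  have hK0 : 0 ≤ K := le_trans (by positivity) hK
  have h3 := h.integral_sum_pow_abs_sub_le hs hK 3
  have h1 := h.integral_sum_pow_abs_sub_le hs hK 1
  have hG0 := h.integral_gaussWeight_one_pos
  set G0 := ∫ ξ, gaussWeight G 1 ξ with hG0d
  have hi := (h3.1.const_mul (1 / 6 * (κ * n)⁻¹)).add (h1.1.const_mul (κ⁻¹ * ((κ * n) ^ 2)⁻¹))
  have hle : ∀ ξ, |correction G ((W G).mulVec (lap G (α G))) ξ| * gaussWeight G s ξ ≤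
      1 / 6 * (κ * n)⁻¹ * ((∑ j, ∑ k, |ξ j - ξ k| ^ 3) * gaussWeight G s ξ) +
      κ⁻¹ * ((κ * n) ^ 2)⁻¹ * ((∑ j, ∑ k, |ξ j - ξ k| ^ 1) * gaussWeight G s ξ) := by
    intro ξ
    refine (mul_le_mul_of_nonneg_right (h.abs_correction_le ξ)
      (gaussWeight_pos G s ξ).le).trans (le_of_eq ?_)
    ring
  have hi' : Integrable fun ξ =>
      |correction G ((W G).mulVec (lap G (α G))) ξ| * gaussWeight G s ξ := by
    refine hi.mono' (Continuous.aestronglyMeasurable (by fun_prop))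
      (Filter.Eventually.of_forall fun ξ => ?_)
    rw [Real.norm_of_nonneg (mul_nonneg (abs_nonneg _) (gaussWeight_pos G s ξ).le)]
    exact hle ξ
  refine ⟨hi', (integral_mono hi' hi hle).trans ?_⟩
  refine (integral_add (h3.1.const_mul _) (h1.1.const_mul _)).trans_le ?_
  rw [integral_const_mul, integral_const_mul]
  have h5 := mul_le_mul_of_nonneg_left h3.2 (by positivity : (0 : ℝ) ≤ 1 / 6 * (κ * n)⁻¹)
  have h6 := mul_le_mul_of_nonneg_left h1.2 (by positivity : (0 : ℝ) ≤ κ⁻¹ * ((κ * n) ^ 2)⁻¹)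
  refine (add_le_add h5 h6).trans ?_
  have hsqrt : (Real.sqrt (κ * n))⁻¹ ^ 2 = (κ * n)⁻¹ := by
    rw [inv_pow, Real.sq_sqrt hk.le]
  set σ := (Real.sqrt (κ * n))⁻¹ with hσ
  have hσ0 : 0 ≤ σ := by positivity
  have e3 : σ ^ 3 = (κ * n)⁻¹ * σ := by rw [← hsqrt]; ring
  have e5 : 1 / 6 * (κ * n)⁻¹ * (n ^ 2 * ((3 : ℕ).factorial * σ ^ 3 * (2 * K * Real.exp 4)) * G0) =
      2 * K * Real.exp 4 * σ * G0 * (κ ^ 2)⁻¹ := by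
    rw [e3]
    norm_num [Nat.factorial]
    field_simp
  have e6 : κ⁻¹ * ((κ * n) ^ 2)⁻¹ *
      (n ^ 2 * ((1 : ℕ).factorial * σ ^ 1 * (2 * K * Real.exp 4)) * G0) =
      2 * K * Real.exp 4 * σ * G0 * (κ ^ 3)⁻¹ := by
    norm_num [Nat.factorial]
    field_simp
  rw [e5, e6]
  have h7 : (κ ^ 2)⁻¹ ≤ (κ ^ 3)⁻¹ :=
    inv_anti₀ (by positivity) (pow_le_pow_of_le_one hκ.le hκ1 (by norm_num))
  have h8 := mul_le_mul_of_nonneg_left h7 (by positivity : 0 ≤ 2 * K * Real.exp 4 * σ * G0)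
  refine (add_le_add_left h8 _).trans (le_of_eq ?_)
  field_simp
  ring

theorem lap_α_dotProduct_W_mulVec_le (h : HasGap G κ) :
    lap G (α G) ⬝ᵥ (W G).mulVec (lap G (α G)) ≤ (κ ^ 3)⁻¹ := by
  have hκ := h.pos
  have hn : (0 : ℝ) < n := Nat.cast_pos.2 h.n_pos
  have hk := h.mul_pos
  refine (h.dotProduct_W_mulVec_le _).trans ?_
  have h1 : ∑ j, lap G (α G) j ^ 2 ≤ ∑ _j : Fin n, κ⁻¹ ^ 2 := by
    refine Finset.sum_le_sum fun j _ => ?_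
    rw [← sq_abs]
    exact pow_le_pow_left₀ (abs_nonneg _) (h.abs_lap_α_le j) 2
  calc (κ * n)⁻¹ * ∑ j, lap G (α G) j ^ 2 ≤ (κ * n)⁻¹ * ∑ _j : Fin n, κ⁻¹ ^ 2 :=
        mul_le_mul_of_nonneg_left h1 (by positivity)
    _ = (κ ^ 3)⁻¹ := by simp; field_simp

end HasGap

end LowerBound

/-! ### The oscillating integral: a differential equation in the strength of the phase. -/

section LowerBound

variable {n : ℕ} {G : SimpleGraph (Fin n)} [DecidableRel G.Adj] {κ : ℝ}

variable (G) in
/-- The integrand of `mainIntegral` with the oscillation scaled by `t`. -/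
def tiltedIntegrand (t : ℝ) (ξ : Fin n → ℝ) : ℂ :=
  Complex.exp ((t : ℂ) * (Complex.I * ((lap G (α G) ⬝ᵥ ξ : ℝ) : ℂ)) + (realExponent G ξ : ℂ))

theorem norm_tiltedIntegrand (t : ℝ) (ξ : Fin n → ℝ) :
    ‖tiltedIntegrand G t ξ‖ = Real.exp (realExponent G ξ) := by
  rw [tiltedIntegrand, Complex.norm_exp]
  simp

@[fun_prop]
theorem continuous_tiltedIntegrand (t : ℝ) : Continuous (tiltedIntegrand G t) := by
  unfold tiltedIntegrand
  fun_prop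

namespace HasGap

theorem W_mulVec_dotProduct_Qhat_mulVec (h : HasGap G κ) (a ξ : Fin n → ℝ) :
    (W G).mulVec a ⬝ᵥ (Qhat G).mulVec ξ = a ⬝ᵥ ξ := by
  rw [Matrix.dotProduct_mulVec, ← Matrix.mulVec_transpose, (Qhat_isSymm G).eq,
    h.Qhat_mulVec_W_mulVec]

theorem hasLineDerivAt_tiltedIntegrand (h : HasGap G κ) (t : ℝ) (ξ : Fin n → ℝ) :
    HasLineDerivAt ℝ (tiltedIntegrand G t)
      (((t * (lap G (α G) ⬝ᵥ (W G).mulVec (lap G (α G))) : ℝ) : ℂ) *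
          (Complex.I * tiltedIntegrand G t ξ) -
        ((lap G (α G) ⬝ᵥ ξ : ℝ) : ℂ) * tiltedIntegrand G t ξ +
        ((correction G ((W G).mulVec (lap G (α G))) ξ : ℝ) : ℂ) * tiltedIntegrand G t ξ)
      ξ ((W G).mulVec (lap G (α G))) := by
  set a := lap G (α G) with ha
  set β := (W G).mulVec a with hβ
  have h1 : HasDerivAt (fun s : ℝ => realExponent G (ξ + s • β))
      (-(β ⬝ᵥ (Qhat G).mulVec ξ) + correction G β ξ) 0 := hasLineDerivAt_realExponent G ξ β
  rw [hβ, h.W_mulVec_dotProduct_Qhat_mulVec, ← hβ] at h1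
  have h2 : HasDerivAt (fun s : ℝ => a ⬝ᵥ (ξ + s • β)) (a ⬝ᵥ β) 0 := by
    have h3 : (fun s : ℝ => a ⬝ᵥ (ξ + s • β)) = fun s : ℝ => a ⬝ᵥ ξ + s * (a ⬝ᵥ β) := by
      funext s
      rw [dotProduct_add, dotProduct_smul, smul_eq_mul]
    rw [h3]
    simpa using ((hasDerivAt_id (0 : ℝ)).mul_const (a ⬝ᵥ β)).const_add (a ⬝ᵥ ξ)
  have h4 := (((h2.ofReal_comp.const_mul Complex.I).const_mul (t : ℂ)).add h1.ofReal_comp).cexp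
  unfold HasLineDerivAt
  refine h4.congr_deriv ?_
  simp only [tiltedIntegrand, Pi.add_apply, zero_smul, add_zero]
  push_cast
  ring

/-- The integrand of `mainIntegral` does not oscillate away. -/
theorem le_norm_integral_cexp_mainExponent (h : HasGap G κ)
    (hs : 1 / 2 ≤ 1 - 2 / (κ ^ 2 * n)) :
    (Real.exp (-((κ ^ 3)⁻¹ / 2)) * Real.exp (-(4 * Real.exp 4 / κ ^ 3)) -
      4 * Real.exp (4 / κ ^ 2) * Real.exp 4 / κ ^ 3 * (Real.sqrt (κ * n))⁻¹) *
        ∫ ξ, gaussWeight G 1 ξ ≤ ‖∫ ξ, Complex.exp (mainExponent G ξ)‖ := by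
  set s := 1 - 2 / (κ ^ 2 * n) with hsd
  have hs0 : 0 < s := by linarith
  have hK := h.inv_sqrt_pow_le hs
  set a := lap G (α G) with ha
  set β := (W G).mulVec a with hβ
  set v := a ⬝ᵥ β with hv
  have hv0 : 0 ≤ v := h.dotProduct_W_mulVec_nonneg a
  have hv1 : v ≤ (κ ^ 3)⁻¹ := h.lap_α_dotProduct_W_mulVec_le
  set G0 := ∫ ξ, gaussWeight G 1 ξ with hG0d
  have hG0 : 0 < G0 := h.integral_gaussWeight_one_pos
  obtain ⟨hci, hcle⟩ := h.integral_abs_correction_le hs hK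
  rw [← ha, ← hβ, ← hG0d] at hcle
  rw [← ha, ← hβ] at hci
  set η := 4 * Real.exp (4 / κ ^ 2) * Real.exp 4 / κ ^ 3 * (Real.sqrt (κ * n))⁻¹ * G0 with hη
  have hdom : ∀ t ξ, ‖tiltedIntegrand G t ξ‖ ≤ gaussWeight G s ξ := fun t ξ => by
    rw [norm_tiltedIntegrand]
    exact h.exp_realExponent_le ξ
  have hTi : ∀ t, Integrable (tiltedIntegrand G t) := fun t =>
    (h.integrable_gaussWeight hs0).mono' (Continuous.aestronglyMeasurable (by fun_prop))
      (Filter.Eventually.of_forall (hdom t))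
  have hXg : Integrable fun ξ => |a ⬝ᵥ ξ| * gaussWeight G s ξ := by
    simpa using h.integrable_pow_abs_mul_gaussWeight hs0 a 1
  have hXi : ∀ t, Integrable fun ξ => ((a ⬝ᵥ ξ : ℝ) : ℂ) * tiltedIntegrand G t ξ := fun t => by
    refine hXg.mono' (Continuous.aestronglyMeasurable (by fun_prop))
      (Filter.Eventually.of_forall fun ξ => ?_)
    rw [norm_mul, Complex.norm_real]
    exact mul_le_mul_of_nonneg_left (hdom t ξ) (norm_nonneg _)
  have hCi : ∀ t, Integrable fun ξ => ((correction G β ξ : ℝ) : ℂ) * tiltedIntegrand G t ξ :=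
    fun t => by
      refine hci.mono' (Continuous.aestronglyMeasurable (by fun_prop))
        (Filter.Eventually.of_forall fun ξ => ?_)
      rw [norm_mul, Complex.norm_real]
      exact mul_le_mul_of_nonneg_left (hdom t ξ) (norm_nonneg _)
  have hCn : ∀ t, ‖∫ ξ, ((correction G β ξ : ℝ) : ℂ) * tiltedIntegrand G t ξ‖ ≤ η := fun t => by
    refine (norm_integral_le_of_norm_le hci (Filter.Eventually.of_forall fun ξ => ?_)).trans hcle
    rw [norm_mul, Complex.norm_real]
    exact mul_le_mul_of_nonneg_left (hdom t ξ) (norm_nonneg _)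
  -- Stein's identity: the derivative along `β` integrates to zero, by integration by parts against
  -- the constant 1.
  have hStein : ∀ t : ℝ, ∫ ξ, ((a ⬝ᵥ ξ : ℝ) : ℂ) * tiltedIntegrand G t ξ =
      ((t * v : ℝ) : ℂ) * (Complex.I * ∫ ξ, tiltedIntegrand G t ξ) +
        ∫ ξ, ((correction G β ξ : ℝ) : ℂ) * tiltedIntegrand G t ξ := by
    intro t
    have hD := h.hasLineDerivAt_tiltedIntegrand t
    rw [← ha, ← hβ, ← hv] at hD
    have hi1 : Integrable fun ξ => ((t * v : ℝ) : ℂ) * (Complex.I * tiltedIntegrand G t ξ) :=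
      ((hTi t).const_mul _).const_mul _
    have hDi := (hi1.sub (hXi t)).add (hCi t)
    have h0 := integral_bilinear_hasLineDerivAt_right_eq_neg_left_of_integrable
      (μ := (volume : Measure (Fin n → ℝ)))
      (f := fun _ => (1 : ℂ)) (f' := fun _ => (0 : ℂ)) (g := tiltedIntegrand G t)
      (g' := fun ξ => ((t * v : ℝ) : ℂ) * (Complex.I * tiltedIntegrand G t ξ) -
        ((a ⬝ᵥ ξ : ℝ) : ℂ) * tiltedIntegrand G t ξ +
        ((correction G β ξ : ℝ) : ℂ) * tiltedIntegrand G t ξ) (v := β)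
      (B := ContinuousLinearMap.mul ℝ ℂ)
      (by simp) (by simp only [ContinuousLinearMap.mul_apply', one_mul]; exact hDi)
      (by simpa only [ContinuousLinearMap.mul_apply', one_mul] using hTi t)
      (fun ξ _ => hasDerivAt_const _ _) (fun ξ _ => hD ξ)
    simp only [ContinuousLinearMap.mul_apply', one_mul, zero_mul, integral_zero, neg_zero] at h0
    have h1 := integral_add (hi1.sub (hXi t)) (hCi t)
    have h2 := integral_sub hi1 (hXi t)
    simp only [Pi.sub_apply] at h1 h2
    rw [h1, h2, integral_const_mul, integral_const_mul] at h0
    linear_combination (-1 : ℂ) * h0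
  set φ : ℝ → ℂ := fun t => ∫ ξ, tiltedIntegrand G t ξ with hφ
  have hφd : ∀ t, HasDerivAt φ (Complex.I * ∫ ξ, ((a ⬝ᵥ ξ : ℝ) : ℂ) * tiltedIntegrand G t ξ) t := by
    intro t
    have h1 := (hasDerivAt_integral_of_dominated_loc_of_deriv_le (𝕜 := ℝ) (x₀ := t)
      (F := fun t ξ => tiltedIntegrand G t ξ)
      (F' := fun t ξ => Complex.I * (((a ⬝ᵥ ξ : ℝ) : ℂ) * tiltedIntegrand G t ξ))
      (s := Set.univ) (μ := volume) Filter.univ_mem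
      (Filter.Eventually.of_forall fun t => (hTi t).aestronglyMeasurable) (hTi t)
      ((hXi t).const_mul _).aestronglyMeasurable
      (Filter.Eventually.of_forall fun ξ t _ => by
        rw [norm_mul, Complex.norm_I, one_mul, norm_mul, Complex.norm_real]
        exact mul_le_mul_of_nonneg_left (hdom t ξ) (norm_nonneg _)) hXg
      (Filter.Eventually.of_forall fun ξ t _ => by
        have h2 : HasDerivAt (fun t : ℝ => (t : ℂ)) 1 t := by
          simpa using (hasDerivAt_id t).ofReal_comp
        have h3 := ((h2.mul_const (Complex.I * ((a ⬝ᵥ ξ : ℝ) : ℂ))).add_const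
          (realExponent G ξ : ℂ)).cexp
        refine h3.congr_deriv ?_
        simp only [tiltedIntegrand, ha]
        ring)).2
    rw [integral_const_mul] at h1
    exact h1
  -- Integrating factor for `φ' = -t v φ + i ∫ correction`: only the small correction remains in the
  -- derivative of `ψ`, so `ψ 1` is close to `ψ 0`.
  set ψ : ℝ → ℂ := fun t => ((Real.exp (t ^ 2 * (v / 2)) : ℝ) : ℂ) * φ t with hψ
  have hψd : ∀ t, HasDerivAt ψ (((Real.exp (t ^ 2 * (v / 2)) : ℝ) : ℂ) *
      (Complex.I * ∫ ξ, ((correction G β ξ : ℝ) : ℂ) * tiltedIntegrand G t ξ)) t := by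
    intro t
    have h1 : HasDerivAt (fun t : ℝ => Real.exp (t ^ 2 * (v / 2)))
        (Real.exp (t ^ 2 * (v / 2)) * (t * v)) t := by
      refine ((((hasDerivAt_id t).pow 2).mul_const (v / 2)).exp).congr_deriv ?_
      simp
      ring
    refine (h1.ofReal_comp.mul (hφd t)).congr_deriv ?_
    rw [hStein t]
    push_cast
    simp only [hφ]
    linear_combination (Complex.exp ((t : ℂ) ^ 2 * ((v : ℂ) / 2)) * t * v *
      ∫ ξ, tiltedIntegrand G t ξ) * Complex.I_mul_I
  have hψb : ‖ψ 1 - ψ 0‖ ≤ Real.exp (v / 2) * η := by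
    refine norm_image_sub_le_of_norm_deriv_le_segment_01'
      (fun t _ => (hψd t).hasDerivWithinAt) (fun t ht => ?_)
    rw [norm_mul, norm_mul, Complex.norm_I, one_mul, Complex.norm_real,
      Real.norm_of_nonneg (Real.exp_pos _).le]
    refine mul_le_mul (Real.exp_le_exp.2 ?_) (hCn t) (norm_nonneg _) (Real.exp_pos _).le
    have h2 : t ^ 2 ≤ 1 := pow_le_one₀ ht.1 ht.2.le
    nlinarith
  have hψ1 : ‖ψ 1‖ = Real.exp (v / 2) * ‖∫ ξ, Complex.exp (mainExponent G ξ)‖ := by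
    have h1 : φ 1 = ∫ ξ, Complex.exp (mainExponent G ξ) := by
      simp only [hφ, tiltedIntegrand, mainExponent_eq, Complex.ofReal_one, one_mul]
    rw [hψ, ← h1, norm_mul, Complex.norm_real, Real.norm_of_nonneg (Real.exp_pos _).le]
    simp
  have hψ0 : Real.exp (-(4 * Real.exp 4 / κ ^ 3)) * G0 ≤ ‖ψ 0‖ := by
    have h1 : ψ 0 = ((∫ ξ, Real.exp (realExponent G ξ) : ℝ) : ℂ) := by
      simp only [hψ, hφ, tiltedIntegrand, Complex.ofReal_zero, zero_mul, zero_add]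
      rw [← integral_complex_ofReal]
      simp
    rw [h1, Complex.norm_real]
    exact (h.le_integral_exp_realExponent hs).trans (le_abs_self _)
  have h1 : ‖ψ 0‖ ≤ ‖ψ 1‖ + ‖ψ 1 - ψ 0‖ := by
    have := norm_sub_le (ψ 1) (ψ 1 - ψ 0)
    rwa [sub_sub_cancel] at this
  have h2 : Real.exp (-(4 * Real.exp 4 / κ ^ 3)) * G0 ≤
      Real.exp (v / 2) * (‖∫ ξ, Complex.exp (mainExponent G ξ)‖ + η) := by
    rw [hψ1] at h1
    linarith
  have h3 := mul_le_mul_of_nonneg_left h2 (Real.exp_pos (-(v / 2))).le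
  rw [← mul_assoc (Real.exp (-(v / 2))) (Real.exp (v / 2)), ← Real.exp_add, neg_add_cancel,
    Real.exp_zero, one_mul] at h3
  have h4 : Real.exp (-((κ ^ 3)⁻¹ / 2)) ≤ Real.exp (-(v / 2)) := Real.exp_le_exp.2 (by linarith)
  have h5 := mul_le_mul_of_nonneg_right h4
    (mul_nonneg (Real.exp_pos (-(4 * Real.exp 4 / κ ^ 3))).le hG0.le)
  rw [sub_mul, mul_assoc]
  linarith

end HasGap

end LowerBound

/-! ### Changing the domain of integration -/

section Domain

variable {n : ℕ}

/-- The lattice `π ℤⁿ`. -/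
def piLattice (n : ℕ) : AddSubgroup (Fin n → ℝ) :=
  AddMonoidHom.range
    { toFun := fun (m : Fin n → ℤ) (j : Fin n) => (m j : ℝ) * Real.pi
      map_zero' := by funext j; simp
      map_add' := fun a b => by funext j; simp [add_mul] : (Fin n → ℤ) →+ (Fin n → ℝ) }

theorem mem_piLattice {x : Fin n → ℝ} :
    x ∈ piLattice n ↔ ∃ m : Fin n → ℤ, (fun j => (m j : ℝ) * Real.pi) = x := Iff.rfl

instance countable_piLattice : Countable (piLattice n) :=
  (Set.countable_range (fun (m : Fin n → ℤ) (j : Fin n) => (m j : ℝ) * Real.pi)).to_subtype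

/-- The half-open interval `(-π/2, π/2]`. -/
def piInterval : Set ℝ := Set.Ioc (-(Real.pi / 2)) (Real.pi / 2)

theorem existsUnique_add_mem_piInterval (x : ℝ) :
    ∃! m : ℤ, x + (m : ℝ) * Real.pi ∈ piInterval := by
  have h := existsUnique_add_zsmul_mem_Ioc Real.pi_pos x (-(Real.pi / 2))
  rw [show -(Real.pi / 2) + Real.pi = Real.pi / 2 by ring] at h
  simpa [piInterval, zsmul_eq_mul] using h

/-- A cell for the lattice `π ℤⁿ`, sheared along coordinate `i₀`. -/
def shearedCell (i₀ : Fin n) (θ : ℝ) : Set (Fin n → ℝ) :=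
  {ξ | ξ i₀ ∈ piInterval ∧ ∀ j, j ≠ i₀ → ξ j - θ * ξ i₀ ∈ piInterval}

theorem measurableSet_shearedCell (i₀ : Fin n) (θ : ℝ) : MeasurableSet (shearedCell i₀ θ) := by
  have h : shearedCell i₀ θ = ((fun ξ : Fin n → ℝ => ξ i₀) ⁻¹' piInterval) ∩
      ⋂ j, ⋂ (_ : j ≠ i₀), ((fun ξ : Fin n → ℝ => ξ j - θ * ξ i₀) ⁻¹' piInterval) := by
    ext ξ
    simp [shearedCell]
  rw [h]
  have hI : MeasurableSet piInterval := measurableSet_Ioc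
  exact ((by fun_prop : Measurable fun ξ : Fin n → ℝ => ξ i₀) hI).inter
    (MeasurableSet.iInter fun j => MeasurableSet.iInter fun _ =>
      (by fun_prop : Measurable fun ξ : Fin n → ℝ => ξ j - θ * ξ i₀) hI)

/-- The shear is triangular: coordinate `i₀` fixes its own shift first, and then each other
coordinate has a unique shift relative to the shifted value at `i₀`. -/
theorem isAddFundamentalDomain_shearedCell (i₀ : Fin n) (θ : ℝ) :
    IsAddFundamentalDomain (piLattice n) (shearedCell i₀ θ) := by
  refine IsAddFundamentalDomain.mk' (measurableSet_shearedCell i₀ θ).nullMeasurableSet ?_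
  intro ξ
  obtain ⟨m₀, hm₀, hm₀'⟩ := existsUnique_add_mem_piInterval (ξ i₀)
  choose m hm hm' using fun j =>
    existsUnique_add_mem_piInterval (ξ j - θ * (ξ i₀ + (m₀ : ℝ) * Real.pi))
  refine ⟨⟨fun j => ((if j = i₀ then m₀ else m j : ℤ) : ℝ) * Real.pi,
    mem_piLattice.2 ⟨_, rfl⟩⟩, ⟨?_, ?_⟩, ?_⟩
  · change ((if i₀ = i₀ then m₀ else m i₀ : ℤ) : ℝ) * Real.pi + ξ i₀ ∈ piInterval
    rw [if_pos rfl, add_comm]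
    exact hm₀
  · intro j hj
    change ((if j = i₀ then m₀ else m j : ℤ) : ℝ) * Real.pi + ξ j -
      θ * (((if i₀ = i₀ then m₀ else m i₀ : ℤ) : ℝ) * Real.pi + ξ i₀) ∈ piInterval
    rw [if_pos rfl, if_neg hj]
    convert! hm j using 1
    ring
  · rintro ⟨y, hy⟩ ⟨h1, h2⟩
    obtain ⟨k, rfl⟩ := mem_piLattice.1 hy
    have h3 : k i₀ = m₀ := by
      refine hm₀' _ ?_
      change ξ i₀ + (k i₀ : ℝ) * Real.pi ∈ piInterval
      rw [add_comm]
      exact h1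
    refine Subtype.ext (funext fun j => ?_)
    change (k j : ℝ) * Real.pi = ((if j = i₀ then m₀ else m j : ℤ) : ℝ) * Real.pi
    by_cases hj : j = i₀
    · rw [if_pos hj, hj, h3]
    · rw [if_neg hj, hm' j (k j)]
      have h4 : (k j : ℝ) * Real.pi + ξ j - θ * ((k i₀ : ℝ) * Real.pi + ξ i₀) ∈ piInterval :=
        h2 j hj
      rw [h3] at h4
      convert! h4 using 1
      ring

/-- Integrals of `π`-periodic functions over the cube and over a sheared cell agree. -/
theorem setIntegral_cube_eq_shearedCell (i₀ : Fin n) (θ : ℝ) {F : (Fin n → ℝ) → ℂ}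
    (hF : ∀ (m : Fin n → ℤ) ξ, F (fun j => (m j : ℝ) * Real.pi + ξ j) = F ξ) :
    ∫ ξ in cube n (Real.pi / 2), F ξ = ∫ ξ in shearedCell i₀ θ, F ξ := by
  have h1 : cube n (Real.pi / 2) = Set.Icc (fun _ : Fin n => -(Real.pi / 2))
      (fun _ => Real.pi / 2) := by
    ext ξ
    simp only [cube, Set.mem_ofPred_eq, Set.mem_Icc, Pi.le_def, abs_le, forall_and]
  -- With `θ = 0` the cell is the half-open cube, which equals the closed one up to a null set.
  have h2 : shearedCell i₀ 0 = Set.pi Set.univ fun _ : Fin n =>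
      Set.Ioc (-(Real.pi / 2)) (Real.pi / 2) := by
    ext ξ
    simp only [shearedCell, Set.mem_ofPred_eq, zero_mul, sub_zero, Set.mem_pi, Set.mem_univ,
      true_implies, piInterval]
    refine ⟨fun h j => ?_, fun h => ⟨h i₀, fun j _ => h j⟩⟩
    by_cases hj : j = i₀
    · rw [hj]
      exact h.1
    · exact h.2 j hj
  have h3 : ∫ ξ in cube n (Real.pi / 2), F ξ = ∫ ξ in shearedCell i₀ 0, F ξ := by
    rw [h1, h2]
    exact (setIntegral_congr_set Measure.univ_pi_Ioc_ae_eq_Icc).symm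
  rw [h3]
  refine (isAddFundamentalDomain_shearedCell i₀ 0).setIntegral_eq
    (isAddFundamentalDomain_shearedCell i₀ θ) ?_
  rintro ⟨y, hy⟩ ξ
  obtain ⟨m, rfl⟩ := mem_piLattice.1 hy
  exact hF m ξ

/-- For a function invariant under diagonal translations, integrals against two weights
are proportional. -/
theorem integral_mul_weight_comm {f : (Fin n → ℝ) → ℂ} {p q : (Fin n → ℝ) → ℝ} {a b : ℝ}
    (hf : Measurable f) (hp : Measurable p) (hq : Measurable q) (hq0 : ∀ ξ, 0 ≤ q ξ)
    (hfd : ∀ ξ (t : ℝ), f (fun j => ξ j + t) = f ξ)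
    (hpa : ∀ ξ : Fin n → ℝ, ∫ t : ℝ, p (fun j => ξ j + t) = a)
    (hqi : ∀ ξ : Fin n → ℝ, Integrable fun t : ℝ => q fun j => ξ j + t)
    (hqb : ∀ ξ : Fin n → ℝ, ∫ t : ℝ, q (fun j => ξ j + t) = b)
    (hfp : Integrable fun ξ => f ξ * (p ξ : ℂ)) (ha : a ≠ 0) :
    Integrable (fun ξ => f ξ * (q ξ : ℂ)) ∧
      (b : ℂ) * ∫ ξ, f ξ * (p ξ : ℂ) = a * ∫ ξ, f ξ * (q ξ : ℂ) := by
  -- Fubini in two ways: integrating out `t` directly gives `b ∫ f p`; after the measure-preserving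
  -- shear `ξ ↦ ξ - t` it gives `a ∫ f q`.
  set H : ℝ × (Fin n → ℝ) → ℂ := fun z =>
    f z.2 * (p z.2 : ℂ) * (q (fun j => z.2 j + z.1) : ℂ) with hH
  have hHm : Measurable H := by
    have h1 : Measurable fun z : ℝ × (Fin n → ℝ) => q (fun j => z.2 j + z.1) :=
      hq.comp (by fun_prop)
    fun_prop
  have hHi : Integrable H ((volume : Measure ℝ).prod (volume : Measure (Fin n → ℝ))) := by
    rw [integrable_prod_iff' hHm.aestronglyMeasurable]
    refine ⟨Filter.Eventually.of_forall fun ξ => ?_, ?_⟩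
    · exact ((hqi ξ).ofReal (𝕜 := ℂ)).const_mul (f ξ * (p ξ : ℂ))
    have h2 : ∀ ξ : Fin n → ℝ, ∫ t : ℝ, ‖H (t, ξ)‖ = ‖f ξ * (p ξ : ℂ)‖ * b := by
      intro ξ
      rw [← hqb ξ, ← integral_const_mul]
      refine integral_congr_ae (Filter.Eventually.of_forall fun t => ?_)
      simp only [hH]
      rw [norm_mul, Complex.norm_real, Real.norm_of_nonneg (hq0 _)]
    simp only [h2]
    exact hfp.norm.mul_const b
  have hshear : MeasurePreserving (fun z : ℝ × (Fin n → ℝ) => (z.1, fun j => z.2 j - z.1))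
      ((volume : Measure ℝ).prod (volume : Measure (Fin n → ℝ)))
      ((volume : Measure ℝ).prod (volume : Measure (Fin n → ℝ))) := by
    refine MeasurePreserving.skew_product (g := fun (t : ℝ) (ξ : Fin n → ℝ) => fun j => ξ j - t)
      (MeasurePreserving.id _) (by unfold Function.uncurry; fun_prop)
      (Filter.Eventually.of_forall fun t => ?_)
    exact (measurePreserving_sub_right volume (fun _ : Fin n => t)).map_eq
  have hH' : ∀ z : ℝ × (Fin n → ℝ), H (z.1, fun j => z.2 j - z.1) =
      f z.2 * (q z.2 : ℂ) * (p (fun j => z.2 j + -z.1) : ℂ) := by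
    intro z
    have h1 := hfd z.2 (-z.1)
    simp only [← sub_eq_add_neg] at h1 ⊢
    simp only [hH, h1, sub_add_cancel]
    ring
  have hHi' : Integrable (fun z : ℝ × (Fin n → ℝ) =>
      f z.2 * (q z.2 : ℂ) * (p (fun j => z.2 j + -z.1) : ℂ))
      ((volume : Measure ℝ).prod (volume : Measure (Fin n → ℝ))) := by
    rw [← funext hH']
    exact (hshear.integrable_comp hHm.aestronglyMeasurable).2 hHi
  have hpa' : ∀ ξ : Fin n → ℝ, ∫ t : ℝ, p (fun j => ξ j + -t) = a := by
    intro ξ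
    rw [← hpa ξ]
    exact integral_neg_eq_self (fun t => p (fun j => ξ j + t)) volume
  have hin : ∀ ξ : Fin n → ℝ, ∫ t : ℝ, f ξ * (q ξ : ℂ) * (p (fun j => ξ j + -t) : ℂ) =
      f ξ * (q ξ : ℂ) * a := by
    intro ξ
    rw [integral_const_mul, integral_complex_ofReal, hpa']
  have e1 : ∫ z, H z ∂((volume : Measure ℝ).prod (volume : Measure (Fin n → ℝ))) =
      b * ∫ ξ, f ξ * (p ξ : ℂ) := by
    rw [integral_prod_symm _ hHi, mul_comm, ← integral_mul_const]
    refine integral_congr_ae (Filter.Eventually.of_forall fun ξ => ?_)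
    simp only [hH]
    rw [integral_const_mul, integral_complex_ofReal, hqb]
  have e2 : ∫ z, H z ∂((volume : Measure ℝ).prod (volume : Measure (Fin n → ℝ))) =
      a * ∫ ξ, f ξ * (q ξ : ℂ) := by
    have h1 : ∫ z, H z ∂((volume : Measure ℝ).prod (volume : Measure (Fin n → ℝ))) =
        ∫ z : ℝ × (Fin n → ℝ), H (z.1, fun j => z.2 j - z.1)
          ∂((volume : Measure ℝ).prod (volume : Measure (Fin n → ℝ))) := by
      conv_lhs => rw [← hshear.map_eq]
      exact integral_map hshear.measurable.aemeasurable hHm.aestronglyMeasurable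
    rw [h1]
    simp only [hH']
    rw [integral_prod_symm _ hHi', mul_comm, ← integral_mul_const]
    exact integral_congr_ae (Filter.Eventually.of_forall hin)
  refine ⟨?_, by rw [← e1, e2]⟩
  have h1 := hHi'.integral_prod_right
  simp only [hin] at h1
  have h2 := h1.mul_const ((a : ℂ)⁻¹)
  refine h2.congr (Filter.Eventually.of_forall fun ξ => ?_)
  have : (a : ℂ) ≠ 0 := Complex.ofReal_ne_zero.2 ha
  simp only []
  field_simp

theorem distPi_le_iff {x ρ : ℝ} : distPi x ≤ ρ ↔ ∃ l : ℤ, |x + Real.pi * l| ≤ ρ := by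
  have hbdd : BddBelow (Set.range fun l : ℤ => |x + Real.pi * l|) :=
    ⟨0, by rintro _ ⟨l, rfl⟩; exact abs_nonneg _⟩
  constructor
  · intro h
    refine ⟨-round (x / Real.pi), le_trans (le_ciInf fun l => ?_) h⟩
    have hpi := Real.pi_pos
    have h1 := round_le (x / Real.pi) (-l)
    have h2 : ∀ m : ℤ, |x + Real.pi * m| = Real.pi * |x / Real.pi - ((-m : ℤ) : ℝ)| := by
      intro m
      rw [← abs_of_pos hpi, ← abs_mul, abs_of_pos hpi]
      congr 1
      push_cast
      field_simp
      ring
    rw [h2, h2, neg_neg]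
    exact mul_le_mul_of_nonneg_left h1 hpi.le
  · rintro ⟨l, hl⟩
    exact (ciInf_le hbdd l).trans hl

/-- Any nonzero multiple of `π` is too far from `x` to be the one within `ρ`. -/
theorem abs_le_of_distPi_le {x ρ : ℝ} (h : distPi x ≤ ρ) (hx : |x| + ρ < Real.pi) : |x| ≤ ρ := by
  obtain ⟨l, hl⟩ := distPi_le_iff.1 h
  have hpi := Real.pi_pos
  have h1 : Real.pi * |(l : ℝ)| < Real.pi * 1 := by
    calc Real.pi * |(l : ℝ)| = |(x + Real.pi * l) - x| := by
          rw [add_sub_cancel_left, abs_mul, abs_of_pos hpi]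
      _ ≤ |x + Real.pi * l| + |x| := abs_sub _ _
      _ < Real.pi * 1 := by linarith
  have h2 : |(l : ℝ)| < 1 := lt_of_mul_lt_mul_left h1 hpi.le
  have h3 : l = 0 := by
    have : |l| < 1 := by exact_mod_cast h2
    exact Int.abs_lt_one_iff.1 this
  simpa [h3] using hl

/-- The points with all differences of coordinates at most `ρ` in absolute value. -/
def nearDiagonal (n : ℕ) (ρ : ℝ) : Set (Fin n → ℝ) := {ξ | ∀ j k, |ξ j - ξ k| ≤ ρ}

/-- The points with all differences of coordinates at distance at most `ρ` from `π ℤ`. -/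
def nearLattice (n : ℕ) (ρ : ℝ) : Set (Fin n → ℝ) := {ξ | ∀ j k, distPi (ξ j - ξ k) ≤ ρ}

theorem measurableSet_nearDiagonal (ρ : ℝ) : MeasurableSet (nearDiagonal n ρ) := by
  have h : nearDiagonal n ρ = ⋂ j, ⋂ k, {ξ : Fin n → ℝ | |ξ j - ξ k| ≤ ρ} := by
    ext ξ
    simp [nearDiagonal]
  rw [h]
  exact MeasurableSet.iInter fun j => MeasurableSet.iInter fun k =>
    measurableSet_le (by fun_prop) (by fun_prop)

theorem measurableSet_nearLattice (ρ : ℝ) : MeasurableSet (nearLattice n ρ) := by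
  have h : nearLattice n ρ =
      ⋂ j, ⋂ k, ⋃ l : ℤ, {ξ : Fin n → ℝ | |ξ j - ξ k + Real.pi * l| ≤ ρ} := by
    ext ξ
    simp [nearLattice, distPi_le_iff]
  rw [h]
  exact MeasurableSet.iInter fun j => MeasurableSet.iInter fun k => MeasurableSet.iUnion fun l =>
    measurableSet_le (by fun_prop) (by fun_prop)

/-- With shear 1 all differences `ξ j - ξ i₀` lie within `π / 2`, so those near `π ℤ` are near 0.
The remaining differences are then at most `2ρ`, again too small to be near a nonzero lattice point.
-/
theorem shearedCell_inter_nearLattice (i₀ : Fin n) {ρ : ℝ} (hρ0 : 0 ≤ ρ) (hρ : ρ ≤ 1 / 2) :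
    shearedCell i₀ 1 ∩ nearLattice n ρ =
      {ξ | ξ i₀ ∈ piInterval} ∩ nearDiagonal n ρ := by
  have hpi := Real.pi_gt_three
  ext ξ
  constructor
  · rintro ⟨⟨h1, h2⟩, h3⟩
    have h4 : ∀ j, |ξ j - ξ i₀| ≤ ρ := by
      intro j
      by_cases hj : j = i₀
      · rw [hj]
        simpa using hρ0
      · have h5 := h2 j hj
        rw [one_mul] at h5
        refine abs_le_of_distPi_le (h3 j i₀) ?_
        have : |ξ j - ξ i₀| ≤ Real.pi / 2 := abs_le.2 ⟨h5.1.le, h5.2⟩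
        linarith
    refine ⟨h1, fun j k => abs_le_of_distPi_le (h3 j k) ?_⟩
    have h5 := abs_sub (ξ j - ξ i₀) (ξ k - ξ i₀)
    rw [sub_sub_sub_cancel_right] at h5
    linarith [h4 j, h4 k]
  · rintro ⟨h1, h2⟩
    refine ⟨⟨h1, fun j _ => ?_⟩, fun j k => distPi_le_iff.2 ⟨0, by simpa using h2 j k⟩⟩
    have h3 := abs_le.1 (h2 j i₀)
    rw [one_mul]
    constructor <;> linarith [h3.1, h3.2]

end Domain

/-! ### Periodicity of the integrand and reduction to a Gaussian weight. -/

section Domain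

variable {n : ℕ} {G : SimpleGraph (Fin n)} [DecidableRel G.Adj]

/-- Regrouped by vertices, each sign appears to the power of the degree, which is even. -/
theorem prod_edgeFinset_pow_eq_one (hG : ∀ j, Even (G.degree j)) (s : Fin n → ℝ)
    (hs : ∀ j, s j = 1 ∨ s j = -1) :
    ∏ e ∈ G.edgeFinset, Sym2.lift ⟨fun j k => s j * s k, fun _ _ => mul_comm _ _⟩ e = 1 := by
  have h1 : ∀ e ∈ G.edgeFinset,
      Sym2.lift ⟨fun j k => s j * s k, fun _ _ => mul_comm _ _⟩ e =
        ∏ v, if v ∈ e then s v else 1 := by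
    intro e he
    induction e using Sym2.ind with
    | _ j k =>
      have hjk : j ≠ k := (SimpleGraph.mem_edgeFinset.1 he : G.Adj j k).ne
      have h2 : Finset.univ.filter (fun v => v ∈ s(j, k)) = {j, k} := by
        ext v
        simp [Sym2.mem_iff]
      rw [← Finset.prod_filter, h2, Finset.prod_pair hjk]
      rfl
  rw [Finset.prod_congr rfl h1, Finset.prod_comm]
  refine Finset.prod_eq_one fun v _ => ?_
  rw [← Finset.prod_filter, ← G.incidenceFinset_eq_filter, Finset.prod_const,
    G.card_incidenceFinset_eq_degree]
  rcases hs v with h | h <;> rw [h]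
  · exact one_pow _
  · exact (hG v).neg_one_pow

/-- The tangents have period `π`; each edge cosine picks up the product of the signs at its two
ends, and these signs cancel over the whole graph. -/
theorem integrand_add_mul_pi (hG : ∀ j, Even (G.degree j)) (r : Fin n) (m : Fin n → ℤ)
    (ξ : Fin n → ℝ) :
    integrand G r (fun j => (m j : ℝ) * Real.pi + ξ j) = integrand G r ξ := by
  have htan : ∀ j k, Real.tan ((m j : ℝ) * Real.pi + ξ j - ((m k : ℝ) * Real.pi + ξ k)) =
      Real.tan (ξ j - ξ k) := by
    intro j k
    have h1 : (m j : ℝ) * Real.pi + ξ j - ((m k : ℝ) * Real.pi + ξ k) =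
        ξ j - ξ k + ((m j - m k : ℤ) : ℝ) * Real.pi := by
      push_cast
      ring
    rw [h1]
    exact Real.tan_periodic.int_mul (m j - m k) (ξ j - ξ k)
  have hcos : ∏ e ∈ G.edgeFinset, edgeCos (fun j => (m j : ℝ) * Real.pi + ξ j) e =
      ∏ e ∈ G.edgeFinset, edgeCos ξ e := by
    have h1 : ∀ e : Sym2 (Fin n), edgeCos (fun j => (m j : ℝ) * Real.pi + ξ j) e =
        Sym2.lift ⟨fun j k => (-1 : ℝ) ^ m j * (-1 : ℝ) ^ m k, fun _ _ => mul_comm _ _⟩ e *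
          edgeCos ξ e := by
      intro e
      induction e using Sym2.ind with
      | _ j k =>
        change Real.cos ((m j : ℝ) * Real.pi + ξ j - ((m k : ℝ) * Real.pi + ξ k)) =
          (-1 : ℝ) ^ m j * (-1 : ℝ) ^ m k * Real.cos (ξ j - ξ k)
        have h2 : (m j : ℝ) * Real.pi + ξ j - ((m k : ℝ) * Real.pi + ξ k) =
            ξ j - ξ k + ((m j - m k : ℤ) : ℝ) * Real.pi := by
          push_cast
          ring
        rw [h2, Real.cos_add_int_mul_pi, zpow_sub₀ (by norm_num), div_eq_mul_inv, ← inv_zpow]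
        norm_num
    rw [Finset.prod_congr rfl fun e _ => h1 e, Finset.prod_mul_distrib,
      prod_edgeFinset_pow_eq_one hG, one_mul]
    intro j
    rcases Int.even_or_odd (m j) with h | h
    · exact Or.inl h.neg_one_zpow
    · exact Or.inr h.neg_one_zpow
  simp only [integrand, hcos, htan]

theorem integrand_add_const (r : Fin n) (ξ : Fin n → ℝ) (t : ℝ) :
    integrand G r (fun j => ξ j + t) = integrand G r ξ := by
  have h : ∀ e : Sym2 (Fin n), edgeCos (fun j => ξ j + t) e = edgeCos ξ e := by
    intro e
    induction e using Sym2.ind with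
    | _ j k =>
      change Real.cos (ξ j + t - (ξ k + t)) = Real.cos (ξ j - ξ k)
      rw [add_sub_add_right_eq_sub]
  simp only [integrand, h, add_sub_add_right_eq_sub]

theorem measurable_integrand (r : Fin n) : Measurable (integrand G r) := by
  have h1 : ∀ e : Sym2 (Fin n), Measurable fun ξ : Fin n → ℝ => edgeCos ξ e := by
    intro e
    induction e using Sym2.ind with
    | _ j k =>
      change Measurable fun ξ : Fin n → ℝ => Real.cos (ξ j - ξ k)
      fun_prop
  have h2 : Measurable Real.tan := by
    have : Real.tan = fun x => Real.sin x / Real.cos x := funext Real.tan_eq_sin_div_cos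
    rw [this]
    fun_prop
  unfold integrand
  refine (Complex.measurable_ofReal.comp (Finset.measurable_fun_prod _ fun e _ => h1 e)).mul
    (Finset.measurable_fun_sum _ fun T _ => Finset.measurable_fun_prod _ fun a _ => ?_)
  refine measurable_const.add (measurable_const.mul (Complex.measurable_ofReal.comp ?_))
  exact h2.comp (by fun_prop)

theorem exists_norm_integrand_le (r : Fin n) {ρ : ℝ} (hρ : ρ ≤ 1 / 2) :
    ∃ C : ℝ, ∀ ξ ∈ nearDiagonal n ρ, ‖integrand G r ξ‖ ≤ C := by
  refine ⟨1 * ∑ T ∈ rootedSpanningTrees G r, ∏ _a ∈ T, (2 : ℝ), fun ξ hξ => ?_⟩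
  rw [integrand, norm_mul]
  refine mul_le_mul ?_ ?_ (norm_nonneg _) zero_le_one
  · rw [Complex.norm_real, Real.norm_eq_abs, Finset.abs_prod]
    refine Finset.prod_le_one (fun e _ => abs_nonneg _) fun e _ => ?_
    induction e using Sym2.ind with
    | _ j k => exact Real.abs_cos_le_one _
  · refine (norm_sum_le _ _).trans (Finset.sum_le_sum fun T _ => ?_)
    rw [norm_prod]
    refine Finset.prod_le_prod (fun a _ => norm_nonneg _) fun a _ => ?_
    refine (norm_add_le _ _).trans ?_
    rw [norm_one, norm_mul, Complex.norm_I, one_mul, Complex.norm_real, Real.norm_eq_abs]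
    have h1 := (hξ a.1 a.2).trans hρ
    linarith [abs_tan_le h1]

/-- The integral of the integrand over the main region, as a Gaussian-weighted integral. -/
theorem setIntegral_mainRegion_integrand (hG : ∀ j, Even (G.degree j)) (hn : 0 < n) (r : Fin n)
    {ε : ℝ} (hρ : (n : ℝ) ^ (-(1 / 2 : ℝ) + ε) ≤ 1 / 2) :
    IntegrableOn (fun ξ => integrand G r ξ * ((Real.exp (-(1 / 2) * (∑ j, ξ j) ^ 2) : ℝ) : ℂ))
      (nearDiagonal n ((n : ℝ) ^ (-(1 / 2 : ℝ) + ε))) ∧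
    ∫ ξ in mainRegion n ε, integrand G r ξ =
      ((Real.pi * n / Real.sqrt (2 * Real.pi) : ℝ) : ℂ) *
        ∫ ξ in nearDiagonal n ((n : ℝ) ^ (-(1 / 2 : ℝ) + ε)),
          integrand G r ξ * ((Real.exp (-(1 / 2) * (∑ j, ξ j) ^ 2) : ℝ) : ℂ) := by
  set ρ := (n : ℝ) ^ (-(1 / 2 : ℝ) + ε) with hρd
  have hρ0 : 0 ≤ ρ := Real.rpow_nonneg (Nat.cast_nonneg n) _
  have hnr : (0 : ℝ) < n := Nat.cast_pos.2 hn
  have hpi := Real.pi_pos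
  set i₀ : Fin n := ⟨0, hn⟩
  have hA := measurableSet_nearDiagonal (n := n) ρ
  have hB := measurableSet_nearLattice (n := n) ρ
  have hI : MeasurableSet {ξ : Fin n → ℝ | ξ i₀ ∈ piInterval} :=
    (measurable_pi_apply i₀) (measurableSet_Ioc : MeasurableSet piInterval)
  have hmain : mainRegion n ε = cube n (Real.pi / 2) ∩ nearLattice n ρ := rfl
  have h1 : ∫ ξ in mainRegion n ε, integrand G r ξ =
      ∫ ξ in {ξ | ξ i₀ ∈ piInterval} ∩ nearDiagonal n ρ, integrand G r ξ := by
    rw [hmain, ← setIntegral_indicator hB, setIntegral_cube_eq_shearedCell i₀ 1,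
      setIntegral_indicator hB, shearedCell_inter_nearLattice i₀ hρ0 hρ]
    intro m ξ
    have h2 : (fun j => (m j : ℝ) * Real.pi + ξ j) ∈ nearLattice n ρ ↔ ξ ∈ nearLattice n ρ := by
      have h3 : ∀ j k, distPi ((m j : ℝ) * Real.pi + ξ j - ((m k : ℝ) * Real.pi + ξ k)) ≤ ρ ↔
          distPi (ξ j - ξ k) ≤ ρ := by
        intro j k
        rw [distPi_le_iff, distPi_le_iff]
        constructor
        · rintro ⟨l, hl⟩
          refine ⟨l + m j - m k, ?_⟩
          convert! hl using 2
          push_cast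
          ring
        · rintro ⟨l, hl⟩
          refine ⟨l - m j + m k, ?_⟩
          convert! hl using 2
          push_cast
          ring
      simp only [nearLattice, Set.mem_ofPred_eq, h3]
    by_cases h4 : ξ ∈ nearLattice n ρ
    · rw [Set.indicator_of_mem (h2.2 h4), Set.indicator_of_mem h4, integrand_add_mul_pi hG]
    · rw [Set.indicator_of_notMem (mt h2.1 h4), Set.indicator_of_notMem h4]
  set f : (Fin n → ℝ) → ℂ := (nearDiagonal n ρ).indicator (integrand G r) with hf
  set p : (Fin n → ℝ) → ℝ := fun ξ => piInterval.indicator 1 (ξ i₀) with hp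
  set q : (Fin n → ℝ) → ℝ := fun ξ => Real.exp (-(1 / 2) * (∑ j, ξ j) ^ 2) with hq
  have hIm : MeasurableSet piInterval := measurableSet_Ioc
  have hpm : Measurable p := (measurable_one.indicator hIm).comp (measurable_pi_apply i₀)
  have hqt : ∀ ξ : Fin n → ℝ, (fun t : ℝ => q fun j => ξ j + t) = fun t : ℝ =>
      Real.exp (-((n : ℝ) ^ 2 / 2) * (t + (∑ j, ξ j) / n) ^ 2) := by
    intro ξ
    funext t
    simp only [hq, Finset.sum_add_distrib, Finset.sum_const, Finset.card_univ, Fintype.card_fin,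
      nsmul_eq_mul]
    congr 1
    field_simp
    ring
  have hfp : (fun ξ => f ξ * (p ξ : ℂ)) =
      ({ξ | ξ i₀ ∈ piInterval} ∩ nearDiagonal n ρ).indicator (integrand G r) := by
    funext ξ
    by_cases h2 : ξ i₀ ∈ piInterval <;> by_cases h3 : ξ ∈ nearDiagonal n ρ <;>
      simp [hf, hp, h2, h3]
  obtain ⟨C, hC⟩ := exists_norm_integrand_le (G := G) r hρ
  have hfpi : Integrable fun ξ => f ξ * (p ξ : ℂ) := by
    rw [hfp, integrable_indicator_iff (hI.inter hA)]
    refine Measure.integrableOn_of_bounded (M := C) ?_ (measurable_integrand r).aestronglyMeasurable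
      ((ae_restrict_iff' (hI.inter hA)).2 (Filter.Eventually.of_forall fun ξ hξ => hC ξ hξ.2))
    refine ne_top_of_le_ne_top (isCompact_closedBall (0 : Fin n → ℝ) 4).measure_lt_top.ne
      (measure_mono ?_)
    rintro ξ ⟨h2, h3⟩
    rw [mem_closedBall_zero_iff, pi_norm_le_iff_of_nonneg (by norm_num)]
    intro j
    have h4 : |ξ i₀| ≤ Real.pi / 2 := abs_le.2 ⟨h2.1.le, h2.2⟩
    have h5 := h3 j i₀
    have h6 := abs_add_le (ξ j - ξ i₀) (ξ i₀)
    rw [sub_add_cancel] at h6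
    rw [Real.norm_eq_abs]
    linarith [Real.pi_le_four]
  -- Along a diagonal line the strip has length `π`. The Gaussian weight integrates to `√(2π) / n`,
  -- because translating by `t` changes the coordinate sum by `n t`.
  have hkey := integral_mul_weight_comm (f := f) (p := p) (q := q) (a := Real.pi)
    (b := Real.sqrt (2 * Real.pi) / n) ((measurable_integrand r).indicator hA) hpm
    (by fun_prop) (fun ξ => (Real.exp_pos _).le)
    (fun ξ t => by
      have h2 : (fun j => ξ j + t) ∈ nearDiagonal n ρ ↔ ξ ∈ nearDiagonal n ρ := by
        simp only [nearDiagonal, Set.mem_ofPred_eq, add_sub_add_right_eq_sub]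
      rw [hf]
      by_cases h4 : ξ ∈ nearDiagonal n ρ
      · rw [Set.indicator_of_mem (h2.2 h4), Set.indicator_of_mem h4, integrand_add_const]
      · rw [Set.indicator_of_notMem (mt h2.1 h4), Set.indicator_of_notMem h4])
    (fun ξ => by
      simp only [hp]
      rw [integral_add_left_eq_self (fun x => piInterval.indicator (1 : ℝ → ℝ) x) (ξ i₀),
        integral_indicator_one hIm, piInterval, Real.volume_real_Ioc_of_le (by linarith)]
      ring)
    (fun ξ => by
      rw [hqt]
      exact (integrable_exp_neg_mul_sq (by positivity)).comp_add_right _)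
    (fun ξ => by
      rw [hqt, integral_add_right_eq_self
        (fun t : ℝ => Real.exp (-((n : ℝ) ^ 2 / 2) * t ^ 2)), integral_gaussian]
      rw [show Real.pi / ((n : ℝ) ^ 2 / 2) = 2 * Real.pi / (n : ℝ) ^ 2 by field_simp,
        Real.sqrt_div (by positivity), Real.sqrt_sq hnr.le])
    hfpi hpi.ne'
  have hfq : (fun ξ => f ξ * (q ξ : ℂ)) =
      (nearDiagonal n ρ).indicator fun ξ => integrand G r ξ * (q ξ : ℂ) := by
    funext ξ
    by_cases h3 : ξ ∈ nearDiagonal n ρ <;> simp [hf, h3]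
  rw [hfp, hfq, integral_indicator (hI.inter hA), integral_indicator hA, ← h1,
    integrable_indicator_iff hA] at hkey
  refine ⟨hkey.1, ?_⟩
  have hs : 0 < Real.sqrt (2 * Real.pi) := Real.sqrt_pos.2 (by positivity)
  have hsC : (Real.sqrt (2 * Real.pi) : ℂ) ≠ 0 := Complex.ofReal_ne_zero.2 hs.ne'
  have hnC : (n : ℂ) ≠ 0 := Nat.cast_ne_zero.2 hn.ne'
  have h2 := hkey.2
  change _ = _ * ∫ ξ in nearDiagonal n ρ, integrand G r ξ * (q ξ : ℂ)
  generalize (∫ ξ in nearDiagonal n ρ, integrand G r ξ * (q ξ : ℂ)) = X at h2 ⊢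
  generalize (∫ ξ in {ξ | ξ i₀ ∈ piInterval} ∩ nearDiagonal n ρ, integrand G r ξ) = Y at h1 h2 ⊢
  rw [h1] at h2 ⊢
  push_cast at h2 ⊢
  field_simp at h2 ⊢
  rw [h2]

/-- `S₀` as a Gaussian-weighted integral near the diagonal. -/
theorem S₀_eq (hG : ∀ j, Even (G.degree j)) (hn : 0 < n) {ε : ℝ}
    (hρ : (n : ℝ) ^ (-(1 / 2 : ℝ) + ε) ≤ 1 / 2) :
    S₀ G ε = ((Real.pi / Real.sqrt (2 * Real.pi) / n : ℝ) : ℂ) *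
        ∫ ξ in nearDiagonal n ((n : ℝ) ^ (-(1 / 2 : ℝ) + ε)),
          (n : ℂ) * (∑ r, integrand G r ξ) *
            ((Real.exp (-(1 / 2) * (∑ j, ξ j) ^ 2) : ℝ) : ℂ) := by
  have h := fun r => setIntegral_mainRegion_integrand hG hn r hρ
  have hnC : (n : ℂ) ≠ 0 := Nat.cast_ne_zero.2 hn.ne'
  rw [S₀, Finset.sum_congr rfl fun r _ => (h r).2, ← Finset.mul_sum,
    ← integral_finsetSum _ fun r _ => (h r).1]
  simp only [mul_assoc (n : ℂ), ← Finset.sum_mul]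
  rw [integral_const_mul]
  push_cast
  field_simp

end Domain

/-! ### The spectral gap -/

section Spectral

variable {n : ℕ} {G : SimpleGraph (Fin n)} [DecidableRel G.Adj]

/-- All eigenvalues of the Laplacian but one are at least the algebraic connectivity. -/
theorem exists_forall_ne_algebraicConnectivity_le (hn : 2 ≤ n) :
    ∃ l : Fin n, ∀ i, i ≠ l →
      algebraicConnectivity G ≤ (G.posSemidef_lapMatrix ℝ).isHermitian.eigenvalues i := by
  have hc : 1 < Fintype.card (Fin n) := by rw [Fintype.card_fin]; omega
  set e : Fin (Fintype.card (Fin n)) ≃ Fin n := Fintype.equivOfCardEq (Fintype.card_fin _)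
  set m : Fin (Fintype.card (Fin n)) := ⟨0, by omega⟩
  -- `e` is the enumeration behind `eigenvalues`, and `m.rev` is the last position of the
  -- non-increasing list, that of the smallest eigenvalue.
  refine ⟨e m.rev, fun i hi => ?_⟩
  rw [algebraicConnectivity, dif_pos hc]
  refine Matrix.IsHermitian.eigenvalues₀_antitone _ ?_
  have h1 : e.symm i ≠ m.rev := fun h => hi (by rw [← h, Equiv.apply_symm_apply])
  have h2 : (e.symm i : ℕ) ≠ (m.rev : ℕ) := fun h => h1 (Fin.ext h)
  have h3 := (e.symm i).isLt
  change (e.symm i : ℕ) ≤ _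
  rw [Fin.val_rev] at h2 ⊢
  change (e.symm i : ℕ) ≠ _ - (0 + 1) at h2
  change _ ≤ _ - (1 + 1)
  omega

/-- Eigenvectors with nonzero eigenvalue are orthogonal to the all-ones vector, because `Q`
annihilates it. That vector is therefore a multiple of the one remaining eigenvector, on which `J`
contributes `n`; on the others the eigenvalue is already at least `γ n`. -/
theorem IsMixing.hasGap {γ : ℝ} (hG : IsMixing G γ) (hγ : 0 < γ) (hn : 2 ≤ n) :
    HasGap G (min γ 1) := by
  have hn0 : 0 < n := by omega
  have hnr : (0 : ℝ) < n := Nat.cast_pos.2 hn0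
  refine ⟨lt_min hγ one_pos, min_le_right _ _, hn0, fun ξ => ?_⟩
  have hQ := (G.posSemidef_lapMatrix ℝ).isHermitian
  set u := hQ.eigenvectorBasis
  set μ := hQ.eigenvalues
  obtain ⟨l, hl⟩ := exists_forall_ne_algebraicConnectivity_le (G := G) hn
  have hl' : ∀ i, i ≠ l → γ * n ≤ μ i := fun i hi => le_trans hG (hl i hi)
  have hl0 : 0 ≤ μ l := (G.posSemidef_lapMatrix ℝ).eigenvalues_nonneg l
  have hdot : ∀ (x y : Fin n → ℝ), inner ℝ (WithLp.toLp 2 x : EuclideanSpace ℝ (Fin n))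
      (WithLp.toLp 2 y) = x ⬝ᵥ y := fun x y => by
    rw [EuclideanSpace.inner_toLp_toLp, star_trivial, dotProduct_comm]
  have hu : ∀ i, (WithLp.toLp 2 (u i).ofLp : EuclideanSpace ℝ (Fin n)) = u i := fun i => rfl
  have hpar : ∀ x y : Fin n → ℝ, ∑ i, ((u i).ofLp ⬝ᵥ x) * ((u i).ofLp ⬝ᵥ y) = x ⬝ᵥ y := by
    intro x y
    rw [← hdot, ← u.sum_inner_mul_inner]
    refine Finset.sum_congr rfl fun i _ => ?_
    rw [← hdot, ← hdot, hu, real_inner_comm]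
  have hQu : ∀ i (x : Fin n → ℝ), (u i).ofLp ⬝ᵥ (G.lapMatrix ℝ).mulVec x =
      μ i * ((u i).ofLp ⬝ᵥ x) := by
    intro i x
    rw [Matrix.dotProduct_mulVec, ← Matrix.mulVec_transpose, (G.isSymm_lapMatrix (R := ℝ)).eq,
      hQ.mulVec_eigenvectorBasis i, smul_dotProduct, smul_eq_mul]
  set o : Fin n → ℝ := fun _ => 1
  have ho : ∀ i, i ≠ l → (u i).ofLp ⬝ᵥ o = 0 := by
    intro i hi
    have h1 := hQu i o
    have h2 : (G.lapMatrix ℝ).mulVec o = 0 := G.lapMatrix_mulVec_const_eq_zero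
    rw [h2, dotProduct_zero] at h1
    exact (mul_eq_zero.1 h1.symm).resolve_left
      ((mul_pos hγ hnr).trans_le (hl' i hi)).ne'
  have hol : ∀ y : Fin n → ℝ, o ⬝ᵥ y = ((u l).ofLp ⬝ᵥ o) * ((u l).ofLp ⬝ᵥ y) := by
    intro y
    rw [← hpar o y]
    exact Finset.sum_eq_single l (fun i _ hi => by rw [ho i hi, zero_mul]) (by simp)
  have hoo : ((u l).ofLp ⬝ᵥ o) ^ 2 = n := by
    rw [sq, ← hol o]
    simp [o, dotProduct]
  have hsum : ∑ j, ξ j = o ⬝ᵥ ξ := by simp [o, dotProduct]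
  have hsq : ∑ j, ξ j ^ 2 = ∑ i, ((u i).ofLp ⬝ᵥ ξ) ^ 2 := by
    have h1 := hpar ξ ξ
    simp only [dotProduct, ← sq] at h1 ⊢
    exact h1.symm
  have hquad : ξ ⬝ᵥ (Qhat G).mulVec ξ =
      ∑ i, (μ i * ((u i).ofLp ⬝ᵥ ξ) ^ 2 + if i = l then n * ((u i).ofLp ⬝ᵥ ξ) ^ 2 else 0) := by
    have h1 : (Matrix.of fun _ _ => (1 : ℝ) : Matrix (Fin n) (Fin n) ℝ).mulVec ξ =
        (∑ j, ξ j) • o := by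
      funext i
      simp [o, Matrix.mulVec, dotProduct]
    rw [Qhat, Matrix.add_mulVec, dotProduct_add, h1, dotProduct_smul, dotProduct_comm ξ o, hsum,
      ← hpar ξ ((G.lapMatrix ℝ).mulVec ξ), Finset.sum_add_distrib, Finset.sum_ite_eq' ,
      if_pos (Finset.mem_univ l), smul_eq_mul, hol ξ, ← hoo]
    congr 1
    · exact Finset.sum_congr rfl fun i _ => by rw [hQu]; ring
    · ring
  rw [hquad, hsq, Finset.mul_sum]
  refine Finset.sum_le_sum fun i _ => ?_
  have h1 : 0 ≤ ((u i).ofLp ⬝ᵥ ξ) ^ 2 := sq_nonneg _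
  by_cases hi : i = l
  · rw [if_pos hi, hi, ← add_mul]
    refine mul_le_mul_of_nonneg_right ?_ (sq_nonneg _)
    nlinarith [min_le_right γ 1]
  · rw [if_neg hi, add_zero]
    refine mul_le_mul_of_nonneg_right (le_trans ?_ (hl' i hi)) h1
    exact mul_le_mul_of_nonneg_right (min_le_left _ _) hnr.le

end Spectral

/-! ### Comparison of the integrals -/

section Comparison

variable {n : ℕ} {G : SimpleGraph (Fin n)} [DecidableRel G.Adj] {κ : ℝ}

theorem cube_half_subset_nearDiagonal (n : ℕ) (ρ : ℝ) : cube n (ρ / 2) ⊆ nearDiagonal n ρ := by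
  intro ξ hξ j k
  have h1 := abs_sub (ξ j) (ξ k)
  linarith [hξ j, hξ k]

theorem cube_half_subset_cube {n : ℕ} {ρ : ℝ} (hρ : 0 ≤ ρ) : cube n (ρ / 2) ⊆ cube n ρ :=
  fun ξ hξ j => (hξ j).trans (by linarith)

namespace HasGap

theorem integrable_cexp_mainExponent (h : HasGap G κ) (hs : 1 / 2 ≤ 1 - 2 / (κ ^ 2 * n)) :
    Integrable fun ξ => Complex.exp (mainExponent G ξ) := by
  have hc : Continuous fun ξ => Complex.exp (mainExponent G ξ) := by
    have h1 := continuous_realExponent G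
    have h2 := continuous_dotProduct_left (lap G (α G))
    simp only [mainExponent_eq]
    fun_prop
  refine (h.integrable_gaussWeight (s := 1 - 2 / (κ ^ 2 * n)) (by linarith)).mono'
    hc.aestronglyMeasurable (Filter.Eventually.of_forall fun ξ => ?_)
  rw [norm_cexp_mainExponent]
  exact h.exp_realExponent_le ξ

/-- Truncating the main integral to a set containing a cube changes it by at most the Gaussian
weight of the complement of the cube. -/
theorem norm_setIntegral_sub_integral_le (h : HasGap G κ) (hs : 1 / 2 ≤ 1 - 2 / (κ ^ 2 * n))
    {δ t : ℝ} (ht : 0 ≤ t) {S : Set (Fin n → ℝ)} (hS : MeasurableSet S) (hδ : cube n δ ⊆ S) :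
    ‖(∫ ξ in S, Complex.exp (mainExponent G ξ)) - ∫ ξ, Complex.exp (mainExponent G ξ)‖ ≤
      n * (2 * Real.exp (4 / κ ^ 2) * Real.exp ((κ * n)⁻¹ * t ^ 2 - t * δ)) *
        ∫ ξ, gaussWeight G 1 ξ := by
  have hi := h.integrable_cexp_mainExponent hs
  have hg := h.integrable_gaussWeight (s := 1 - 2 / (κ ^ 2 * n)) (by linarith)
  refine le_trans ?_ (h.setIntegral_gaussWeight_le hs (h.inv_sqrt_pow_le hs) δ t ht)
  rw [← integral_add_compl hS hi, sub_add_cancel_left, norm_neg]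
  calc ‖∫ ξ in Sᶜ, Complex.exp (mainExponent G ξ)‖
      ≤ ∫ ξ in Sᶜ, gaussWeight G (1 - 2 / (κ ^ 2 * n)) ξ := by
        refine norm_integral_le_of_norm_le hg.integrableOn
          (Filter.Eventually.of_forall fun ξ => ?_)
        rw [norm_cexp_mainExponent]
        exact h.exp_realExponent_le ξ
    _ ≤ ∫ ξ in (cube n δ)ᶜ, gaussWeight G (1 - 2 / (κ ^ 2 * n)) ξ :=
        setIntegral_mono_set hg.integrableOn
          (Filter.Eventually.of_forall fun ξ => (gaussWeight_pos G _ ξ).le)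
          (Set.compl_subset_compl.2 hδ).eventuallyLE

/-- The pointwise relative error is integrated against a Gaussian majorant of the modulus, whose
mass is at most `exp (4 / κ²)` times the standard one. -/
theorem norm_setIntegral_integrand_sub_le (h : HasGap G κ) (hs : 1 / 2 ≤ 1 - 2 / (κ ^ 2 * n))
    {ρ η : ℝ} (hρ0 : 0 ≤ ρ) (hρ : ρ ≤ 1 / 2) (hρκ : 4 * ρ / κ ≤ 1 / 2)
    (hη : Real.exp ((n : ℝ) ^ 2 * ρ ^ 6 + ((128 * n * ρ ^ 3 / κ ^ 3) +
      (n * ρ ^ 3 / κ + 2 * n * ρ ^ 4 / κ ^ 2 + 2 * ρ ^ 2 / κ ^ 2))) - 1 ≤ η) :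
    ‖(∫ ξ in nearDiagonal n ρ, (n : ℂ) * (∑ r, integrand G r ξ) *
        ((Real.exp (-(1 / 2) * (∑ j, ξ j) ^ 2) : ℝ) : ℂ)) -
      ((Qhat G).det : ℂ) * ∫ ξ in nearDiagonal n ρ, Complex.exp (mainExponent G ξ)‖ ≤
      (Qhat G).det * (η * Real.exp (4 / κ ^ 2) * ∫ ξ, gaussWeight G 1 ξ) := by
  set s := 1 - 2 / (κ ^ 2 * n) with hsd
  have hs0 : 0 < s := by linarith
  have hd := h.det_pos
  set F : (Fin n → ℝ) → ℂ := fun ξ => (n : ℂ) * (∑ r, integrand G r ξ) *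
    ((Real.exp (-(1 / 2) * (∑ j, ξ j) ^ 2) : ℝ) : ℂ) with hF
  set E : (Fin n → ℝ) → ℂ := fun ξ => ((Qhat G).det : ℂ) * Complex.exp (mainExponent G ξ) with hE
  have hA := measurableSet_nearDiagonal (n := n) ρ
  have hg := h.integrable_gaussWeight hs0
  have hEi : Integrable E := (h.integrable_cexp_mainExponent hs).const_mul _
  have hFm : Measurable F := by
    have h1 : Measurable fun ξ : Fin n → ℝ => ∑ r, integrand G r ξ :=
      Finset.measurable_fun_sum _ fun r _ => measurable_integrand r
    have h2 : Measurable fun ξ : Fin n → ℝ => Real.exp (-(1 / 2) * (∑ j, ξ j) ^ 2) := by fun_prop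
    exact (h1.const_mul _).mul (Complex.measurable_ofReal.comp h2)
  have hb : ∀ ξ ∈ nearDiagonal n ρ, ‖F ξ - E ξ‖ ≤ (Qhat G).det * η * gaussWeight G s ξ := by
    intro ξ hξ
    obtain ⟨u, hu, hu'⟩ := h.integrand_expansion hρ0 hρ hρκ hξ
    have h1 : F ξ - E ξ = ((Qhat G).det : ℂ) * (Complex.exp (mainExponent G ξ) * (u - 1)) := by
      simp only [hF, hE]
      rw [hu']
      ring
    rw [h1, norm_mul, norm_mul, Complex.norm_real, Real.norm_of_nonneg hd.le,
      norm_cexp_mainExponent, mul_assoc, mul_comm η]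
    exact mul_le_mul_of_nonneg_left (mul_le_mul (h.exp_realExponent_le ξ) (hu.trans hη)
      (norm_nonneg _) (gaussWeight_pos G s ξ).le) hd.le
  have hgA : IntegrableOn (fun ξ => (Qhat G).det * η * gaussWeight G s ξ) (nearDiagonal n ρ) :=
    (hg.const_mul _).integrableOn
  have hae : ∀ᵐ ξ ∂volume.restrict (nearDiagonal n ρ),
      ‖F ξ - E ξ‖ ≤ (Qhat G).det * η * gaussWeight G s ξ :=
    (ae_restrict_iff' hA).2 (Filter.Eventually.of_forall hb)
  have hdi : IntegrableOn (fun ξ => F ξ - E ξ) (nearDiagonal n ρ) :=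
    hgA.mono' (hFm.aestronglyMeasurable.sub hEi.aestronglyMeasurable.restrict) hae
  have hFi : IntegrableOn F (nearDiagonal n ρ) :=
    (hdi.add hEi.integrableOn).congr (Filter.Eventually.of_forall fun ξ => by
      simp only [Pi.add_apply, sub_add_cancel])
  have hη0 : 0 ≤ η := by
    refine le_trans ?_ hη
    have := h.pos
    rw [sub_nonneg, Real.one_le_exp_iff]
    positivity
  rw [← integral_const_mul, ← integral_sub hFi hEi.integrableOn]
  calc ‖∫ ξ in nearDiagonal n ρ, (F ξ - E ξ)‖
      ≤ ∫ ξ in nearDiagonal n ρ, (Qhat G).det * η * gaussWeight G s ξ :=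
        norm_integral_le_of_norm_le hgA hae
    _ ≤ ∫ ξ, (Qhat G).det * η * gaussWeight G s ξ :=
        setIntegral_le_integral (hg.const_mul _) (Filter.Eventually.of_forall fun ξ =>
          mul_nonneg (mul_nonneg hd.le hη0) (gaussWeight_pos G s ξ).le)
    _ = (Qhat G).det * η * ((Real.sqrt s)⁻¹ ^ n * ∫ ξ, gaussWeight G 1 ξ) := by
        rw [integral_const_mul, integral_gaussWeight hs0]
    _ ≤ (Qhat G).det * η * (Real.exp (4 / κ ^ 2) * ∫ ξ, gaussWeight G 1 ξ) :=
        mul_le_mul_of_nonneg_left (mul_le_mul_of_nonneg_right (h.inv_sqrt_pow_le hs)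
          h.integral_gaussWeight_one_pos.le) (mul_nonneg hd.le hη0)
    _ = _ := by ring

/-- The relative error between `S₀` and its main term, for explicit values of the parameters. -/
theorem exists_S₀_eq (h : HasGap G κ) (hG : ∀ j, Even (G.degree j)) {ε c η τ : ℝ}
    (hs : 1 / 2 ≤ 1 - 2 / (κ ^ 2 * n)) (hρ : (n : ℝ) ^ (-(1 / 2 : ℝ) + ε) ≤ 1 / 2)
    (hρκ : 4 * (n : ℝ) ^ (-(1 / 2 : ℝ) + ε) / κ ≤ 1 / 2)
    (hη : Real.exp ((n : ℝ) ^ 2 * ((n : ℝ) ^ (-(1 / 2 : ℝ) + ε)) ^ 6 +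
      ((128 * n * ((n : ℝ) ^ (-(1 / 2 : ℝ) + ε)) ^ 3 / κ ^ 3) +
      (n * ((n : ℝ) ^ (-(1 / 2 : ℝ) + ε)) ^ 3 / κ +
        2 * n * ((n : ℝ) ^ (-(1 / 2 : ℝ) + ε)) ^ 4 / κ ^ 2 +
        2 * ((n : ℝ) ^ (-(1 / 2 : ℝ) + ε)) ^ 2 / κ ^ 2))) - 1 ≤ η)
    (hτ : n * (2 * Real.exp (4 / κ ^ 2) * Real.exp (1 / κ - (n : ℝ) ^ ε / 2)) ≤ τ)
    (hc : 0 < c) (hcτ : τ ≤ c)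
    (hmain : 2 * c ≤ Real.exp (-((κ ^ 3)⁻¹ / 2)) * Real.exp (-(4 * Real.exp 4 / κ ^ 3)) -
      4 * Real.exp (4 / κ ^ 2) * Real.exp 4 / κ ^ 3 * (Real.sqrt (κ * n))⁻¹) :
    ∃ δ : ℂ, ‖δ‖ ≤ (η * Real.exp (4 / κ ^ 2) + 2 * τ) / c ∧
      S₀ G ε = (1 + δ) * (((2 : ℝ) ^ (-(1 / 2 : ℝ)) * Real.pi ^ (1 / 2 : ℝ) * (n : ℝ)⁻¹ *
        (Qhat G).det : ℝ) : ℂ) * mainIntegral G ε := by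
  have hn : (0 : ℝ) < n := Nat.cast_pos.2 h.n_pos
  have hd := h.det_pos
  have hk := h.pos
  set ρ := (n : ℝ) ^ (-(1 / 2 : ℝ) + ε) with hρd
  have hρ0 : 0 ≤ ρ := Real.rpow_nonneg hn.le _
  set I₁ := ∫ ξ, gaussWeight G 1 ξ with hI₁
  have hI₁0 : 0 < I₁ := h.integral_gaussWeight_one_pos
  set A := ∫ ξ in nearDiagonal n ρ, (n : ℂ) * (∑ r, integrand G r ξ) *
        ((Real.exp (-(1 / 2) * (∑ j, ξ j) ^ 2) : ℝ) : ℂ)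
  set B := ∫ ξ in nearDiagonal n ρ, Complex.exp (mainExponent G ξ)
  set D := mainIntegral G ε with hD
  have hD' : D = ∫ ξ in cube n ρ, Complex.exp (mainExponent G ξ) := rfl
  set I := ∫ ξ, Complex.exp (mainExponent G ξ)
  -- The tilt `t = √n` with `δ = ρ / 2` gives `t² / (κ n) = 1 / κ` and `t δ = n^ε / 2`.
  have hexp : Real.exp ((κ * n)⁻¹ * Real.sqrt n ^ 2 - Real.sqrt n * (ρ / 2)) =
      Real.exp (1 / κ - (n : ℝ) ^ ε / 2) := by
    rw [Real.sq_sqrt hn.le, Real.sqrt_eq_rpow, mul_div_assoc', hρd, ← Real.rpow_add hn]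
    congr 2
    · field_simp
    · ring_nf
  have hAB : ‖A - ((Qhat G).det : ℂ) * B‖ ≤ (Qhat G).det * (η * Real.exp (4 / κ ^ 2) * I₁) :=
    h.norm_setIntegral_integrand_sub_le hs hρ0 hρ hρκ hη
  have hBI : ‖B - I‖ ≤ τ * I₁ := by
    have h1 := h.norm_setIntegral_sub_integral_le hs (Real.sqrt_nonneg n)
      (measurableSet_nearDiagonal ρ) (cube_half_subset_nearDiagonal n ρ)
    rw [hexp] at h1
    exact h1.trans (mul_le_mul_of_nonneg_right hτ hI₁0.le)
  have hDI : ‖D - I‖ ≤ τ * I₁ := by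
    have h1 := h.norm_setIntegral_sub_integral_le hs (Real.sqrt_nonneg n)
      (measurableSet_cube n ρ) (cube_half_subset_cube hρ0)
    rw [hexp] at h1
    exact h1.trans (mul_le_mul_of_nonneg_right hτ hI₁0.le)
  have hI : 2 * c * I₁ ≤ ‖I‖ :=
    (mul_le_mul_of_nonneg_right hmain hI₁0.le).trans (h.le_norm_integral_cexp_mainExponent hs)
  -- Truncation costs at most `τ I₁ ≤ c I₁`, half of the lower bound for the full integral.
  have hDn : c * I₁ ≤ ‖D‖ := by
    have h1 := norm_sub_norm_le I D
    rw [norm_sub_rev] at h1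
    have h2 := mul_le_mul_of_nonneg_right hcτ hI₁0.le
    linarith
  have hDpos : 0 < ‖D‖ := (_root_.mul_pos hc hI₁0).trans_le hDn
  have hD0 : D ≠ 0 := norm_pos_iff.1 hDpos
  have hd0 : ((Qhat G).det : ℂ) ≠ 0 := Complex.ofReal_ne_zero.2 hd.ne'
  have hAD : ‖A - ((Qhat G).det : ℂ) * D‖ ≤
      (Qhat G).det * ((η * Real.exp (4 / κ ^ 2) + 2 * τ) * I₁) := by
    have h1 : A - ((Qhat G).det : ℂ) * D = (A - ((Qhat G).det : ℂ) * B) +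
        ((Qhat G).det : ℂ) * ((B - I) - (D - I)) := by ring
    rw [h1]
    refine (norm_add_le _ _).trans ?_
    rw [norm_mul, Complex.norm_real, Real.norm_of_nonneg hd.le]
    have h2 : ‖(B - I) - (D - I)‖ ≤ 2 * τ * I₁ := (norm_sub_le _ _).trans (by linarith)
    nlinarith [mul_le_mul_of_nonneg_left h2 hd.le]
  have hconst : (2 : ℝ) ^ (-(1 / 2 : ℝ)) * Real.pi ^ (1 / 2 : ℝ) * (n : ℝ)⁻¹ =
      Real.pi / Real.sqrt (2 * Real.pi) / n := by
    rw [Real.rpow_neg (by norm_num), ← Real.sqrt_eq_rpow, ← Real.sqrt_eq_rpow,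
      Real.sqrt_mul (by norm_num), div_eq_mul_inv _ (n : ℝ)]
    congr 1
    have h1 := Real.sq_sqrt Real.pi_pos.le
    have h2 := Real.sqrt_pos.2 Real.pi_pos
    field_simp
    linarith
  refine ⟨(A - ((Qhat G).det : ℂ) * D) / (((Qhat G).det : ℂ) * D), ?_, ?_⟩
  · rw [norm_div, norm_mul, Complex.norm_real, Real.norm_of_nonneg hd.le,
      div_le_div_iff₀ (_root_.mul_pos hd hDpos) hc]
    have hη0 : 0 ≤ η * Real.exp (4 / κ ^ 2) + 2 * τ := by
      have h1 : 0 ≤ (Qhat G).det * ((η * Real.exp (4 / κ ^ 2) + 2 * τ) * I₁) :=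
        (norm_nonneg _).trans hAD
      exact nonneg_of_mul_nonneg_left (nonneg_of_mul_nonneg_right h1 hd) hI₁0
    calc _ ≤ (Qhat G).det * ((η * Real.exp (4 / κ ^ 2) + 2 * τ) * I₁) * c :=
          mul_le_mul_of_nonneg_right hAD hc.le
      _ = (η * Real.exp (4 / κ ^ 2) + 2 * τ) * ((Qhat G).det * (c * I₁)) := by ring
      _ ≤ _ := mul_le_mul_of_nonneg_left (mul_le_mul_of_nonneg_left hDn hd.le) hη0
  · rw [S₀_eq hG h.n_pos hρ, hconst]
    change _ * A = _
    rw [Complex.ofReal_mul (Real.pi / Real.sqrt (2 * Real.pi) / n)]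
    generalize ((Real.pi / Real.sqrt (2 * Real.pi) / n : ℝ) : ℂ) = w
    field_simp
    ring

end HasGap

end Comparison

/-! ### Asymptotics -/

section Asymptotics

open Filter Topology

theorem tendsto_natCast_rpow_neg {a : ℝ} (ha : a < 0) :
    Tendsto (fun n : ℕ => (n : ℝ) ^ a) atTop (𝓝 0) := by
  have h := (tendsto_rpow_neg_atTop (neg_pos.2 ha)).comp
    (tendsto_natCast_atTop_atTop (R := ℝ))
  simpa only [neg_neg] using! h

theorem tendsto_rpow_mul_exp_neg_rpow {ε : ℝ} (hε : 0 < ε) (a : ℝ) :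
    Tendsto (fun n : ℕ => (n : ℝ) ^ a * Real.exp (-((n : ℝ) ^ ε / 2))) atTop (𝓝 0) := by
  have h1 : Tendsto (fun n : ℕ => (n : ℝ) ^ ε) atTop atTop :=
    (tendsto_rpow_atTop hε).comp tendsto_natCast_atTop_atTop
  refine ((tendsto_rpow_mul_exp_neg_mul_atTop_nhds_zero (a / ε) (1 / 2) (by norm_num)).comp
    h1).congr fun n => ?_
  simp only [Function.comp_apply]
  rw [← Real.rpow_mul (Nat.cast_nonneg n), mul_div_cancel₀ _ hε.ne']
  congr 2
  ring

/-- The factor `exp (-n^ε / 2)` beats every power of `n`, here `n^(3/2)`, so the tail is even below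
`n^(-1/2)`. -/
theorem eventually_mul_exp_le {ε : ℝ} (hε : 0 < ε) (K b : ℝ) :
    ∀ᶠ n : ℕ in atTop, n * (2 * Real.exp K * Real.exp (b - (n : ℝ) ^ ε / 2)) ≤
      (n : ℝ) ^ (-(1 / 2 : ℝ) + 6 * ε) := by
  have h1 := (tendsto_rpow_mul_exp_neg_rpow hε (3 / 2)).const_mul (2 * Real.exp K * Real.exp b)
  rw [mul_zero] at h1
  filter_upwards [h1.eventually_le_const one_pos, eventually_ge_atTop 1] with n h2 hn
  have hn1 : (1 : ℝ) ≤ n := by exact_mod_cast hn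
  have hn0 : (0 : ℝ) < n := by linarith
  have h3 : (n : ℝ) = (n : ℝ) ^ (-(1 / 2) : ℝ) * (n : ℝ) ^ (3 / 2 : ℝ) := by
    rw [← Real.rpow_add hn0]
    norm_num
  calc n * (2 * Real.exp K * Real.exp (b - (n : ℝ) ^ ε / 2))
      = (n : ℝ) ^ (-(1 / 2) : ℝ) * (2 * Real.exp K * Real.exp b *
          ((n : ℝ) ^ (3 / 2 : ℝ) * Real.exp (-((n : ℝ) ^ ε / 2)))) := by
        rw [sub_eq_add_neg, Real.exp_add]
        nth_rewrite 1 [h3]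
        ring
    _ ≤ (n : ℝ) ^ (-(1 / 2) : ℝ) * 1 :=
        mul_le_mul_of_nonneg_left h2 (Real.rpow_nonneg hn0.le _)
    _ ≤ (n : ℝ) ^ (-(1 / 2 : ℝ) + 6 * ε) := by
        rw [mul_one]
        exact Real.rpow_le_rpow_of_exponent_le hn1 (by linarith)

/-- With `ρ = n^(-1/2 + ε)` the terms have exponents `-1 + 6ε`, `-1/2 + 3ε`, `-1 + 4ε` and `-1 +
2ε`, all at most `-1/2 + 6ε`. -/
theorem error_exponent_le {n κ ε : ℝ} (hn : 1 ≤ n) (hκ : 0 < κ) (hε : 0 < ε) (hε' : ε < 1 / 12) :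
    n ^ 2 * (n ^ (-(1 / 2 : ℝ) + ε)) ^ 6 + ((128 * n * (n ^ (-(1 / 2 : ℝ) + ε)) ^ 3 / κ ^ 3) +
      (n * (n ^ (-(1 / 2 : ℝ) + ε)) ^ 3 / κ + 2 * n * (n ^ (-(1 / 2 : ℝ) + ε)) ^ 4 / κ ^ 2 +
        2 * (n ^ (-(1 / 2 : ℝ) + ε)) ^ 2 / κ ^ 2)) ≤
      (1 + 128 / κ ^ 3 + 1 / κ + 4 / κ ^ 2) * n ^ (-(1 / 2 : ℝ) + 6 * ε) := by
  have hn0 : 0 < n := by linarith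
  have hpow : ∀ (m k : ℕ), ((m : ℝ) + (-(1 / 2) + ε) * k ≤ -(1 / 2) + 6 * ε) →
      n ^ m * (n ^ (-(1 / 2 : ℝ) + ε)) ^ k ≤ n ^ (-(1 / 2 : ℝ) + 6 * ε) := by
    intro m k hmk
    rw [← Real.rpow_natCast n m, ← Real.rpow_mul_natCast hn0.le, ← Real.rpow_add hn0]
    exact Real.rpow_le_rpow_of_exponent_le hn hmk
  have h6 := hpow 2 6 (by norm_num; linarith)
  have h3 := hpow 1 3 (by norm_num; linarith)
  have h4 := hpow 1 4 (by norm_num; linarith)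
  have h2 := hpow 0 2 (by norm_num; linarith)
  rw [pow_one] at h3 h4
  rw [pow_zero, one_mul] at h2
  set y := n ^ (-(1 / 2 : ℝ) + 6 * ε)
  set ρ := n ^ (-(1 / 2 : ℝ) + ε)
  have e1 : 128 * n * ρ ^ 3 / κ ^ 3 ≤ 128 / κ ^ 3 * y := by
    have := mul_le_mul_of_nonneg_left h3 (by positivity : 0 ≤ 128 / κ ^ 3)
    exact le_trans (le_of_eq (by ring)) this
  have e2 : n * ρ ^ 3 / κ ≤ 1 / κ * y := by
    have := mul_le_mul_of_nonneg_left h3 (by positivity : 0 ≤ 1 / κ)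
    exact le_trans (le_of_eq (by ring)) this
  have e3 : 2 * n * ρ ^ 4 / κ ^ 2 ≤ 2 / κ ^ 2 * y := by
    have := mul_le_mul_of_nonneg_left h4 (by positivity : 0 ≤ 2 / κ ^ 2)
    exact le_trans (le_of_eq (by ring)) this
  have e4 : 2 * ρ ^ 2 / κ ^ 2 ≤ 2 / κ ^ 2 * y := by
    have := mul_le_mul_of_nonneg_left h2 (by positivity : 0 ≤ 2 / κ ^ 2)
    exact le_trans (le_of_eq (by ring)) this
  have e5 : (1 + 128 / κ ^ 3 + 1 / κ + 4 / κ ^ 2) * y =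
      y + (128 / κ ^ 3 * y + (1 / κ * y + 2 / κ ^ 2 * y + 2 / κ ^ 2 * y)) := by ring
  rw [e5]
  gcongr

end Asymptotics

/-- The contribution of the main region agrees with the main term up to a relative error
`O(n ^ (-1/2 + 6 ε))`, uniformly over `γ`-mixing graphs with even degrees. -/
theorem exists_forall_S₀_eq {γ : ℝ} (hγ : 0 < γ) {ε : ℝ} (hε : 0 < ε) (hε' : ε < 1 / 12) :
    ∃ C : ℝ, 0 < C ∧ ∃ n₀ : ℕ, ∀ n : ℕ, n₀ ≤ n →
      ∀ (G : SimpleGraph (Fin n)) [DecidableRel G.Adj],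
        (∀ j, Even (G.degree j)) → IsMixing G γ →
          ∃ δ : ℂ, ‖δ‖ ≤ C * (n : ℝ) ^ (-(1 / 2 : ℝ) + 6 * ε) ∧
            S₀ G ε =
              (1 + δ) *
                (((2 : ℝ) ^ (-(1 / 2 : ℝ)) * Real.pi ^ (1 / 2 : ℝ) * (n : ℝ)⁻¹ *
                  (Qhat G).det : ℝ) : ℂ) *
                mainIntegral G ε := by
  set κ := min γ 1
  have hκ : 0 < κ := lt_min hγ one_pos
  set c₀ := Real.exp (-((κ ^ 3)⁻¹ / 2)) * Real.exp (-(4 * Real.exp 4 / κ ^ 3))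
  have hc₀ : 0 < c₀ := mul_pos (Real.exp_pos _) (Real.exp_pos _)
  set C₁ := 1 + 128 / κ ^ 3 + 1 / κ + 4 / κ ^ 2
  have hC₁ : 0 < C₁ := by positivity
  set L := 4 * Real.exp (4 / κ ^ 2) * Real.exp 4 / κ ^ 3
  have hsmall : Filter.Tendsto (fun n : ℕ => (n : ℝ) ^ (-(1 / 2 : ℝ) + 6 * ε)) Filter.atTop
      (nhds 0) := tendsto_natCast_rpow_neg (by linarith)
  have hρ : Filter.Tendsto (fun n : ℕ => (n : ℝ) ^ (-(1 / 2 : ℝ) + ε)) Filter.atTop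
      (nhds 0) := tendsto_natCast_rpow_neg (by linarith)
  have hL : Filter.Tendsto (fun n : ℕ => L * (Real.sqrt (κ * n))⁻¹) Filter.atTop (nhds 0) := by
    have h1 : Filter.Tendsto (fun n : ℕ => Real.sqrt (κ * n)) Filter.atTop Filter.atTop :=
      Real.tendsto_sqrt_atTop.comp (tendsto_natCast_atTop_atTop.const_mul_atTop hκ)
    simpa using h1.inv_tendsto_atTop.const_mul L
  have hs : Filter.Tendsto (fun n : ℕ => 2 / (κ ^ 2 * n)) Filter.atTop (nhds 0) :=
    Filter.Tendsto.const_div_atTop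
      (tendsto_natCast_atTop_atTop.const_mul_atTop (pow_pos hκ 2)) 2
  -- This is the explicit relative error with `c = c₀ / 4`, `τ = y` and `η = 2 C₁ y`, where `y =
  -- n^(-1/2 + 6ε)` is factored out.
  refine ⟨(2 * C₁ * Real.exp (4 / κ ^ 2) + 2) / (c₀ / 4), by positivity, ?_⟩
  -- The bound `C₁⁻¹` linearises `exp (C₁ y) - 1`, the bound `c₀ / 4` gives `τ ≤ c`, and the bound
  -- `c₀ / 2` on the oscillation error leaves `2c = c₀ / 2`.
  obtain ⟨n₀, hn₀⟩ := Filter.eventually_atTop.1 ((((((Filter.eventually_ge_atTop 2).and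
    (hs.eventually_le_const (by norm_num : (0 : ℝ) < 1 / 2))).and
    (hρ.eventually_le_const (lt_min (by norm_num : (0 : ℝ) < 1 / 2)
      (by positivity : 0 < κ / 8)))).and
    (hsmall.eventually_le_const (lt_min (by positivity : 0 < C₁⁻¹)
      (by positivity : 0 < c₀ / 4)))).and
    (hL.eventually_le_const (by positivity : 0 < c₀ / 2))).and
    (eventually_mul_exp_le hε (4 / κ ^ 2) (1 / κ)))
  refine ⟨n₀, fun n hn G _ hG hmix => ?_⟩
  obtain ⟨⟨⟨⟨⟨hn2, h1⟩, h2⟩, h3⟩, h4⟩, h5⟩ := hn₀ n hn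
  have hn1 : (1 : ℝ) ≤ n := by
    have : 1 ≤ n := by omega
    exact_mod_cast this
  have hgap : HasGap G κ := hmix.hasGap hγ hn2
  have hx := error_exponent_le hn1 hκ hε hε'
  set y := (n : ℝ) ^ (-(1 / 2 : ℝ) + 6 * ε)
  have hy0 : 0 ≤ y := Real.rpow_nonneg (by linarith) _
  have hCy : C₁ * y ≤ 1 := by
    have := mul_le_mul_of_nonneg_left (h3.trans (min_le_left _ _)) hC₁.le
    rwa [mul_inv_cancel₀ hC₁.ne'] at this
  have hη : Real.exp (C₁ * y) - 1 ≤ 2 * C₁ * y := by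
    have h6 : 0 ≤ C₁ * y := mul_nonneg hC₁.le hy0
    have h7 := Real.abs_exp_sub_one_le (x := C₁ * y) (by rwa [abs_of_nonneg h6])
    rw [abs_of_nonneg h6] at h7
    linarith [le_abs_self (Real.exp (C₁ * y) - 1)]
  obtain ⟨δ, hδ, hS⟩ := hgap.exists_S₀_eq hG (ε := ε) (c := c₀ / 4) (η := 2 * C₁ * y) (τ := y)
    (by linarith) (h2.trans (min_le_left _ _))
    (by
      rw [div_le_iff₀ hκ]
      linarith [h2.trans (min_le_right _ _)])
    ((sub_le_sub_right (Real.exp_le_exp.2 hx) 1).trans hη) h5 (by positivity)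
    (h3.trans (min_le_right _ _)) (by linarith)
  refine ⟨δ, hδ.trans (le_of_eq ?_), hS⟩
  ring

end EulerianCircuits

end

theorem proposition3p1 (γ : ℝ) (hγ : 0 < γ) (ε : ℝ) (hε : 0 < ε) (hε' : ε < 1 / 12) :
    ∃ C : ℝ, 0 < C ∧ ∃ n₀ : ℕ, ∀ n : ℕ, n₀ ≤ n →
      ∀ (G : SimpleGraph (Fin n)) [DecidableRel G.Adj],
        (∀ j, Even (G.degree j)) → EulerianCircuits.IsMixing G γ →
          ∃ δ : ℂ, ‖δ‖ ≤ C * (n : ℝ) ^ (-(1 / 2 : ℝ) + 6 * ε) ∧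
            EulerianCircuits.S₀ G ε =
              (1 + δ) *
                (((2 : ℝ) ^ (-(1 / 2 : ℝ)) * Real.pi ^ (1 / 2 : ℝ) * (n : ℝ)⁻¹ *
                  (EulerianCircuits.Qhat G).det : ℝ) : ℂ) *
                EulerianCircuits.mainIntegral G ε :=
  EulerianCircuits.exists_forall_S₀_eq hγ hε hε'
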